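/- Corollary 2 (Minimax). Consider the federated stochastic minimax problem over $m\ge 1$ clients $$\min_{x\in\mathbb R^{d_1}} f(x):=\max_{y\in\mathbb R^{d_2}}\frac1m\sum_{i=1}^m f_i(x,y),\qquad f_i(x,y)=\mathbb E_{\xi\sim\mathcal C_i}[f_i(x,y;\xi)],\qquad d_2\ge 1,$$ and let $y^*(x)$ denote the maximizer. Write $z=(x,y)$ and assume, for every client $i$: $f_i$ is twice continuously differentiable and $x\mapsto f_i(x,y)$ is $\ell_{f,0}$-Lipschitz for every $y$; $\nabla f_i$ and $\nabla^2 f_i$ are $\ell_{f,1}$- and $\ell_{f,2}$-Lipschitz in $z$; $y\mapsto f_i(x,y)$ is $\mu_f$-strongly concave for every $x$; $f_i(\cdot;\xi)$ is differentiable, and $\nabla f_i(z;\xi)$ is an unbiased estimator of $\nabla f_i(z)$ with variance at most $\sigma_f^2$. Assume also that $f$ is bounded below. Put $\kappa_f=\ell_{f,1}/\mu_f$. FedNest starts from $(x^0,y^0)$ and performs $K$ outer rounds with step sizes $\alpha_k=\min\{\bar\alpha_1,\bar\alpha_2,\bar\alpha_3,\bar\alpha/\sqrt K\}$ and $\beta_k=\bar\beta\alpha_k/T$.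 In round $k$, put $y^{k,0}=y^k$. For $t=0,\dots,T-1$, with $x=x^k$ and $y=y^{k,t}$, client $i$ starts from $y_{i,0}=y$ and makes $\tau_i\ge1$ local steps $$y_{i,\nu+1}=y_{i,\nu}+\tfrac{\beta_k}{\tau_i}\Big(\nabla_yf_i(x,y_{i,\nu};\xi_{i,\nu})-\nabla_yf_i(x,y;\xi_{i,\nu})+\tfrac1m\sum_{j=1}^m\nabla_yf_j(x,y;\xi_j)\Big),$$ and $y^{k,t+1}=\frac1m\sum_i y_{i,\tau_i}$. Then $y^{k+1}=y^{k,T}$, and with $x=x^k$, $x_{i,0}=x$, $y^+=y^{k+1}$, $$x_{i,\nu+1}=x_{i,\nu}-\tfrac{\alpha_k}{\tau_i}\Big(\nabla_xf_i(x_{i,\nu},y^+;\xi_{i,\nu})-\nabla_xf_i(x,y^+;\xi_{i,\nu})+\tfrac1m\sum_{j=1}^m\nabla_xf_j(x,y^+;\xi_j)\Big),$$ and $x^{k+1}=\frac1m\sum_i x_{i,\tau_i}$. Each symbol $\xi_j$ and $\xi_{i,\nu}$ is one single sample (batch size one), drawn from the distribution of its client; the samples are fresh in every call and all are independent. Let $c>0$.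 There is a constant $C>0$, depending only on $\ell_{f,0},\ell_{f,1},\ell_{f,2},\sigma_f,c$, such that for every $\mu_f>0$ and every $T$ of order $\kappa_f$, meaning $\kappa_f\le cT$ and $T\le c\,\kappa_f$, there are positive constants $\bar\alpha_1,\bar\alpha_2,\bar\alpha_3,\bar\alpha,\bar\beta$, depending only on $\ell_{f,0},\ell_{f,1},\ell_{f,2},\sigma_f,c,\mu_f,T$ (in particular not on $K$), such that for every problem as above and every starting point the maximizer $y^*(x)$ exists for all $x$, $f$ is differentiable, and with $\Delta=1+f(x^0)-\inf f+\|y^0-y^*(x^0)\|^2$ the following holds. (a) For every $K\ge1$, $$\frac1K\sum_{k=1}^K\mathbb E\|\nabla f(x^k)\|^2\le C\Delta\Big(\frac{\kappa_f^2}{K}+\frac{\kappa_f}{\sqrt K}\Big).$$ (b) For every $0<\epsilon\le1$ there is $K\ge 1$ with $K\le C\Delta^2\kappa_f^2\epsilon^{-2}$ for which the left-hand side in (a) is at most $\epsilon$ and the total number of samples drawn by all clients in the $K$ rounds is at most $C\Delta^2\big(\sum_i\tau_i\big)\kappa_f^3\epsilon^{-2}$. -/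

import Mathlib

open MeasureTheory ProbabilityTheory

noncomputable section

namespace FedNest

/-- `ℝ^d` with the Euclidean norm. -/
abbrev Vec (d : ℕ) : Type := EuclideanSpace ℝ (Fin d)

/-- `ℝ^(d₁+d₂)`, written as pairs `z = (x, y)`, with the Euclidean norm
`‖z‖² = ‖x‖² + ‖y‖²`. -/
abbrev Pt (d₁ d₂ : ℕ) : Type := WithLp 2 (Vec d₁ × Vec d₂)

/-- The point `z = (x, y)`. -/
def pt {d₁ d₂ : ℕ} (x : Vec d₁) (y : Vec d₂) : Pt d₁ d₂ := WithLp.toLp 2 (x, y)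

/-- Data of a federated stochastic minimax problem with `m` clients: the sampled losses
`f_i(z; ξ)` and the sampling distributions `𝒞_i`. -/
structure Problem (d₁ d₂ m : ℕ) (Ξ : Type*) [MeasurableSpace Ξ] where
  loss : Fin m → Pt d₁ d₂ → Ξ → ℝ
  law : Fin m → Measure Ξ
  law_prob : ∀ i, IsProbabilityMeasure (law i)

variable {d₁ d₂ m : ℕ} {Ξ : Type*} [MeasurableSpace Ξ]

namespace Problem

/-- Client objective `f_i(z) = E_{ξ ∼ 𝒞_i} f_i(z; ξ)`. -/
def clientObj (P : Problem d₁ d₂ m Ξ) (i : Fin m) (z : Pt d₁ d₂) : ℝ :=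
  ∫ s, P.loss i z s ∂(P.law i)

/-- `(1/m) ∑ i, f_i(x, y)`. -/
def obj (P : Problem d₁ d₂ m Ξ) (x : Vec d₁) (y : Vec d₂) : ℝ :=
  (1 / (m : ℝ)) * ∑ i, P.clientObj i (pt x y)

/-- `y*(x)`, a maximizer of `y ↦ (1/m) ∑ i, f_i(x, y)`. -/
def yStar (P : Problem d₁ d₂ m Ξ) (x : Vec d₁) : Vec d₂ :=
  Classical.epsilon fun y => IsMaxOn (P.obj x) Set.univ y

/-- The objective to be minimized, `f(x) = max_y (1/m) ∑ i, f_i(x, y)`, written as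
`(1/m) ∑ i, f_i(x, y*(x))`. -/
def outer (P : Problem d₁ d₂ m Ξ) (x : Vec d₁) : ℝ := P.obj x (P.yStar x)

/-- The stochastic gradient `∇ f_i(z; ξ)` with respect to `z = (x, y)`. -/
def stochGrad (P : Problem d₁ d₂ m Ξ) (i : Fin m) (z : Pt d₁ d₂) (s : Ξ) : Pt d₁ d₂ :=
  gradient (fun w => P.loss i w s) z

/-- `∇_x f_i(x, y; ξ)`. -/
def gradX (P : Problem d₁ d₂ m Ξ) (i : Fin m) (x : Vec d₁) (y : Vec d₂) (s : Ξ) : Vec d₁ :=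
  (P.stochGrad i (pt x y) s).fst

/-- `∇_y f_i(x, y; ξ)`. -/
def gradY (P : Problem d₁ d₂ m Ξ) (i : Fin m) (x : Vec d₁) (y : Vec d₂) (s : Ξ) : Vec d₂ :=
  (P.stochGrad i (pt x y) s).snd

/-- Well-behaved objectives: Lipschitz conditions on `f_i` (in `x`), on the gradient and on the
Hessian (in the operator norm), and strong concavity of each `f_i` in `y`. -/
structure WellBehaved (P : Problem d₁ d₂ m Ξ) (ℓ₀ ℓ₁ ℓ₂ μ : ℝ) : Prop where
  smooth : ∀ i, ContDiff ℝ 2 (P.clientObj i)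
  lip_obj : ∀ i x x' y,
    |P.clientObj i (pt x y) - P.clientObj i (pt x' y)| ≤ ℓ₀ * ‖x - x'‖
  lip_grad : ∀ i z z',
    ‖gradient (P.clientObj i) z - gradient (P.clientObj i) z'‖ ≤ ℓ₁ * ‖z - z'‖
  lip_hess : ∀ i z z',
    ‖fderiv ℝ (gradient (P.clientObj i)) z - fderiv ℝ (gradient (P.clientObj i)) z'‖
      ≤ ℓ₂ * ‖z - z'‖
  concave : ∀ i x, StrongConcaveOn Set.univ μ fun y => P.clientObj i (pt x y)

/-- Stochastic samples: `∇ f_i(z; ξ)` is an unbiased estimator of `∇ f_i(z)` with variance at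
most `σ²` (and the expectations defining `f_i` and its gradient make sense). -/
structure GoodSamples (P : Problem d₁ d₂ m Ξ) (σ : ℝ) : Prop where
  meas : ∀ i z, Measurable (P.loss i z)
  integrable : ∀ i z, Integrable (P.loss i z) (P.law i)
  diff : ∀ i s, Differentiable ℝ fun z => P.loss i z s
  grad_integrable : ∀ i z, Integrable (P.stochGrad i z) (P.law i)
  unbiased : ∀ i z, ∫ s, P.stochGrad i z s ∂(P.law i) = gradient (P.clientObj i) z
  var_integrable : ∀ i z,
    Integrable (fun s => ‖P.stochGrad i z s - gradient (P.clientObj i) z‖ ^ 2) (P.law i)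
  var_le : ∀ i z,
    ∫ s, ‖P.stochGrad i z s - gradient (P.clientObj i) z‖ ^ 2 ∂(P.law i) ≤ σ ^ 2

/-- Local iterates `y_{i,ν}` of client `i` in the inner optimizer, with local step size `b`,
aggregated direction `q` and samples `s ν = ξ_{i,ν}`; here `𝔾_i = -∇_y f_i(x, ·)`. -/
def fedInnLocal (P : Problem d₁ d₂ m Ξ) (i : Fin m) (b : ℝ) (x : Vec d₁) (y q : Vec d₂)
    (s : ℕ → Ξ) : ℕ → Vec d₂
  | 0 => y
  | ν + 1 =>
    fedInnLocal P i b x y q s ν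
      - b • (-P.gradY i x (fedInnLocal P i b x y q s ν) (s ν) - -P.gradY i x y (s ν) + q)

/-- One call `y⁺ = FedInn(x, y, β)`; `s i none = ξ_i` and `s i (some ν) = ξ_{i,ν}`. -/
def fedInn (P : Problem d₁ d₂ m Ξ) (τ : Fin m → ℕ) (β : Fin m → ℝ) (x : Vec d₁) (y : Vec d₂)
    (s : Fin m → Option ℕ → Ξ) : Vec d₂ :=
  (1 / (m : ℝ)) • ∑ i, P.fedInnLocal i (β i) x y
    ((1 / (m : ℝ)) • ∑ j, -P.gradY j x y (s j none)) (fun ν => s i (some ν)) (τ i)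

/-- Local iterates `x_{i,ν}` of client `i` in the outer optimizer, with local step size `a`,
aggregated direction `h` and samples `s ν = ξ_{i,ν}`; here `𝔽_i = ∇_x f_i(·, y⁺)`. -/
def fedOutLocal (P : Problem d₁ d₂ m Ξ) (i : Fin m) (a : ℝ) (x : Vec d₁) (yp : Vec d₂)
    (h : Vec d₁) (s : ℕ → Ξ) : ℕ → Vec d₁
  | 0 => x
  | ν + 1 =>
    fedOutLocal P i a x yp h s ν
      - a • (P.gradX i (fedOutLocal P i a x yp h s ν) yp (s ν) - P.gradX i x yp (s ν) + h)

/-- One call `x⁺ = FedOut(x, y⁺, α)`; `s i none = ξ_i` and `s i (some ν) = ξ_{i,ν}`. -/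
def fedOut (P : Problem d₁ d₂ m Ξ) (τ : Fin m → ℕ) (α : Fin m → ℝ) (x : Vec d₁) (yp : Vec d₂)
    (s : Fin m → Option ℕ → Ξ) : Vec d₁ :=
  (1 / (m : ℝ)) • ∑ i, P.fedOutLocal i (α i) x yp
    ((1 / (m : ℝ)) • ∑ j, P.gradX j x yp (s j none)) (fun ν => s i (some ν)) (τ i)

/-- Inner loop: `y^{k,0} = y` and `y^{k,t+1} = FedInn(x, y^{k,t}, β)`. -/
def innerIter (P : Problem d₁ d₂ m Ξ) (τ : Fin m → ℕ) (β : Fin m → ℝ) (x : Vec d₁) (y : Vec d₂)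
    (s : ℕ → Fin m → Option ℕ → Ξ) : ℕ → Vec d₂
  | 0 => y
  | t + 1 => P.fedInn τ β x (innerIter P τ β x y s t) (s t)

end Problem

/-- Labels of the samples, `(k, stage, i, slot)`: outer round `k`; `stage = some t` for the
`t`-th call of `FedInn` and `stage = none` for the call of `FedOut` in that round; client `i`;
`slot = none` for the sample `ξ_i` used in the aggregated direction and `slot = some ν` for the
sample `ξ_{i,ν}` of the `ν`-th local step. Each label stands for one single sample. -/
abbrev SampleIdx (m : ℕ) : Type := ℕ × Option ℕ × (_ : Fin m) × Option ℕ

/-- The client that draws a sample. -/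
def SampleIdx.client {m : ℕ} (j : SampleIdx m) : Fin m := j.2.2.1

/-- The samples drawn by a run of `K` outer rounds, each with `T` calls of `FedInn` and one call
of `FedOut`, where client `i` makes `τ i` local steps per call. -/
def samplesUsed {m : ℕ} (τ : Fin m → ℕ) (T K : ℕ) : Finset (SampleIdx m) :=
  Finset.range K ×ˢ Finset.insertNone (Finset.range T) ×ˢ
    Finset.univ.sigma fun i => Finset.insertNone (Finset.range (τ i))

/-- All samples are independent and those of client `i` have law `𝒞_i`. -/
structure IsSampling (P : Problem d₁ d₂ m Ξ) {Ω : Type*} [MeasurableSpace Ω] (Pr : Measure Ω)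
    (ξ : SampleIdx m → Ω → Ξ) : Prop where
  meas : ∀ j, Measurable (ξ j)
  indep : iIndepFun ξ Pr
  law : ∀ j, Measure.map (ξ j) Pr = P.law j.client

namespace Problem

/-- The iterates `(x^k, y^k)` of FedNest, as a function of the samples `s`; `α k i` and `β k i`
are the local step sizes of client `i` in round `k`. -/
def fedNest (P : Problem d₁ d₂ m Ξ) (τ : Fin m → ℕ) (T : ℕ) (α β : ℕ → Fin m → ℝ)
    (x₀ : Vec d₁) (y₀ : Vec d₂) (s : SampleIdx m → Ξ) : ℕ → Vec d₁ × Vec d₂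
  | 0 => (x₀, y₀)
  | k + 1 =>
    let p := fedNest P τ T α β x₀ y₀ s k
    let yp := P.innerIter τ (β k) p.1 p.2 (fun t i j => s (k, some t, ⟨i, j⟩)) T
    (P.fedOut τ (α k) p.1 yp (fun i j => s (k, none, ⟨i, j⟩)), yp)

end Problem

/-- The constants from which the step sizes are built. -/
structure StepParams where
  a₁ : ℝ
  a₂ : ℝ
  a₃ : ℝ
  a : ℝ
  b : ℝ
  a₁_pos : 0 < a₁
  a₂_pos : 0 < a₂
  a₃_pos : 0 < a₃
  a_pos : 0 < a
  b_pos : 0 < b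

/-- `α_k = min {a₁, a₂, a₃, a / √K}`. -/
def StepParams.alpha (S : StepParams) (K : ℕ) : ℝ :=
  min (min (min S.a₁ S.a₂) S.a₃) (S.a / √(K : ℝ))

/-- `β_k = b α_k / T`. -/
def StepParams.beta (S : StepParams) (T K : ℕ) : ℝ := S.b * S.alpha K / T

namespace Problem

/-- The outer iterate `x^k` of FedNest with horizon `K` and local step sizes
`α_i^k = α_k / τ_i`, `β_i^k = β_k / τ_i`. -/
def xIter (P : Problem d₁ d₂ m Ξ) (τ : Fin m → ℕ) (T K : ℕ) (S : StepParams)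
    (x₀ : Vec d₁) (y₀ : Vec d₂) (s : SampleIdx m → Ξ) (k : ℕ) : Vec d₁ :=
  (P.fedNest τ T (fun _ i => S.alpha K / τ i) (fun _ i => S.beta T K / τ i) x₀ y₀ s k).1

/-- `‖∇ f(x^k)‖²` as a random variable. -/
def gradSq (P : Problem d₁ d₂ m Ξ) (τ : Fin m → ℕ) (T K : ℕ) (S : StepParams)
    (x₀ : Vec d₁) (y₀ : Vec d₂) {Ω : Type*} (ξ : SampleIdx m → Ω → Ξ) (k : ℕ) (ω : Ω) : ℝ :=
  ‖gradient P.outer (P.xIter τ T K S x₀ y₀ (fun j => ξ j ω) k)‖ ^ 2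

/-- `(1/K) ∑_{k=1}^K E ‖∇ f(x^k)‖²`. -/
def avgGradSq (P : Problem d₁ d₂ m Ξ) (τ : Fin m → ℕ) (T K : ℕ) (S : StepParams)
    (x₀ : Vec d₁) (y₀ : Vec d₂) {Ω : Type*} [MeasurableSpace Ω] (Pr : Measure Ω)
    (ξ : SampleIdx m → Ω → Ξ) : ℝ :=
  (1 / (K : ℝ)) * ∑ k ∈ Finset.Icc 1 K, ∫ ω, P.gradSq τ T K S x₀ y₀ ξ k ω ∂Pr

/-- `1 + (f(x⁰) - inf f) + ‖y⁰ - y*(x⁰)‖²`, the dependence on the initial point. -/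
def initGap (P : Problem d₁ d₂ m Ξ) (x₀ : Vec d₁) (y₀ : Vec d₂) : ℝ :=
  1 + (P.outer x₀ - ⨅ x, P.outer x) + ‖y₀ - P.yStar x₀‖ ^ 2

end Problem

end FedNest

end

namespace FedNest

/-! ### The maximizer map and the value function of a strongly concave saddle objective. -/

section Analysis

/-! Let Φ be the average of the client objectives. It inherits their bounds, so strong concavity
makes y* Lipschitz with constant κ. As ∇_yΦ vanishes at (x, y*(x)), the envelope argument gives
∇f(x) = ∇_xΦ(x, y*(x)) (`hasGradientAt_value`).

A federated call is a perturbed gradient step. With total step γ its displacement has L² norm O(γ),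
and its mean is −γ times the averaged field up to O(γ²), whatever the numbers of local steps
(`fedStep_moments`). Hence an inner call contracts E‖y − y*(x)‖² by 1 − βμ with noise O(β²)
(`lintegral_fedInn_le`), and an outer call gains (α/2)‖∇f‖² up to errors of order α‖y − y*(x)‖² and
α² (`lintegral_fedOut_le`).

The delicate point is that y* moves with x. Lipschitz continuity alone would charge ‖y − y*(x)‖
times E‖x⁺ − x‖, which is O(α) and after Young's inequality leaves noise of order α instead of α².
`exists_argmax_expansion` linearizes the pairing of y* with a fixed vector, with a quadratic
remainder. At first order only the mean displacement then enters, where the noise cancels. This is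
the role of the Lipschitz Hessian.

The two estimates combine in the Lyapunov function f − inf f + κ⁻¹‖y − y*(x)‖²; the weight κ⁻¹
offsets the Lipschitz constant of y*. The ratio of step sizes is tuned so that T inner calls absorb
the error coefficient gained in the outer call (`lyapunov_succ_add_le`). The net noise per round is
O(κ²α²). Telescoping with α = min(δ/κ², 1/(κ√K)) gives the rate (`rate_arith`), and K of order
(CΔκ/ε)² rounds suffice (`exists_rounds`).

Conditioning on the past is replaced by independence and Tonelli for nonnegative integrals
(`lintegral_batch`), so integrability of the Lyapunov function along the run is never needed. -/

theorem norm_sub_sub_le_of_lipschitz_fderiv {E F : Type*} [NormedAddCommGroup E] [NormedSpace ℝ E]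
    [NormedAddCommGroup F] [NormedSpace ℝ F] {f : E → F} {L : ℝ} (hf : Differentiable ℝ f)
    (hL : ∀ z z', ‖fderiv ℝ f z - fderiv ℝ f z'‖ ≤ L * ‖z - z'‖) (h0 : 0 ≤ L) (z z' : E) :
    ‖f z' - f z - fderiv ℝ f z (z' - z)‖ ≤ L * ‖z' - z‖ ^ 2 := by
  have := (convex_segment z z').norm_image_sub_le_of_norm_fderiv_le' (𝕜 := ℝ) (f := f)
    (φ := fderiv ℝ f z) (C := L * ‖z' - z‖) (x := z) (y := z') (fun w _ => hf w)
    (fun w hw => (hL w z).trans (mul_le_mul_of_nonneg_left (norm_sub_le_of_mem_segment hw) h0))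
    (left_mem_segment ℝ z z') (right_mem_segment ℝ z z')
  calc _ ≤ _ := this
    _ = _ := by ring

theorem abs_sub_sub_inner_le_of_lipschitz_gradient {E : Type*} [NormedAddCommGroup E]
    [InnerProductSpace ℝ E] [CompleteSpace E] {f : E → ℝ} {L : ℝ} (hf : Differentiable ℝ f)
    (hL : ∀ z z', ‖gradient f z - gradient f z'‖ ≤ L * ‖z - z'‖) (h0 : 0 ≤ L) (z z' : E) :
    |f z' - f z - inner ℝ (gradient f z) (z' - z)| ≤ L * ‖z' - z‖ ^ 2 := by
  have := norm_sub_sub_le_of_lipschitz_fderiv (f := f) (L := L) hf (fun a b => by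
    have := hL a b
    simp only [gradient] at this
    rwa [← map_sub, LinearIsometryEquiv.norm_map] at this) h0 z z'
  simpa [gradient] using this

theorem hasDerivAt_add_smul {E : Type*} [NormedAddCommGroup E] [NormedSpace ℝ E] (z v : E)
    (t : ℝ) : HasDerivAt (fun t : ℝ => z + t • v) v t := by
  simpa using ((hasDerivAt_id t).smul_const v).const_add z

theorem hasDerivAt_comp_add_smul {E F : Type*} [NormedAddCommGroup E] [NormedSpace ℝ E]
    [NormedAddCommGroup F] [NormedSpace ℝ F] {f : E → F} (hf : Differentiable ℝ f) (z v : E)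
    (t : ℝ) : HasDerivAt (fun t : ℝ => f (z + t • v)) (fderiv ℝ f (z + t • v) v) t :=
  (hf (z + t • v)).hasFDerivAt.comp_hasDerivAt t (hasDerivAt_add_smul z v t)

theorem hasDerivAt_const_inner {E : Type*} [NormedAddCommGroup E] [InnerProductSpace ℝ E]
    (v : E) {f : ℝ → E} {f' : E} {t : ℝ} (hf : HasDerivAt f f' t) :
    HasDerivAt (fun t => inner ℝ v (f t)) (inner ℝ v f') t :=
  (innerSL ℝ v).hasFDerivAt.comp_hasDerivAt t hf

theorem differentiable_gradient_of_contDiff {E : Type*} [NormedAddCommGroup E]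
    [InnerProductSpace ℝ E] [CompleteSpace E] {f : E → ℝ} (hf : ContDiff ℝ 2 f) :
    Differentiable ℝ (gradient f) := by
  have h1 : ContDiff ℝ 1 (fderiv ℝ f) := hf.fderiv_right (by norm_num)
  exact (InnerProductSpace.toDual ℝ E).symm.toContinuousLinearEquiv.differentiable.comp
    (h1.differentiable (by norm_num))

theorem continuous_gradient_of_contDiff {E : Type*} [NormedAddCommGroup E]
    [InnerProductSpace ℝ E] [CompleteSpace E] {f : E → ℝ} (hf : ContDiff ℝ 2 f) :
    Continuous (gradient f) :=
  (differentiable_gradient_of_contDiff hf).continuous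

/-- The hypothesis says that t ↦ ⟨v, g(z + tv)⟩ + tc is antitone, so its derivative at 0 is
nonpositive. -/
theorem inner_fderiv_le_of_strong_mono {E : Type*} [NormedAddCommGroup E]
    [InnerProductSpace ℝ E] {g : E → E} (hg : Differentiable ℝ g) (z v : E) (c : ℝ)
    (hm : ∀ s t : ℝ, s < t → inner ℝ v (g (z + t • v)) - inner ℝ v (g (z + s • v)) ≤ -(t - s) * c) :
    inner ℝ v (fderiv ℝ g z v) ≤ -c := by
  have h1 := hasDerivAt_comp_add_smul hg z v 0
  rw [zero_smul, add_zero] at h1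
  have h2 : HasDerivAt (fun t : ℝ => inner ℝ v (g (z + t • v)) + t * c)
      (inner ℝ v (fderiv ℝ g z v) + 1 * c) 0 :=
    (hasDerivAt_const_inner v h1).add ((hasDerivAt_id 0).mul_const _)
  have h3 : Antitone fun t : ℝ => inner ℝ v (g (z + t • v)) + t * c := by
    intro s t hst
    rcases hst.eq_or_lt with rfl | hlt
    · exact le_rfl
    have := hm s t hlt
    dsimp only
    linarith
  have h4 := h3.deriv_nonpos (x := 0)
  rw [h2.deriv] at h4
  linarith

variable {d₁ d₂ : ℕ}

theorem pt_sub_pt (x x' : Vec d₁) (y y' : Vec d₂) : pt x y - pt x' y' = pt (x - x') (y - y') := rfl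

theorem pt_add_smul (x u : Vec d₁) (y v : Vec d₂) (t : ℝ) :
    pt x y + t • pt u v = pt (x + t • u) (y + t • v) := rfl

theorem norm_pt_sq (x : Vec d₁) (y : Vec d₂) : ‖pt x y‖ ^ 2 = ‖x‖ ^ 2 + ‖y‖ ^ 2 := by
  rw [WithLp.prod_norm_sq_eq_of_L2]; rfl

theorem inner_pt (z : Pt d₁ d₂) (u : Vec d₁) (v : Vec d₂) :
    inner ℝ z (pt u v) = inner ℝ z.fst u + inner ℝ z.snd v := by
  rw [WithLp.prod_inner_apply]; rfl

theorem norm_pt_zero_left (y : Vec d₂) : ‖pt (0 : Vec d₁) y‖ = ‖y‖ := by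
  have := norm_pt_sq (0 : Vec d₁) y
  rw [norm_zero] at this
  exact (sq_eq_sq₀ (norm_nonneg _) (norm_nonneg _)).1 (by linarith)

theorem norm_pt_zero_right (x : Vec d₁) : ‖pt x (0 : Vec d₂)‖ = ‖x‖ := by
  have := norm_pt_sq x (0 : Vec d₂)
  rw [norm_zero] at this
  exact (sq_eq_sq₀ (norm_nonneg _) (norm_nonneg _)).1 (by linarith)

theorem norm_fst_le (z : Pt d₁ d₂) : ‖z.fst‖ ≤ ‖z‖ := by
  have := WithLp.prod_norm_sq_eq_of_L2 z
  exact (sq_le_sq₀ (norm_nonneg _) (norm_nonneg _)).1 (by nlinarith [sq_nonneg ‖z.snd‖])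

theorem norm_snd_le (z : Pt d₁ d₂) : ‖z.snd‖ ≤ ‖z‖ := by
  have := WithLp.prod_norm_sq_eq_of_L2 z
  exact (sq_le_sq₀ (norm_nonneg _) (norm_nonneg _)).1 (by nlinarith [sq_nonneg ‖z.fst‖])

theorem continuous_pt : Continuous fun p : Vec d₁ × Vec d₂ => pt p.1 p.2 :=
  WithLp.prod_continuous_toLp 2 _ _

/-- A twice continuously differentiable function `Φ(x, y)` that is Lipschitz in `x`, strongly
concave in `y`, and has Lipschitz gradient and Hessian. -/
structure RegularSaddle (Φ : Pt d₁ d₂ → ℝ) (ℓ₀ ℓ₁ ℓ₂ μ : ℝ) : Prop where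
  smooth : ContDiff ℝ 2 Φ
  lip_obj : ∀ x x' y, |Φ (pt x y) - Φ (pt x' y)| ≤ ℓ₀ * ‖x - x'‖
  lip_grad : ∀ z z', ‖gradient Φ z - gradient Φ z'‖ ≤ ℓ₁ * ‖z - z'‖
  lip_hess : ∀ z z',
    ‖fderiv ℝ (gradient Φ) z - fderiv ℝ (gradient Φ) z'‖ ≤ ℓ₂ * ‖z - z'‖
  concave : ∀ x, StrongConcaveOn Set.univ μ fun y => Φ (pt x y)

namespace RegularSaddle

variable {Φ : Pt d₁ d₂ → ℝ} {ℓ₀ ℓ₁ ℓ₂ μ : ℝ}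

theorem differentiable (h : RegularSaddle Φ ℓ₀ ℓ₁ ℓ₂ μ) : Differentiable ℝ Φ :=
  h.smooth.differentiable (by norm_num)

theorem hasDerivAt_line (h : RegularSaddle Φ ℓ₀ ℓ₁ ℓ₂ μ) (z v : Pt d₁ d₂) (t : ℝ) :
    HasDerivAt (fun t : ℝ => Φ (z + t • v)) (inner ℝ (gradient Φ (z + t • v)) v) t := by
  exact (h.differentiable (z + t • v)).hasGradientAt.hasFDerivAt.comp_hasDerivAt t
    (hasDerivAt_add_smul z v t)

theorem differentiable_gradient (h : RegularSaddle Φ ℓ₀ ℓ₁ ℓ₂ μ) :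
    Differentiable ℝ (gradient Φ) :=
  differentiable_gradient_of_contDiff h.smooth

theorem continuous_gradient (h : RegularSaddle Φ ℓ₀ ℓ₁ ℓ₂ μ) : Continuous (gradient Φ) :=
  continuous_gradient_of_contDiff h.smooth

theorem concaveOn_line (h : RegularSaddle Φ ℓ₀ ℓ₁ ℓ₂ μ) (x : Vec d₁) (y v : Vec d₂) :
    ConcaveOn ℝ Set.univ fun t : ℝ =>
      Φ (pt x y + t • pt 0 v) + μ / 2 * ‖y + t • v‖ ^ 2 := by
  have h1 := strongConcaveOn_iff_convex.1 (h.concave x)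
  have h2 := h1.comp_affineMap (AffineMap.lineMap y (y + v) : ℝ →ᵃ[ℝ] Vec d₂)
  have h3 : (fun t : ℝ => Φ (pt x y + t • pt 0 v) + μ / 2 * ‖y + t • v‖ ^ 2) =
      (fun y => Φ (pt x y) + μ / 2 * ‖y‖ ^ 2) ∘ (AffineMap.lineMap y (y + v) : ℝ →ᵃ[ℝ] Vec d₂) := by
    ext t
    simp [AffineMap.lineMap_apply, pt_add_smul, add_comm]
  rw [h3]
  exact h2

theorem hasDerivAt_line_add_sq (h : RegularSaddle Φ ℓ₀ ℓ₁ ℓ₂ μ) (x : Vec d₁) (y v : Vec d₂)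
    (t : ℝ) :
    HasDerivAt (fun t : ℝ => Φ (pt x y + t • pt 0 v) + μ / 2 * ‖y + t • v‖ ^ 2)
      (inner ℝ (gradient Φ (pt x (y + t • v))).snd v + μ * inner ℝ (y + t • v) v) t := by
  have h1 := h.hasDerivAt_line (pt x y) (pt 0 v) t
  rw [inner_pt, inner_zero_right, zero_add, pt_add_smul, smul_zero, add_zero] at h1
  have h3 := (hasDerivAt_add_smul y v t).norm_sq.const_mul (μ / 2)
  refine (h1.add h3).congr_deriv ?_
  ring

theorem strong_mono (h : RegularSaddle Φ ℓ₀ ℓ₁ ℓ₂ μ) (x : Vec d₁) (y y' : Vec d₂) :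
    inner ℝ ((gradient Φ (pt x y')).snd - (gradient Φ (pt x y)).snd) (y' - y)
      ≤ -μ * ‖y' - y‖ ^ 2 := by
  have h1 := (h.concaveOn_line x y (y' - y)).antitoneOn_deriv
    (fun t _ => (h.hasDerivAt_line_add_sq x y (y' - y) t).differentiableAt)
    (Set.mem_univ 0) (Set.mem_univ 1) zero_le_one
  rw [(h.hasDerivAt_line_add_sq x y (y' - y) 0).deriv,
    (h.hasDerivAt_line_add_sq x y (y' - y) 1).deriv] at h1
  have h2 : μ * inner ℝ y' (y' - y) - μ * inner ℝ y (y' - y) = μ * ‖y' - y‖ ^ 2 := by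
    rw [← mul_sub, ← inner_sub_left, real_inner_self_eq_norm_sq]
  simp only [zero_smul, add_zero, one_smul, add_sub_cancel] at h1
  rw [inner_sub_left]
  linarith

/-- Concavity along the segment from 0 to y puts the chord slope below the slope at 0. The resulting
coercivity yields the existence of maximizers. -/
theorem le_quadratic (h : RegularSaddle Φ ℓ₀ ℓ₁ ℓ₂ μ) (x : Vec d₁) (y : Vec d₂) :
    Φ (pt x y) ≤ Φ (pt x 0) + ‖(gradient Φ (pt x 0)).snd‖ * ‖y‖ - μ / 2 * ‖y‖ ^ 2 := by
  have h1 := ConcaveOn.slope_le_of_hasDerivAt (h.concaveOn_line x 0 y) (Set.mem_univ 0)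
    (Set.mem_univ 1) zero_lt_one (h.hasDerivAt_line_add_sq x 0 y 0)
  simp only [slope_def_field, pt_add_smul] at h1
  have := real_inner_le_norm (gradient Φ (pt x 0)).snd y
  simp at h1
  linarith

theorem exists_isMaxOn (h : RegularSaddle Φ ℓ₀ ℓ₁ ℓ₂ μ) (hμ : 0 < μ) (x : Vec d₁) :
    ∃ y, IsMaxOn (fun y => Φ (pt x y)) Set.univ y := by
  have hc : Continuous fun y => Φ (pt x y) :=
    h.smooth.continuous.comp (continuous_pt.comp (by fun_prop : Continuous fun y => (x, y)))
  obtain ⟨y, hy⟩ := hc.exists_forall_ge' (x₀ := 0) (by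
    have ht := tendsto_norm_cocompact_atTop (E := Vec d₂)
    filter_upwards [ht.eventually_ge_atTop (2 / μ * ‖(gradient Φ (pt x 0)).snd‖)] with y hy
    have h1 := h.le_quadratic x y
    have h2 : ‖(gradient Φ (pt x 0)).snd‖ ≤ μ / 2 * ‖y‖ := by
      rw [div_mul_eq_mul_div, div_le_iff₀ hμ] at hy
      linarith
    nlinarith [norm_nonneg y])
  exact ⟨y, fun z _ => hy z⟩

theorem gradient_snd_eq_zero (h : RegularSaddle Φ ℓ₀ ℓ₁ ℓ₂ μ) {x : Vec d₁} {y : Vec d₂}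
    (hy : IsMaxOn (fun y => Φ (pt x y)) Set.univ y) : (gradient Φ (pt x y)).snd = 0 := by
  set v := (gradient Φ (pt x y)).snd with hv
  have h1 := h.hasDerivAt_line (pt x y) (pt 0 v) 0
  have h2 : IsLocalMax (fun t : ℝ => Φ (pt x y + t • pt 0 v)) 0 :=
    Filter.Eventually.of_forall fun t => by
      simpa [pt_add_smul] using hy (Set.mem_univ (y + t • v))
  have h3 := h2.hasDerivAt_eq_zero h1
  rw [zero_smul, add_zero, inner_pt, inner_zero_right, zero_add, ← hv] at h3
  exact inner_self_eq_zero.1 h3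

theorem norm_gradient_fst_le (h : RegularSaddle Φ ℓ₀ ℓ₁ ℓ₂ μ) (z : Pt d₁ d₂) (h0 : 0 ≤ ℓ₀) :
    ‖(gradient Φ z).fst‖ ≤ ℓ₀ := by
  obtain ⟨x, y, rfl⟩ : ∃ x y, z = pt x y := ⟨z.fst, z.snd, rfl⟩
  -- Testing the Lipschitz bound in the direction of the partial gradient itself gives ‖v‖² ≤ ℓ₀‖v‖.
  set v := (gradient Φ (pt x y)).fst with hv
  have h1 := h.hasDerivAt_line (pt x y) (pt v 0) 0
  have h2 := h1.le_of_lip' (C := ℓ₀ * ‖v‖) (by positivity) (Filter.Eventually.of_forall fun t => by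
    have := h.lip_obj (x + t • v) x y
    simp only [pt_add_smul, zero_smul, add_zero, smul_zero, sub_zero, Real.norm_eq_abs]
    refine this.trans (le_of_eq ?_)
    rw [add_sub_cancel_left, norm_smul, Real.norm_eq_abs]; ring)
  rw [zero_smul, add_zero, inner_pt, inner_zero_right, add_zero, ← hv,
    real_inner_self_eq_norm_sq, Real.norm_eq_abs, abs_of_nonneg (by positivity)] at h2
  by_contra hcon
  push Not at hcon
  nlinarith [norm_nonneg v]

theorem norm_gradient_snd_sub_le (h : RegularSaddle Φ ℓ₀ ℓ₁ ℓ₂ μ) (x : Vec d₁) (y y' : Vec d₂) :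
    ‖(gradient Φ (pt x y)).snd - (gradient Φ (pt x y')).snd‖ ≤ ℓ₁ * ‖y - y'‖ := by
  have h1 := (norm_snd_le _).trans (h.lip_grad (pt x y) (pt x y'))
  rwa [pt_sub_pt, sub_self, norm_pt_zero_left] at h1

theorem norm_gradient_fst_sub_le (h : RegularSaddle Φ ℓ₀ ℓ₁ ℓ₂ μ) (x : Vec d₁) (y y' : Vec d₂) :
    ‖(gradient Φ (pt x y)).fst - (gradient Φ (pt x y')).fst‖ ≤ ℓ₁ * ‖y - y'‖ := by
  have h1 := (norm_fst_le _).trans (h.lip_grad (pt x y) (pt x y'))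
  rwa [pt_sub_pt, sub_self, norm_pt_zero_left] at h1

/-- Strong monotonicity and the Lipschitz bound are compared on a unit vector, which exists because
d₂ > 0. This is the source of κ ≥ 1. -/
theorem mu_le (h : RegularSaddle Φ ℓ₀ ℓ₁ ℓ₂ μ) (hd : 0 < d₂) : μ ≤ ℓ₁ := by
  set v : Vec d₂ := EuclideanSpace.single ⟨0, hd⟩ 1 with hv
  have hn : ‖v‖ = 1 := by simp [hv]
  have h1 := h.strong_mono 0 0 v
  have h2 := h.norm_gradient_snd_sub_le 0 v 0
  have h3 := neg_le_of_abs_le (abs_real_inner_le_norm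
    ((gradient Φ (pt 0 v)).snd - (gradient Φ (pt 0 0)).snd) (v - 0))
  rw [sub_zero, hn] at *
  linarith

theorem norm_hess_le (h : RegularSaddle Φ ℓ₀ ℓ₁ ℓ₂ μ) (h1 : 0 ≤ ℓ₁) (z : Pt d₁ d₂) :
    ‖fderiv ℝ (gradient Φ) z‖ ≤ ℓ₁ :=
  norm_fderiv_le_of_lip' ℝ h1 (Filter.Eventually.of_forall fun w => h.lip_grad w z)

theorem inner_hess_le (h : RegularSaddle Φ ℓ₀ ℓ₁ ℓ₂ μ) (x : Vec d₁) (y u : Vec d₂) :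
    inner ℝ (pt 0 u) (fderiv ℝ (gradient Φ) (pt x y) (pt 0 u)) ≤ -μ * ‖u‖ ^ 2 := by
  have h3 := inner_fderiv_le_of_strong_mono h.differentiable_gradient (pt x y) (pt 0 u)
    (μ * ‖u‖ ^ 2) fun s t hlt => by
    have h4 := h.strong_mono x (y + s • u) (y + t • u)
    have h5 : y + t • u - (y + s • u) = (t - s) • u := by rw [sub_smul]; abel
    rw [h5, inner_smul_right, inner_sub_left, norm_smul, mul_pow, Real.norm_eq_abs, sq_abs] at h4
    simp only [pt_add_smul, smul_zero, add_zero]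
    rw [real_inner_comm, real_inner_comm (gradient Φ (pt x (y + s • u))), inner_pt, inner_pt,
      inner_zero_right, inner_zero_right, zero_add, zero_add]
    have h6 : 0 < t - s := sub_pos.2 hlt
    refine le_of_mul_le_mul_left ?_ h6
    calc _ ≤ _ := h4
      _ = _ := by ring
  linarith

/-- The function `p` selects a maximizer of `Φ(x, ·)` for each `x`. -/
def IsArgmax (Φ : Pt d₁ d₂ → ℝ) (p : Vec d₁ → Vec d₂) : Prop :=
  ∀ x, IsMaxOn (fun y => Φ (pt x y)) Set.univ (p x)

variable {p : Vec d₁ → Vec d₂}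

/-- The y-gradient at (x', p x) is at most ℓ₁‖x' − x‖, since it vanishes at (x, p x). Strong
monotonicity in y at x', where p x' is critical, turns this into a distance. -/
theorem argmax_lipschitz (h : RegularSaddle Φ ℓ₀ ℓ₁ ℓ₂ μ) (hμ : 0 < μ) (hp : IsArgmax Φ p)
    (x x' : Vec d₁) : ‖p x' - p x‖ ≤ ℓ₁ / μ * ‖x' - x‖ := by
  have h1 := h.strong_mono x' (p x) (p x')
  rw [h.gradient_snd_eq_zero (hp x')] at h1
  have h2 := (norm_snd_le _).trans (h.lip_grad (pt x' (p x)) (pt x (p x)))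
  rw [pt_sub_pt, sub_self, norm_pt_zero_right] at h2
  have h3 : ‖(gradient Φ (pt x' (p x))).snd‖ ≤ ℓ₁ * ‖x' - x‖ := by
    simpa [h.gradient_snd_eq_zero (hp x)] using h2
  have h4 := neg_le_of_abs_le (abs_real_inner_le_norm (0 - (gradient Φ (pt x' (p x))).snd)
    (p x' - p x))
  rw [zero_sub, norm_neg] at h4
  rw [zero_sub] at h1
  rw [div_mul_eq_mul_div, le_div_iff₀ hμ]
  by_contra hcon
  push Not at hcon
  have h5 : 0 < ‖p x' - p x‖ := by
    by_contra h0
    have : ‖p x' - p x‖ = 0 := le_antisymm (not_lt.1 h0) (norm_nonneg _)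
    rw [this, zero_mul] at hcon
    linarith [norm_nonneg (gradient Φ (pt x' (p x))).snd]
  nlinarith

theorem argmax_continuous (h : RegularSaddle Φ ℓ₀ ℓ₁ ℓ₂ μ) (hμ : 0 < μ) (hp : IsArgmax Φ p)
    (h1 : 0 ≤ ℓ₁) : Continuous p := by
  refine (LipschitzWith.of_dist_le_mul (K := ⟨ℓ₁ / μ, by positivity⟩) fun x x' => ?_).continuous
  rw [dist_eq_norm, dist_eq_norm]
  exact h.argmax_lipschitz hμ hp x' x

theorem norm_pt_argmax_sub_sq_le (h : RegularSaddle Φ ℓ₀ ℓ₁ ℓ₂ μ) (hμ : 0 < μ)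
    (hp : IsArgmax Φ p) (x x' : Vec d₁) :
    ‖pt x' (p x') - pt x (p x)‖ ^ 2 ≤ (1 + (ℓ₁ / μ) ^ 2) * ‖x' - x‖ ^ 2 := by
  rw [pt_sub_pt, norm_pt_sq]
  have := pow_le_pow_left₀ (norm_nonneg _) (h.argmax_lipschitz hμ hp x x') 2
  rw [mul_pow] at this
  linarith

/-- Envelope argument: in the expansion of Φ at (x, p x) the y-part of the linear term vanishes, and
the graph of p is Lipschitz. No derivative of p is needed. -/
theorem abs_value_sub_le (h : RegularSaddle Φ ℓ₀ ℓ₁ ℓ₂ μ) (hμ : 0 < μ) (hp : IsArgmax Φ p)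
    (h1 : 0 ≤ ℓ₁) (x x' : Vec d₁) :
    |Φ (pt x' (p x')) - Φ (pt x (p x)) - inner ℝ (gradient Φ (pt x (p x))).fst (x' - x)|
      ≤ ℓ₁ * (1 + (ℓ₁ / μ) ^ 2) * ‖x' - x‖ ^ 2 := by
  have h2 := abs_sub_sub_inner_le_of_lipschitz_gradient h.differentiable h.lip_grad h1
    (pt x (p x)) (pt x' (p x'))
  have h3 := mul_le_mul_of_nonneg_left (h.norm_pt_argmax_sub_sq_le hμ hp x x') h1
  rw [pt_sub_pt, inner_pt, h.gradient_snd_eq_zero (hp x), inner_zero_left, add_zero,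
    ← pt_sub_pt] at h2
  linarith

theorem hasGradientAt_value (h : RegularSaddle Φ ℓ₀ ℓ₁ ℓ₂ μ) (hμ : 0 < μ) (hp : IsArgmax Φ p)
    (h1 : 0 ≤ ℓ₁) (x : Vec d₁) :
    HasGradientAt (fun x => Φ (pt x (p x))) (gradient Φ (pt x (p x))).fst x := by
  rw [hasGradientAt_iff_isLittleO]
  refine Asymptotics.IsBigO.trans_isLittleO (g := fun x' => ‖x' - x‖ ^ 2) ?_ ?_
  · refine Asymptotics.IsBigO.of_bound (ℓ₁ * (1 + (ℓ₁ / μ) ^ 2)) (Filter.Eventually.of_forall ?_)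
    intro x'
    rw [Real.norm_eq_abs, norm_pow, norm_norm]
    exact h.abs_value_sub_le hμ hp h1 x x'
  · exact Asymptotics.isLittleO_pow_sub_sub x one_lt_two

/-- First-order expansion of the maximizer map with a quadratic remainder. -/
theorem exists_argmax_expansion (h : RegularSaddle Φ ℓ₀ ℓ₁ ℓ₂ μ) (hμ : 0 < μ)
    (hp : IsArgmax Φ p) (h1 : 0 ≤ ℓ₁) (h2 : 0 ≤ ℓ₂) (x : Vec d₁) (v : Vec d₂) :
    ∃ w : Vec d₁, ‖w‖ ≤ ℓ₁ / μ * ‖v‖ ∧ ∀ x',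
      |inner ℝ v (p x' - p x) - inner ℝ w (x' - x)|
        ≤ ℓ₂ / μ * (1 + (ℓ₁ / μ) ^ 2) * ‖v‖ * ‖x' - x‖ ^ 2 := by
  set z := pt x (p x) with hz
  set H := fderiv ℝ (gradient Φ) z with hH
  set A := ContinuousLinearMap.adjoint H with hA
  have hHn : ‖H‖ ≤ ℓ₁ := h.norm_hess_le h1 z
  have hAn : ‖A‖ ≤ ℓ₁ := by rwa [hA, LinearIsometryEquiv.norm_map]
  -- The yy-block of the adjoint Hessian. Working with the adjoint makes the symmetry of the Hessian
  -- unnecessary.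
  let N : Vec d₂ →ₗ[ℝ] Vec d₂ :=
    { toFun := fun u => (A (pt 0 u)).snd
      map_add' := fun u u' => by
        rw [show (pt 0 (u + u') : Pt d₁ d₂) = pt 0 u + pt 0 u' from by
          rw [← one_smul ℝ (pt 0 u'), pt_add_smul]; simp, map_add]; rfl
      map_smul' := fun c u => by
        rw [show (pt 0 (c • u) : Pt d₁ d₂) = c • pt 0 u from by
          rw [← zero_add (c • pt 0 u), show (0 : Pt d₁ d₂) = pt 0 0 from rfl, pt_add_smul]; simp,
          map_smul]; rfl }
  have hN : ∀ u, N u = (A (pt 0 u)).snd := fun u => rfl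
  have hco : ∀ u, μ * ‖u‖ ^ 2 ≤ ‖N u‖ * ‖u‖ := fun u => by
    have h3 := h.inner_hess_le x (p x) u
    have h4 : inner ℝ (N u) u = inner ℝ (pt 0 u) (H (pt 0 u)) := by
      rw [← ContinuousLinearMap.adjoint_inner_left, inner_pt, inner_zero_right, zero_add, hN]
    rw [← hz, ← hH, ← h4] at h3
    linarith [neg_le_of_abs_le (abs_real_inner_le_norm (N u) u)]
  have hle : ∀ u, ‖u‖ ≤ ‖N u‖ / μ := fun u => by
    rw [le_div_iff₀ hμ]
    rcases (norm_nonneg u).eq_or_lt with h0 | h0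
    · rw [← h0, zero_mul]; positivity
    · nlinarith [hco u]
  have hinj : Function.Injective N := by
    rw [← LinearMap.ker_eq_bot, LinearMap.ker_eq_bot']
    intro u hu
    simpa [hu] using hle u
  -- Coercivity makes the block injective, hence onto in finite dimension. Then w comes from the
  -- other block applied to u, as in the implicit function theorem.
  obtain ⟨u, hu⟩ := LinearMap.injective_iff_surjective.1 hinj v
  have hun := hle u
  rw [hu] at hun
  rw [hN] at hu
  refine ⟨-(A (pt 0 u)).fst, ?_, fun x' => ?_⟩
  · rw [norm_neg]
    calc ‖(A (pt 0 u)).fst‖ ≤ ‖A (pt 0 u)‖ := norm_fst_le _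
      _ ≤ ‖A‖ * ‖pt (0 : Vec d₁) u‖ := A.le_opNorm _
      _ ≤ ℓ₁ * (‖v‖ / μ) := by rw [norm_pt_zero_left]; gcongr
      _ = ℓ₁ / μ * ‖v‖ := by ring
  · set z' := pt x' (p x') with hz'
    have h3 := norm_sub_sub_le_of_lipschitz_fderiv h.differentiable_gradient h.lip_hess h2 z z'
    set R := gradient Φ z' - gradient Φ z - H (z' - z) with hR
    -- Both points lie on the graph of the maximizer, so their y-gradients vanish and only the
    -- Taylor remainder survives the pairing with (0, u).
    have h4 : inner ℝ (A (pt 0 u)) (z' - z) = -inner ℝ R (pt 0 u) := by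
      rw [ContinuousLinearMap.adjoint_inner_left, hR, inner_sub_left, inner_sub_left, inner_pt,
        inner_pt, h.gradient_snd_eq_zero (hp x), h.gradient_snd_eq_zero (hp x'),
        real_inner_comm (H (z' - z))]
      simp
    have h5 : inner ℝ (A (pt 0 u)) (z' - z)
        = inner ℝ (A (pt 0 u)).fst (x' - x) + inner ℝ v (p x' - p x) := by
      rw [hz, hz', pt_sub_pt, inner_pt, hu]
    have h6 : inner ℝ v (p x' - p x) - inner ℝ (-(A (pt 0 u)).fst) (x' - x)
        = -inner ℝ R (pt 0 u) := by
      rw [inner_neg_left]; linarith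
    rw [h6, abs_neg]
    calc |inner ℝ R (pt 0 u)| ≤ ‖R‖ * ‖pt (0 : Vec d₁) u‖ := abs_real_inner_le_norm _ _
      _ ≤ (ℓ₂ * ((1 + (ℓ₁ / μ) ^ 2) * ‖x' - x‖ ^ 2)) * (‖v‖ / μ) := by
          rw [norm_pt_zero_left]
          gcongr
          exact h3.trans (mul_le_mul_of_nonneg_left (h.norm_pt_argmax_sub_sq_le hμ hp x x') h2)
      _ = _ := by ring

end RegularSaddle

end Analysis

end FedNest

namespace FedNest

/-! ### Bounds inherited by the average over the clients. -/

section Average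

theorem norm_average_sub_le {E : Type*} [NormedAddCommGroup E] [NormedSpace ℝ E] {m : ℕ}
    (hm : 0 < m) (u v : Fin m → E) {C : ℝ} (h : ∀ i, ‖u i - v i‖ ≤ C) :
    ‖(1 / (m : ℝ)) • ∑ i, u i - (1 / (m : ℝ)) • ∑ i, v i‖ ≤ C := by
  have hm' : (0 : ℝ) < m := Nat.cast_pos.2 hm
  rw [← smul_sub, ← Finset.sum_sub_distrib, norm_smul, Real.norm_of_nonneg (by positivity)]
  calc 1 / (m : ℝ) * ‖∑ i, (u i - v i)‖ ≤ 1 / (m : ℝ) * ∑ _i : Fin m, C := by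
        gcongr; exact norm_sum_le_of_le _ fun i _ => h i
    _ = C := by simp; field_simp

theorem fderiv_average {E F : Type*} [NormedAddCommGroup E] [NormedSpace ℝ E]
    [NormedAddCommGroup F] [NormedSpace ℝ F] {m : ℕ} {f : Fin m → E → F}
    (hf : ∀ i, Differentiable ℝ (f i)) (c : ℝ) (z : E) :
    fderiv ℝ (fun z => c • ∑ i, f i z) z = c • ∑ i, fderiv ℝ (f i) z := by
  have h1 : HasFDerivAt (fun z => ∑ i, f i z) (∑ i, fderiv ℝ (f i) z) z :=
    HasFDerivAt.fun_sum fun i _ => (hf i z).hasFDerivAt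
  exact (h1.const_smul c).fderiv

theorem gradient_average {E : Type*} [NormedAddCommGroup E] [InnerProductSpace ℝ E]
    [CompleteSpace E] {m : ℕ} {f : Fin m → E → ℝ}
    (hf : ∀ i, Differentiable ℝ (f i)) (c : ℝ) (z : E) :
    gradient (fun z => c * ∑ i, f i z) z = c • ∑ i, gradient (f i) z := by
  have h1 := fderiv_average hf c z
  simp only [smul_eq_mul] at h1
  rw [gradient, h1, map_smul, map_sum]
  rfl

theorem fderiv_gradient_average {E : Type*} [NormedAddCommGroup E] [InnerProductSpace ℝ E]
    [CompleteSpace E] {m : ℕ} {f : Fin m → E → ℝ}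
    (hf : ∀ i, ContDiff ℝ 2 (f i)) (c : ℝ) (z : E) :
    fderiv ℝ (gradient (fun z => c * ∑ i, f i z)) z = c • ∑ i, fderiv ℝ (gradient (f i)) z := by
  have h1 : gradient (fun z => c * ∑ i, f i z) = fun z => c • ∑ i, gradient (f i) z :=
    funext fun z => gradient_average (fun i => (hf i).differentiable (by norm_num)) c z
  rw [h1]
  exact fderiv_average (fun i => differentiable_gradient_of_contDiff (hf i)) c z

theorem strongConcaveOn_average {E : Type*} [NormedAddCommGroup E] [InnerProductSpace ℝ E]
    {m : ℕ} (hm : 0 < m) {f : Fin m → E → ℝ} {μ : ℝ}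
    (hf : ∀ i, StrongConcaveOn Set.univ μ (f i)) :
    StrongConcaveOn Set.univ μ fun y => (1 / (m : ℝ)) * ∑ i, f i y := by
  have hm' : (0 : ℝ) < m := Nat.cast_pos.2 hm
  refine ⟨convex_univ, fun x _ y _ a b ha hb hab => ?_⟩
  have h1 : ∀ i, a * f i x + b * f i y + a * b * (μ / 2 * ‖x - y‖ ^ 2) ≤ f i (a • x + b • y) :=
    fun i => (hf i).2 (Set.mem_univ x) (Set.mem_univ y) ha hb hab
  have h2 := Finset.sum_le_sum fun i (_ : i ∈ Finset.univ) => h1 i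
  rw [Finset.sum_add_distrib, Finset.sum_add_distrib, ← Finset.mul_sum, ← Finset.mul_sum] at h2
  simp only [Finset.sum_const, Finset.card_univ, Fintype.card_fin, nsmul_eq_mul] at h2
  have h3 := mul_le_mul_of_nonneg_left h2 (by positivity : 0 ≤ 1 / (m : ℝ))
  simp only [smul_eq_mul]
  refine le_trans (le_of_eq ?_) h3
  field_simp

end Average

namespace Problem

variable {d₁ d₂ m : ℕ} {Ξ : Type*} [MeasurableSpace Ξ]

/-- The average `(1/m) ∑ i, f_i(z)` of the client objectives. -/
noncomputable def avgObj (P : Problem d₁ d₂ m Ξ) (z : Pt d₁ d₂) : ℝ :=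
  (1 / (m : ℝ)) * ∑ i, P.clientObj i z

variable {P : Problem d₁ d₂ m Ξ} {ℓ₀ ℓ₁ ℓ₂ μ : ℝ}

theorem WellBehaved.gradient_avgObj (h : P.WellBehaved ℓ₀ ℓ₁ ℓ₂ μ) (z : Pt d₁ d₂) :
    gradient P.avgObj z = (1 / (m : ℝ)) • ∑ i, gradient (P.clientObj i) z :=
  gradient_average (fun i => (h.smooth i).differentiable (by norm_num)) _ z

theorem WellBehaved.regularSaddle (h : P.WellBehaved ℓ₀ ℓ₁ ℓ₂ μ) (hm : 0 < m) :
    RegularSaddle P.avgObj ℓ₀ ℓ₁ ℓ₂ μ where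
  smooth := by
    have h1 : ContDiff ℝ 2 fun z => ∑ i, P.clientObj i z := ContDiff.sum fun i _ => h.smooth i
    exact contDiff_const.mul h1
  lip_obj x x' y := by
    have := norm_average_sub_le hm (fun i => P.clientObj i (pt x y))
      (fun i => P.clientObj i (pt x' y)) fun i => h.lip_obj i x x' y
    exact this
  lip_grad z z' := by
    rw [h.gradient_avgObj, h.gradient_avgObj]
    exact norm_average_sub_le hm _ _ fun i => h.lip_grad i z z'
  lip_hess z z' := by
    have h1 : ∀ z, fderiv ℝ (gradient P.avgObj) z
        = (1 / (m : ℝ)) • ∑ i, fderiv ℝ (gradient (P.clientObj i)) z :=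
      fderiv_gradient_average h.smooth _
    rw [h1, h1]
    exact norm_average_sub_le hm _ _ fun i => h.lip_hess i z z'
  concave x := strongConcaveOn_average hm fun i => h.concave i x

theorem WellBehaved.isArgmax_yStar (h : P.WellBehaved ℓ₀ ℓ₁ ℓ₂ μ) (hm : 0 < m) (hμ : 0 < μ) :
    RegularSaddle.IsArgmax P.avgObj P.yStar := fun x =>
  Classical.epsilon_spec (p := fun y => IsMaxOn (P.obj x) Set.univ y)
    ((h.regularSaddle hm).exists_isMaxOn hμ x)

end Problem

end FedNest

namespace FedNest

/-! ### Independence of functions of disjoint families of samples. -/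

section Independence

variable {Ω Ξ : Type*} [MeasurableSpace Ω] [MeasurableSpace Ξ] {Pr : Measure Ω}

/-- Tonelli on the product law. It stands in for conditioning on X and needs only nonnegativity and
measurability. -/
theorem lintegral_comp_of_indepFun [IsProbabilityMeasure Pr] {α β : Type*} [MeasurableSpace α]
    [MeasurableSpace β] {X : Ω → α} {Y : Ω → β} (hX : Measurable X) (hY : Measurable Y)
    (h : IndepFun X Y Pr) {Φ : α × β → ENNReal} (hΦ : Measurable Φ) :
    ∫⁻ ω, Φ (X ω, Y ω) ∂Pr = ∫⁻ ω, ∫⁻ ω', Φ (X ω, Y ω') ∂Pr ∂Pr := by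
  have h1 := (indepFun_iff_map_prod_eq_prod_map_map hX.aemeasurable hY.aemeasurable).1 h
  have : IsProbabilityMeasure (Measure.map X Pr) := Measure.isProbabilityMeasure_map hX.aemeasurable
  have : IsProbabilityMeasure (Measure.map Y Pr) := Measure.isProbabilityMeasure_map hY.aemeasurable
  calc ∫⁻ ω, Φ (X ω, Y ω) ∂Pr = ∫⁻ p, Φ p ∂(Measure.map (fun ω => (X ω, Y ω)) Pr) :=
        (lintegral_map hΦ (hX.prodMk hY)).symm
    _ = ∫⁻ x, ∫⁻ y, Φ (x, y) ∂(Measure.map Y Pr) ∂(Measure.map X Pr) := by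
        rw [h1, lintegral_prod _ hΦ.aemeasurable]
    _ = ∫⁻ ω, ∫⁻ y, Φ (X ω, y) ∂(Measure.map Y Pr) ∂Pr :=
        lintegral_map hΦ.lintegral_prod_right' hX
    _ = _ := by
        refine lintegral_congr fun ω => ?_
        exact lintegral_map (f := fun y => Φ (X ω, y)) (hΦ.comp measurable_prodMk_left) hY

theorem indepFun_of_measurable_iSup {ι α β : Type*} [MeasurableSpace α] [MeasurableSpace β]
    {s : ι → Ω → Ξ} (hs : ∀ i, Measurable (s i)) (h : iIndepFun s Pr) {S T : Set ι}
    (hST : Disjoint S T) {X : Ω → α} {Y : Ω → β}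
    (hX : Measurable[⨆ i ∈ S, MeasurableSpace.comap (s i) inferInstance] X)
    (hY : Measurable[⨆ i ∈ T, MeasurableSpace.comap (s i) inferInstance] Y) :
    IndepFun X Y Pr := by
  rw [IndepFun_iff_Indep]
  have h1 := indep_iSup_of_disjoint (fun i => (hs i).comap_le) ((iIndepFun_iff_iIndep _ _ _).1 h) hST
  exact indep_of_indep_of_le_left (indep_of_indep_of_le_right h1 hY.comap_le) hX.comap_le

theorem measurable_iSup_comap {ι Ω Ξ : Type*} [MeasurableSpace Ξ] (s : ι → Ω → Ξ) {S : Set ι} {i : ι} (hi : i ∈ S) :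
    Measurable[⨆ i ∈ S, MeasurableSpace.comap (s i) inferInstance] (s i) :=
  (comap_measurable (s i)).mono (le_iSup₂_of_le i hi le_rfl) le_rfl

end Independence

/-! ### Calculus of L² bounds. -/

section L2

variable {Ω : Type*} [MeasurableSpace Ω] {Pr : Measure Ω}
  {E : Type*} [NormedAddCommGroup E]

/-- `f` is square integrable with `L²` norm at most `C`. -/
structure L2Le (Pr : Measure Ω) (f : Ω → E) (C : ℝ) : Prop where
  meas : AEStronglyMeasurable f Pr
  nonneg : 0 ≤ C
  le : eLpNorm f 2 Pr ≤ ENNReal.ofReal C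

theorem eLpNorm_two_sq (f : Ω → E) : eLpNorm f 2 Pr ^ 2 = ∫⁻ ω, ‖f ω‖ₑ ^ 2 ∂Pr := by
  have := eLpNorm_nnreal_pow_eq_lintegral (μ := Pr) (f := f) (p := 2) two_ne_zero
  simpa only [NNReal.coe_ofNat, ENNReal.coe_ofNat, ENNReal.rpow_ofNat] using this

namespace L2Le

theorem memLp {f : Ω → E} {C : ℝ} (h : L2Le Pr f C) : MemLp f 2 Pr :=
  ⟨h.meas, h.le.trans_lt ENNReal.ofReal_lt_top⟩

theorem of_lintegral {f : Ω → E} {C : ℝ} (hf : AEStronglyMeasurable f Pr) (hC : 0 ≤ C)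
    (h : ∫⁻ ω, ‖f ω‖ₑ ^ 2 ∂Pr ≤ ENNReal.ofReal (C ^ 2)) : L2Le Pr f C := by
  refine ⟨hf, hC, ?_⟩
  rw [← eLpNorm_two_sq, ENNReal.ofReal_pow hC] at h
  exact (ENNReal.pow_le_pow_left_iff two_ne_zero).1 h

theorem mono {f : Ω → E} {C D : ℝ} (h : L2Le Pr f C) (hCD : C ≤ D) : L2Le Pr f D :=
  ⟨h.meas, h.nonneg.trans hCD, h.le.trans (ENNReal.ofReal_le_ofReal hCD)⟩

theorem add {f g : Ω → E} {C D : ℝ} (hf : L2Le Pr f C) (hg : L2Le Pr g D) :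
    L2Le Pr (fun ω => f ω + g ω) (C + D) := by
  refine ⟨hf.meas.add hg.meas, add_nonneg hf.nonneg hg.nonneg, ?_⟩
  rw [ENNReal.ofReal_add hf.nonneg hg.nonneg]
  exact (eLpNorm_add_le hf.meas hg.meas (by norm_num)).trans (add_le_add hf.le hg.le)

theorem neg {f : Ω → E} {C : ℝ} (hf : L2Le Pr f C) : L2Le Pr (fun ω => -f ω) C :=
  ⟨hf.meas.neg, hf.nonneg, (eLpNorm_neg f 2 Pr).le.trans hf.le⟩

theorem sub {f g : Ω → E} {C D : ℝ} (hf : L2Le Pr f C) (hg : L2Le Pr g D) :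
    L2Le Pr (fun ω => f ω - g ω) (C + D) := by
  simpa only [sub_eq_add_neg] using hf.add hg.neg

theorem zero : L2Le Pr (fun _ => (0 : E)) 0 :=
  ⟨aestronglyMeasurable_const, le_rfl, by simp⟩

theorem const [IsProbabilityMeasure Pr] (c : E) : L2Le Pr (fun _ => c) ‖c‖ := by
  refine ⟨aestronglyMeasurable_const, norm_nonneg c, ?_⟩
  rw [eLpNorm_const c two_ne_zero (IsProbabilityMeasure.ne_zero Pr)]
  simp

theorem of_norm_le {F : Type*} [NormedAddCommGroup F] {f : Ω → E} {g : Ω → F} {C c : ℝ}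
    (hf : L2Le Pr f C) (hc : 0 ≤ c) (hg : AEStronglyMeasurable g Pr)
    (h : ∀ ω, ‖g ω‖ ≤ c * ‖f ω‖) : L2Le Pr g (c * C) := by
  refine ⟨hg, mul_nonneg hc hf.nonneg, ?_⟩
  rw [ENNReal.ofReal_mul hc]
  exact (eLpNorm_le_mul_eLpNorm_of_ae_le_mul (Filter.Eventually.of_forall h) 2).trans
    (mul_le_mul_right hf.le _)

theorem integrable [IsFiniteMeasure Pr] {f : Ω → E} {C : ℝ} (hf : L2Le Pr f C) :
    Integrable f Pr := hf.memLp.integrable (by norm_num)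

theorem smul [NormedSpace ℝ E] {f : Ω → E} {C c : ℝ} (hf : L2Le Pr f C) (hc : 0 ≤ c) :
    L2Le Pr (fun ω => c • f ω) (c * C) :=
  hf.of_norm_le hc (hf.meas.const_smul c) fun ω => by rw [norm_smul, Real.norm_of_nonneg hc]

theorem sum {ι : Type*} (s : Finset ι) {f : ι → Ω → E} {C : ι → ℝ}
    (hf : ∀ i ∈ s, L2Le Pr (f i) (C i)) : L2Le Pr (fun ω => ∑ i ∈ s, f i ω) (∑ i ∈ s, C i) := by
  classical
  induction s using Finset.induction_on with
  | empty => simpa using zero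
  | insert a s ha ih =>
    simp only [Finset.sum_insert ha]
    exact (hf a (Finset.mem_insert_self a s)).add
      (ih fun i hi => hf i (Finset.mem_insert_of_mem hi))

theorem average [NormedSpace ℝ E] {m : ℕ} (hm : 0 < m) {f : Fin m → Ω → E} {C : ℝ} (hf : ∀ i, L2Le Pr (f i) C) :
    L2Le Pr (fun ω => (1 / (m : ℝ)) • ∑ i, f i ω) C := by
  have hm' : (0 : ℝ) < m := Nat.cast_pos.2 hm
  have h := (sum Finset.univ fun i _ => hf i).smul (c := 1 / (m : ℝ)) (by positivity)
  refine h.mono (le_of_eq ?_)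
  simp; field_simp

theorem integral_norm_sq_le {f : Ω → E} {C : ℝ} (hf : L2Le Pr f C) :
    ∫ ω, ‖f ω‖ ^ 2 ∂Pr ≤ C ^ 2 := by
  rw [integral_eq_lintegral_of_nonneg_ae (Filter.Eventually.of_forall fun ω => by positivity)
    (by exact hf.meas.norm.pow 2)]
  refine ENNReal.toReal_le_of_le_ofReal (by positivity) ?_
  have h1 : ∀ ω, ENNReal.ofReal (‖f ω‖ ^ 2) = ‖f ω‖ₑ ^ 2 := fun ω => by
    rw [ENNReal.ofReal_pow (norm_nonneg _), ofReal_norm]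
  simp only [h1]
  rw [← eLpNorm_two_sq, ENNReal.ofReal_pow hf.nonneg]
  exact pow_le_pow_left' hf.le 2

theorem integrable_norm_sq {f : Ω → E} {C : ℝ} (hf : L2Le Pr f C) :
    Integrable (fun ω => ‖f ω‖ ^ 2) Pr := hf.memLp.integrable_norm_pow two_ne_zero

theorem norm_integral_le [NormedSpace ℝ E] [IsProbabilityMeasure Pr] {f : Ω → E} {C : ℝ} (hf : L2Le Pr f C) :
    ‖∫ ω, f ω ∂Pr‖ ≤ C := by
  have h1 : ‖∫ ω, f ω ∂Pr‖ₑ ≤ ENNReal.ofReal C :=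
    calc ‖∫ ω, f ω ∂Pr‖ₑ ≤ ∫⁻ ω, ‖f ω‖ₑ ∂Pr := enorm_integral_le_lintegral_enorm f
      _ = eLpNorm f 1 Pr := eLpNorm_one_eq_lintegral_enorm.symm
      _ ≤ eLpNorm f 2 Pr := eLpNorm_le_eLpNorm_of_exponent_le (by norm_num) hf.meas
      _ ≤ _ := hf.le
  rw [← ofReal_norm] at h1
  exact (ENNReal.ofReal_le_ofReal_iff hf.nonneg).1 h1

end L2Le

end L2

/-! ### Drift and bias of the local iterates of one client. -/

section Local

variable {Ω Ξ : Type*} [MeasurableSpace Ω] [MeasurableSpace Ξ] {Pr : Measure Ω}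
  {E : Type*} [NormedAddCommGroup E] [InnerProductSpace ℝ E] [FiniteDimensional ℝ E]
  [MeasurableSpace E] [BorelSpace E]

/-- `g(w; ξ)`, `ξ ∼ ν`, is an unbiased estimator of the `ℓ`-Lipschitz vector field `G` with
variance at most `σ²`. -/
structure IsOracle (g : E → Ξ → E) (G : E → E) (ν : Measure Ξ) (ℓ σ : ℝ) : Prop where
  meas : Measurable (Function.uncurry g)
  integrable : ∀ w, Integrable (g w) ν
  mean : ∀ w, ∫ s, g w s ∂ν = G w
  var_le : ∀ w, ∫⁻ s, ‖g w s - G w‖ₑ ^ 2 ∂ν ≤ ENNReal.ofReal (σ ^ 2)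
  lip : ∀ w w', ‖G w - G w'‖ ≤ ℓ * ‖w - w'‖

/-- Variance-reduced local iterates with step size `a`, base point `w`, aggregated direction `q`
and samples `s`. -/
noncomputable def localIter (g : E → Ξ → E) (a : ℝ) (w q : E) (s : ℕ → Ξ) : ℕ → E
  | 0 => w
  | n + 1 => localIter g a w q s n
      - a • (g (localIter g a w q s n) (s n) - g w (s n) + q)

theorem measurable_localIter_param {Ω A : Type*} [MeasurableSpace Ω] [MeasurableSpace A]
    {g : A → E → Ξ → E} (hg : Measurable fun p : A × E × Ξ => g p.1 p.2.1 p.2.2) (a : ℝ)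
    {c : Ω → A} {w q : Ω → E} {ζ : ℕ → Ω → Ξ} (hc : Measurable c) (hw : Measurable w)
    (hq : Measurable q) (n : ℕ) (hζ : ∀ k < n, Measurable (ζ k)) :
    Measurable fun ω => localIter (g (c ω)) a (w ω) (q ω) (fun k => ζ k ω) n := by
  induction n with
  | zero => exact hw
  | succ n ih =>
    have h1 := ih fun k hk => hζ k (hk.trans n.lt_succ_self)
    have h2 := hζ n n.lt_succ_self
    have h3 := hg.comp (hc.prodMk (h1.prodMk h2))
    have h4 := hg.comp (hc.prodMk (hw.prodMk h2))
    exact h1.sub (((h3.sub h4).add hq).const_smul a)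

theorem measurable_localIter {Ω : Type*} [MeasurableSpace Ω] {g : E → Ξ → E}
    (hg : Measurable (Function.uncurry g)) (a : ℝ) {w q : Ω → E} {ζ : ℕ → Ω → Ξ}
    (hw : Measurable w) (hq : Measurable q) (n : ℕ) (hζ : ∀ k < n, Measurable (ζ k)) :
    Measurable fun ω => localIter g a (w ω) (q ω) (fun k => ζ k ω) n :=
  measurable_localIter_param (g := fun _ : Unit => g) (c := fun _ => ())
    (hg.comp measurable_snd) a measurable_const hw hq n hζ

variable {g : E → Ξ → E} {G : E → E} {ν : Measure Ξ} {ℓ σ : ℝ}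

namespace IsOracle

theorem continuous {E : Type*} [NormedAddCommGroup E] [InnerProductSpace ℝ E] [MeasurableSpace E]
    {g : E → Ξ → E} {G : E → E} (h : IsOracle g G ν ℓ σ) (hℓ : 0 ≤ ℓ) : Continuous G := by
  refine (LipschitzWith.of_dist_le_mul (K := ⟨ℓ, hℓ⟩) fun x x' => ?_).continuous
  rw [dist_eq_norm, dist_eq_norm]
  exact h.lip x x'

variable [IsProbabilityMeasure Pr] {X : Ω → E} {ζ : Ω → Ξ}

theorem l2Le_noise (h : IsOracle g G ν ℓ σ) (hℓ : 0 ≤ ℓ) (hσ : 0 ≤ σ) (hX : Measurable X)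
    (hζ : Measurable ζ) (hlaw : Measure.map ζ Pr = ν) (hind : IndepFun X ζ Pr) :
    L2Le Pr (fun ω => g (X ω) (ζ ω) - G (X ω)) σ := by
  have hG := (h.continuous hℓ).measurable
  have hΨ : Measurable fun p : E × Ξ => g p.1 p.2 - G p.1 :=
    (h.meas).sub (hG.comp measurable_fst)
  refine .of_lintegral (hΨ.comp (hX.prodMk hζ)).aestronglyMeasurable hσ ?_
  have hΦ : Measurable fun p : E × Ξ => ‖g p.1 p.2 - G p.1‖ₑ ^ 2 := hΨ.enorm.pow_const 2
  rw [lintegral_comp_of_indepFun hX hζ hind hΦ]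
  calc _ ≤ ∫⁻ _ω, ENNReal.ofReal (σ ^ 2) ∂Pr := by
        refine lintegral_mono fun ω => ?_
        rw [← lintegral_map (f := fun s => ‖g (X ω) s - G (X ω)‖ₑ ^ 2)
          (hΦ.comp measurable_prodMk_left) hζ, hlaw]
        exact h.var_le _
    _ = _ := by simp

theorem integral_noise (h : IsOracle g G ν ℓ σ) (hℓ : 0 ≤ ℓ) (hσ : 0 ≤ σ) (hX : Measurable X)
    (hζ : Measurable ζ) (hlaw : Measure.map ζ Pr = ν) (hind : IndepFun X ζ Pr) :
    ∫ ω, (g (X ω) (ζ ω) - G (X ω)) ∂Pr = 0 := by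
  have hG := (h.continuous hℓ).measurable
  have hΨ : Measurable fun p : E × Ξ => g p.1 p.2 - G p.1 :=
    (h.meas).sub (hG.comp measurable_fst)
  have h1 := (indepFun_iff_map_prod_eq_prod_map_map hX.aemeasurable hζ.aemeasurable).1 hind
  have : IsProbabilityMeasure (Measure.map X Pr) := Measure.isProbabilityMeasure_map hX.aemeasurable
  have : IsProbabilityMeasure ν := hlaw ▸ Measure.isProbabilityMeasure_map hζ.aemeasurable
  have h2 := (h.l2Le_noise hℓ hσ hX hζ hlaw hind).integrable
  have h3 : Integrable (fun p : E × Ξ => g p.1 p.2 - G p.1) ((Measure.map X Pr).prod ν) := by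
    rw [← hlaw, ← h1]
    exact (integrable_map_measure hΨ.aestronglyMeasurable (hX.prodMk hζ).aemeasurable).2 h2
  rw [← integral_map (f := fun p : E × Ξ => g p.1 p.2 - G p.1) (hX.prodMk hζ).aemeasurable
    hΨ.aestronglyMeasurable, h1, hlaw, integral_prod _ h3]
  have h4 : ∀ x, ∫ s, (g x s - G x) ∂ν = 0 := fun x => by
    rw [integral_sub (h.integrable x) (integrable_const _), h.mean]
    simp
  simp [h4]

theorem l2Le_noise_const (h : IsOracle g G ν ℓ σ) (hℓ : 0 ≤ ℓ) (hσ : 0 ≤ σ) (w : E)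
    (hζ : Measurable ζ) (hlaw : Measure.map ζ Pr = ν) :
    L2Le Pr (fun ω => g w (ζ ω) - G w) σ :=
  h.l2Le_noise hℓ hσ (X := fun _ => w) measurable_const hζ hlaw (indepFun_const_left w ζ)

theorem integral_noise_const (h : IsOracle g G ν ℓ σ) (hℓ : 0 ≤ ℓ) (hσ : 0 ≤ σ) (w : E)
    (hζ : Measurable ζ) (hlaw : Measure.map ζ Pr = ν) :
    ∫ ω, (g w (ζ ω) - G w) ∂Pr = 0 :=
  h.integral_noise hℓ hσ (X := fun _ => w) measurable_const hζ hlaw (indepFun_const_left w ζ)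

variable {q : Ω → E} {ζ : ℕ → Ω → Ξ} {a Q : ℝ} {w : E} {N : ℕ}

/-- Separates the increment into the noise at the current point, the noise at the base point, the
drift of the mean field and the aggregated direction. The two noises share a sample but are bounded
separately. -/
theorem _root_.FedNest.localIter_step {Ω Ξ E : Type*} [NormedAddCommGroup E]
    [InnerProductSpace ℝ E] {g : E → Ξ → E} {G : E → E} {q : Ω → E} {ζ : ℕ → Ω → Ξ} {a : ℝ} {w : E}
    (ω : Ω) (n : ℕ) :
    localIter g a w (q ω) (fun k => ζ k ω) (n + 1) - w
      = (localIter g a w (q ω) (fun k => ζ k ω) n - w)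
        - a • ((g (localIter g a w (q ω) (fun k => ζ k ω) n) (ζ n ω)
              - G (localIter g a w (q ω) (fun k => ζ k ω) n))
            - (g w (ζ n ω) - G w)
            + (G (localIter g a w (q ω) (fun k => ζ k ω) n) - G w) + q ω) := by
  rw [localIter]
  simp only [smul_add, smul_sub]
  abel

/-- By the triangle inequality in L², each step adds at most a times Q + 2σ plus the drift;
independence is used only to bound the noise at the random current point. -/
theorem l2Le_localIter (h : IsOracle g G ν ℓ σ) (hℓ : 0 ≤ ℓ) (hσ : 0 ≤ σ) (ha : 0 ≤ a)
    (hN : 2 * (a * N) * ℓ ≤ 1) (hq : Measurable q) (hQ : L2Le Pr q Q)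
    (hζ : ∀ n, Measurable (ζ n)) (hlaw : ∀ n, Measure.map (ζ n) Pr = ν)
    (hind : ∀ n, IndepFun (fun ω => localIter g a w (q ω) (fun k => ζ k ω) n) (ζ n) Pr)
    {n : ℕ} (hn : n ≤ N) :
    L2Le Pr (fun ω => localIter g a w (q ω) (fun k => ζ k ω) n - w)
      (2 * (a * n) * (Q + 2 * σ)) := by
  have hQ0 := hQ.nonneg
  induction n with
  | zero => simpa [localIter] using L2Le.zero
  | succ n ih =>
    have ih := ih (Nat.le_of_succ_le hn)
    have hm := measurable_localIter h.meas a (measurable_const (a := w)) hq n fun k _ => hζ k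
    have hG := (h.continuous hℓ).measurable
    have h1 := ih.of_norm_le (g := fun ω => G (localIter g a w (q ω) (fun k => ζ k ω) n) - G w) hℓ
      ((hG.comp hm).sub_const _).aestronglyMeasurable fun ω => h.lip _ _
    have h2 := h.l2Le_noise hℓ hσ hm (hζ n) (hlaw n) (hind n)
    have h3 := h.l2Le_noise_const hℓ hσ w (hζ n) (hlaw n)
    have h4 := ih.sub ((((h2.sub h3).add h1).add hQ).smul ha)
    simp only [localIter_step (G := G)]
    refine h4.mono ?_
    have hn' : (n : ℝ) ≤ N := by exact_mod_cast Nat.le_of_succ_le hn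
    -- The step size restriction makes the drift no larger than the other terms, which accounts for
    -- the factor 2.
    have h5 : ℓ * (2 * (a * n) * (Q + 2 * σ)) ≤ Q + 2 * σ := by
      have h6 : 2 * (a * n) * ℓ ≤ 1 := le_trans (by gcongr) hN
      nlinarith
    push_cast
    nlinarith [mul_le_mul_of_nonneg_left h5 ha]

/-- In expectation both noises vanish, so beyond the aggregated direction only the drift remains. It
is ℓ times the L² displacement, and so the bias is second order in a·N. -/
theorem norm_integral_localIter_le (h : IsOracle g G ν ℓ σ) (hℓ : 0 ≤ ℓ) (hσ : 0 ≤ σ)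
    (ha : 0 ≤ a) (hN : 2 * (a * N) * ℓ ≤ 1) (hq : Measurable q) (hQ : L2Le Pr q Q)
    (hζ : ∀ n, Measurable (ζ n)) (hlaw : ∀ n, Measure.map (ζ n) Pr = ν)
    (hind : ∀ n, IndepFun (fun ω => localIter g a w (q ω) (fun k => ζ k ω) n) (ζ n) Pr)
    {n : ℕ} (hn : n ≤ N) :
    ‖∫ ω, (localIter g a w (q ω) (fun k => ζ k ω) n - w) ∂Pr + (a * n) • ∫ ω, q ω ∂Pr‖
      ≤ (a * n) * (ℓ * (2 * (a * N) * (Q + 2 * σ))) := by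
  have hQ0 := hQ.nonneg
  induction n with
  | zero => simp [localIter]
  | succ n ih =>
    have ih := ih (Nat.le_of_succ_le hn)
    have hL := h.l2Le_localIter hℓ hσ ha hN hq hQ hζ hlaw hind (Nat.le_of_succ_le hn)
    have hm := measurable_localIter h.meas a (measurable_const (a := w)) hq n fun k _ => hζ k
    have hG := (h.continuous hℓ).measurable
    have h1 := hL.of_norm_le (g := fun ω => G (localIter g a w (q ω) (fun k => ζ k ω) n) - G w) hℓ
      ((hG.comp hm).sub_const _).aestronglyMeasurable fun ω => h.lip _ _
    have h2 := h.l2Le_noise hℓ hσ hm (hζ n) (hlaw n) (hind n)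
    have h3 := h.l2Le_noise_const hℓ hσ w (hζ n) (hlaw n)
    have h4 : ∫ ω, (localIter g a w (q ω) (fun k => ζ k ω) (n + 1) - w) ∂Pr
        = ∫ ω, (localIter g a w (q ω) (fun k => ζ k ω) n - w) ∂Pr
          - a • (∫ ω, (G (localIter g a w (q ω) (fun k => ζ k ω) n) - G w) ∂Pr
            + ∫ ω, q ω ∂Pr) := by
      simp only [localIter_step (G := G)]
      rw [integral_sub hL.integrable
        ((((h2.sub h3).add h1).add hQ).smul ha).integrable, integral_smul,
        integral_add ((h2.sub h3).add h1).integrable hQ.integrable,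
        integral_add (h2.sub h3).integrable h1.integrable,
        integral_sub h2.integrable h3.integrable,
        h.integral_noise hℓ hσ hm (hζ n) (hlaw n) (hind n),
        h.integral_noise_const hℓ hσ w (hζ n) (hlaw n), sub_zero, zero_add]
    have h5 : ∫ ω, (localIter g a w (q ω) (fun k => ζ k ω) (n + 1) - w) ∂Pr
          + (a * (n + 1 : ℕ)) • ∫ ω, q ω ∂Pr
        = (∫ ω, (localIter g a w (q ω) (fun k => ζ k ω) n - w) ∂Pr + (a * n) • ∫ ω, q ω ∂Pr)
          - a • ∫ ω, (G (localIter g a w (q ω) (fun k => ζ k ω) n) - G w) ∂Pr := by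
      rw [h4]
      push_cast
      rw [mul_add, add_smul, mul_one, smul_add]
      abel
    have hn' : (n : ℝ) ≤ N := by exact_mod_cast Nat.le_of_succ_le hn
    rw [h5]
    calc _ ≤ _ := norm_sub_le _ _
      _ ≤ (a * n) * (ℓ * (2 * (a * N) * (Q + 2 * σ)))
          + a * (ℓ * (2 * (a * N) * (Q + 2 * σ))) := by
        refine add_le_add ih ?_
        rw [norm_smul, Real.norm_of_nonneg ha]
        refine mul_le_mul_of_nonneg_left (h1.norm_integral_le.trans ?_) ha
        gcongr
      _ = _ := by push_cast; ring

end IsOracle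

end Local

end FedNest

namespace FedNest

/-! ### First and second moments of one federated step. -/

section FedStep

variable {Ω Ξ : Type*} [MeasurableSpace Ω] [MeasurableSpace Ξ] {Pr : Measure Ω} {m : ℕ}
  {E : Type*} [NormedAddCommGroup E] [InnerProductSpace ℝ E] [FiniteDimensional ℝ E]
  [MeasurableSpace E] [BorelSpace E]

theorem measurable_average {Ω : Type*} {mΩ : MeasurableSpace Ω} {f : Fin m → Ω → E}
    (hf : ∀ i, Measurable (f i)) : Measurable fun ω => (1 / (m : ℝ)) • ∑ i, f i ω :=
  Measurable.const_smul (Finset.measurable_sum _ fun i _ => hf i) _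

/-- One federated step: the average over the clients of their last local iterates. -/
noncomputable def fedStep (g : Fin m → E → Ξ → E) (τ : Fin m → ℕ) (a : Fin m → ℝ) (w : E)
    (s : Fin m → Option ℕ → Ξ) : E :=
  (1 / (m : ℝ)) • ∑ i, localIter (g i) (a i) w ((1 / (m : ℝ)) • ∑ j, g j w (s j none))
    (fun k => s i (some k)) (τ i)

theorem measurable_fedStep {Ω A : Type*} [MeasurableSpace Ω] [MeasurableSpace A]
    {g : Fin m → A → E → Ξ → E} (hg : ∀ i, Measurable fun p : A × E × Ξ => g i p.1 p.2.1 p.2.2)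
    (τ : Fin m → ℕ) (a : Fin m → ℝ) {c : Ω → A} {w : Ω → E} {s : Ω → Fin m → Option ℕ → Ξ}
    (hc : Measurable c) (hw : Measurable w) (hs : ∀ i j, Measurable fun ω => s ω i j) :
    Measurable fun ω => fedStep (fun i => g i (c ω)) τ a (w ω) (s ω) := by
  refine measurable_average fun i => ?_
  refine measurable_localIter_param (hg i) (a i) hc hw ?_ _ fun k _ => hs i (some k)
  exact measurable_average fun j => (hg j).comp (hc.prodMk (hw.prodMk (hs j none)))

/-- The local step γ/τ_i taken τ_i times amounts to γ for every client, so the bounds do not see τ.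
The noise 3σ is σ from the aggregated direction and 2σ from the local corrections. -/
theorem fedStep_moments [IsProbabilityMeasure Pr] (hm : 0 < m) {g : Fin m → E → Ξ → E}
    {G : Fin m → E → E} {ν : Fin m → Measure Ξ} {ℓ σ : ℝ}
    (h : ∀ i, IsOracle (g i) (G i) (ν i) ℓ σ) (hℓ : 0 ≤ ℓ) (hσ : 0 ≤ σ) {τ : Fin m → ℕ}
    (hτ : ∀ i, 1 ≤ τ i) {γ : ℝ} (hγ : 0 ≤ γ) (hγℓ : 2 * γ * ℓ ≤ 1)
    {s : Fin m → Option ℕ → Ω → Ξ} (hs : ∀ i j, Measurable (s i j))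
    (hind : iIndepFun (fun p : (_ : Fin m) × Option ℕ => s p.1 p.2) Pr)
    (hlaw : ∀ i j, Measure.map (s i j) Pr = ν i) (w : E) :
    L2Le Pr (fun ω => fedStep g τ (fun i => γ / τ i) w (fun i j => s i j ω) - w)
        (2 * γ * (‖(1 / (m : ℝ)) • ∑ i, G i w‖ + 3 * σ)) ∧
      ‖∫ ω, (fedStep g τ (fun i => γ / τ i) w (fun i j => s i j ω) - w) ∂Pr
          + γ • ((1 / (m : ℝ)) • ∑ i, G i w)‖
        ≤ 2 * γ ^ 2 * ℓ * (‖(1 / (m : ℝ)) • ∑ i, G i w‖ + 3 * σ) := by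
  set Gb := (1 / (m : ℝ)) • ∑ i, G i w with hGb
  set q : Ω → E := fun ω => (1 / (m : ℝ)) • ∑ j, g j w (s j none ω) with hq
  have hm' : (0 : ℝ) < m := Nat.cast_pos.2 hm
  have hgm : ∀ j, Measurable (g j w) := fun j => (h j).meas.comp measurable_prodMk_left
  have hqm : Measurable q :=
    measurable_average fun j => (hgm j).comp (hs j none)
  have hnoise : ∀ j, L2Le Pr (fun ω => g j w (s j none ω) - G j w) σ := fun j =>
    (h j).l2Le_noise_const hℓ hσ w (hs j none) (hlaw j none)
  have hqe : ∀ ω, q ω = (1 / (m : ℝ)) • ∑ j, (g j w (s j none ω) - G j w) + Gb := fun ω => by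
    rw [Finset.sum_sub_distrib, smul_sub, sub_add_cancel]
  have hav := L2Le.average hm hnoise
  have hQ : L2Le Pr q (‖Gb‖ + σ) := by
    have := hav.add (L2Le.const Gb)
    rw [show q = _ from funext hqe]
    exact this.mono (add_comm _ _).le
  have hqi : ∫ ω, q ω ∂Pr = Gb := by
    simp only [hqe]
    rw [integral_add hav.integrable (integrable_const _), integral_smul,
      integral_finsetSum _ fun j _ => (hnoise j).integrable]
    simp [fun j => (h j).integral_noise_const hℓ hσ w (hs j none) (hlaw j none)]
  have hloc : ∀ i n, IndepFun (fun ω => localIter (g i) (γ / τ i) w (q ω)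
      (fun k => s i (some k) ω) n) (s i (some n)) Pr := fun i n => by
    set s' : (_ : Fin m) × Option ℕ → Ω → Ξ := fun p => s p.1 p.2 with hs'
    -- The n-th local iterate depends on all the aggregation samples and on the client's own earlier
    -- local samples. This set contains those labels and misses slot n.
    set S : Set ((_ : Fin m) × Option ℕ) := {p | p.2 = none ∨ ∃ k < n, p.2 = some k} with hS
    set T : Set ((_ : Fin m) × Option ℕ) := {⟨i, some n⟩} with hT
    refine indepFun_of_measurable_iSup (s := s') (fun p => hs p.1 p.2) hind (S := S) (T := T)
      ?_ ?_ (measurable_iSup_comap s' (i := ⟨i, some n⟩) rfl)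
    · rw [Set.disjoint_singleton_right]
      simp [hS]
    · have h0 : ∀ j, Measurable[⨆ p ∈ S, MeasurableSpace.comap (s' p) inferInstance]
          (s j none) := fun j => measurable_iSup_comap s' (S := S) (i := ⟨j, none⟩) (Or.inl rfl)
      have h1 : ∀ k < n, Measurable[⨆ p ∈ S, MeasurableSpace.comap (s' p) inferInstance]
          (s i (some k)) := fun k hk =>
        measurable_iSup_comap s' (S := S) (i := ⟨i, some k⟩) (Or.inr ⟨k, hk, rfl⟩)
      have h2 : Measurable[⨆ p ∈ S, MeasurableSpace.comap (s' p) inferInstance] q :=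
        measurable_average fun j => (hgm j).comp (h0 j)
      exact @measurable_localIter _ _ _ _ _ _ _ _ _
        (⨆ p ∈ S, MeasurableSpace.comap (s' p) inferInstance) _ (h i).meas _ _ _ _
        measurable_const h2 n h1
  have hτ' : ∀ i, (0 : ℝ) < τ i := fun i => Nat.cast_pos.2 (hτ i)
  have hmul : ∀ i, γ / τ i * τ i = γ := fun i => div_mul_cancel₀ γ (hτ' i).ne'
  have ha : ∀ i, 0 ≤ γ / τ i := fun i => div_nonneg hγ (hτ' i).le
  have hN : ∀ i, 2 * (γ / τ i * τ i) * ℓ ≤ 1 := fun i => by rwa [hmul]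
  have hL := fun i => (h i).l2Le_localIter hℓ hσ (ha i) (hN i) hqm hQ (fun n => hs i (some n))
    (fun n => hlaw i (some n)) (hloc i) (le_refl (τ i))
  have hI := fun i => (h i).norm_integral_localIter_le hℓ hσ (ha i) (hN i) hqm hQ
    (fun n => hs i (some n)) (fun n => hlaw i (some n)) (hloc i) (le_refl (τ i))
  simp only [hmul] at hL hI
  have hstep : ∀ ω, fedStep g τ (fun i => γ / τ i) w (fun i j => s i j ω) - w
      = (1 / (m : ℝ)) • ∑ i, (localIter (g i) (γ / τ i) w (q ω) (fun k => s i (some k) ω) (τ i)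
          - w) := fun ω => by
    rw [Finset.sum_sub_distrib, smul_sub, Finset.sum_const, Finset.card_univ, Fintype.card_fin,
      ← Nat.cast_smul_eq_nsmul ℝ, smul_smul, one_div_mul_cancel hm'.ne', one_smul]
    rfl
  simp only [hstep]
  refine ⟨(L2Le.average hm hL).mono (le_of_eq (by ring)), ?_⟩
  rw [integral_smul, integral_finsetSum _ fun i _ => (hL i).integrable]
  have := norm_average_sub_le hm
    (fun i => ∫ ω, (localIter (g i) (γ / τ i) w (q ω) (fun k => s i (some k) ω) (τ i) - w) ∂Pr)
    (fun _ => -(γ • Gb)) (C := 2 * γ ^ 2 * ℓ * (‖Gb‖ + 3 * σ)) fun i => by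
      rw [sub_neg_eq_add, ← hqi]
      refine (hI i).trans (le_of_eq ?_)
      rw [hqi]; ring
  rw [Finset.sum_const, Finset.card_univ, Fintype.card_fin, ← Nat.cast_smul_eq_nsmul ℝ,
    smul_smul, one_div_mul_cancel hm'.ne', one_smul, sub_neg_eq_add] at this
  exact this

end FedStep

end FedNest

/-! ### Partial stochastic gradients as measurable, unbiased oracles. -/

namespace FedNest

theorem continuous_of_differentiable_real {E : Type*} [NormedAddCommGroup E] [NormedSpace ℝ E]
    {f : E → ℝ} (hf : Differentiable ℝ f) : Continuous f := hf.continuous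

namespace Problem

variable {d₁ d₂ m : ℕ} {Ξ : Type*} [MeasurableSpace Ξ] {P : Problem d₁ d₂ m Ξ}
  {ℓ₀ ℓ₁ ℓ₂ μ σ : ℝ}

/-- The loss is continuous in z and measurable in the sample, hence jointly measurable. Directional
derivatives are limits of its difference quotients along a sequence tending to 0. -/
theorem GoodSamples.measurable_inner_stochGrad (h : P.GoodSamples σ) (i : Fin m) (u : Vec d₁)
    (v : Vec d₂) :
    Measurable fun p : Vec d₁ × Vec d₂ × Ξ =>
      inner ℝ (P.stochGrad i (pt p.1 p.2.1) p.2.2) (pt u v) := by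
  have hl : Measurable fun p : (Vec d₁ × Vec d₂) × Ξ => P.loss i (pt p.1.1 p.1.2) p.2 :=
    measurable_uncurry_of_continuous_of_measurable
      (u := fun (p : Vec d₁ × Vec d₂) s => P.loss i (pt p.1 p.2) s)
      (fun s => (continuous_of_differentiable_real (h.diff i s)).comp continuous_pt) fun p => h.meas i _
  set t : ℕ → ℝ := fun n => 1 / ((n : ℝ) + 1) with ht
  have htend : Filter.Tendsto t Filter.atTop (nhdsWithin 0 {0}ᶜ) :=
    tendsto_nhdsWithin_iff.2 ⟨tendsto_one_div_add_atTop_nhds_zero_nat,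
      Filter.Eventually.of_forall fun n => (Nat.one_div_pos_of_nat (α := ℝ)).ne'⟩
  refine measurable_of_tendsto_metrizable (f := fun n (p : Vec d₁ × Vec d₂ × Ξ) =>
    (t n)⁻¹ * (P.loss i (pt (p.1 + t n • u) (p.2.1 + t n • v)) p.2.2
      - P.loss i (pt p.1 p.2.1) p.2.2)) (fun n => ?_) ?_
  · refine Measurable.const_mul (Measurable.sub ?_ ?_) _
    · exact hl.comp (((measurable_fst.add_const _).prodMk
        ((measurable_fst.comp measurable_snd).add_const _)).prodMk
          (measurable_snd.comp measurable_snd))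
    · exact hl.comp ((measurable_fst.prodMk (measurable_fst.comp measurable_snd)).prodMk
          (measurable_snd.comp measurable_snd))
  · rw [tendsto_pi_nhds]
    rintro ⟨x, y, s⟩
    have h1 := hasDerivAt_comp_add_smul (h.diff i s) (pt x y) (pt u v) 0
    rw [hasDerivAt_iff_tendsto_slope_zero] at h1
    have h2 := h1.comp htend
    simp only [zero_add, zero_smul, add_zero, pt_add_smul] at h2
    have h3 : inner ℝ (P.stochGrad i (pt x y) s) (pt u v)
        = fderiv ℝ (fun z => P.loss i z s) (pt x y) (pt u v) := by
      rw [stochGrad, gradient, InnerProductSpace.toDual_symm_apply]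
    rw [h3]
    exact h2

theorem measurable_euclidean_of_inner {Ω : Type*} [MeasurableSpace Ω] {d : ℕ} {f : Ω → Vec d}
    (hf : ∀ u, Measurable fun ω => inner ℝ (f ω) u) : Measurable f := by
  have h1 : Measurable fun ω => (f ω).ofLp := measurable_pi_iff.2 fun j => by
    have := hf (EuclideanSpace.single j 1)
    simpa [EuclideanSpace.inner_single_right] using this
  exact (WithLp.measurable_toLp 2 _).comp h1

theorem GoodSamples.measurable_gradX (h : P.GoodSamples σ) (i : Fin m) :
    Measurable fun p : Vec d₁ × Vec d₂ × Ξ => P.gradX i p.1 p.2.1 p.2.2 :=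
  measurable_euclidean_of_inner fun u => by
    have := h.measurable_inner_stochGrad i u 0
    simp only [inner_pt, inner_zero_right, add_zero] at this
    exact this

theorem GoodSamples.measurable_gradY (h : P.GoodSamples σ) (i : Fin m) :
    Measurable fun p : Vec d₁ × Vec d₂ × Ξ => P.gradY i p.1 p.2.1 p.2.2 :=
  measurable_euclidean_of_inner fun u => by
    have := h.measurable_inner_stochGrad i 0 u
    simp only [inner_pt, inner_zero_right, zero_add] at this
    exact this

theorem GoodSamples.lintegral_var_le (h : P.GoodSamples σ) (i : Fin m) (z : Pt d₁ d₂) :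
    ∫⁻ s, ‖P.stochGrad i z s - gradient (P.clientObj i) z‖ₑ ^ 2 ∂(P.law i)
      ≤ ENNReal.ofReal (σ ^ 2) := by
  have h1 : ∀ s, ‖P.stochGrad i z s - gradient (P.clientObj i) z‖ₑ ^ 2
      = ENNReal.ofReal (‖P.stochGrad i z s - gradient (P.clientObj i) z‖ ^ 2) := fun s => by
    rw [ENNReal.ofReal_pow (norm_nonneg _), ofReal_norm]
  simp only [h1]
  rw [← ofReal_integral_eq_lintegral_ofReal (h.var_integrable i z)
    (Filter.Eventually.of_forall fun s => by positivity)]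
  exact ENNReal.ofReal_le_ofReal (h.var_le i z)

theorem GoodSamples.isOracle_gradX (h : P.GoodSamples σ) (hw : P.WellBehaved ℓ₀ ℓ₁ ℓ₂ μ)
    (i : Fin m) (y : Vec d₂) :
    IsOracle (fun x s => P.gradX i x y s) (fun x => (gradient (P.clientObj i) (pt x y)).fst)
      (P.law i) ℓ₁ σ where
  meas := (h.measurable_gradX i).comp
    (measurable_fst.prodMk (measurable_const.prodMk measurable_snd))
  integrable x := (h.grad_integrable i (pt x y)).prodLp_fst
  mean x := by
    rw [← h.unbiased, fst_integral_withLp (h.grad_integrable i (pt x y))]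
    rfl
  var_le x := by
    refine le_trans (lintegral_mono fun s => ?_) (h.lintegral_var_le i (pt x y))
    refine pow_le_pow_left' (enorm_le_iff_norm_le.2 ?_) 2
    exact norm_fst_le (P.stochGrad i (pt x y) s - gradient (P.clientObj i) (pt x y))
  lip x x' := by
    have h1 := (norm_fst_le _).trans (hw.lip_grad i (pt x y) (pt x' y))
    rwa [pt_sub_pt, sub_self, norm_pt_zero_right] at h1

theorem GoodSamples.isOracle_gradY (h : P.GoodSamples σ) (hw : P.WellBehaved ℓ₀ ℓ₁ ℓ₂ μ)
    (i : Fin m) (x : Vec d₁) :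
    IsOracle (fun y s => -P.gradY i x y s) (fun y => -(gradient (P.clientObj i) (pt x y)).snd)
      (P.law i) ℓ₁ σ where
  meas := ((h.measurable_gradY i).comp
    (measurable_const.prodMk (measurable_fst.prodMk measurable_snd))).neg
  integrable y := (h.grad_integrable i (pt x y)).prodLp_snd.neg
  mean y := by
    rw [← h.unbiased, snd_integral_withLp (h.grad_integrable i (pt x y)), integral_neg]
    rfl
  var_le y := by
    refine le_trans (lintegral_mono fun s => ?_) (h.lintegral_var_le i (pt x y))
    refine pow_le_pow_left' (enorm_le_iff_norm_le.2 ?_) 2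
    rw [neg_sub_neg, norm_sub_rev]
    exact norm_snd_le (P.stochGrad i (pt x y) s - gradient (P.clientObj i) (pt x y))
  lip y y' := by
    have h1 := (norm_snd_le _).trans (hw.lip_grad i (pt x y) (pt x y'))
    rw [pt_sub_pt, sub_self, norm_pt_zero_left] at h1
    rw [neg_sub_neg, norm_sub_rev]
    exact h1

theorem fedInn_eq_fedStep (τ : Fin m → ℕ) (β : Fin m → ℝ) (x : Vec d₁) (y : Vec d₂)
    (s : Fin m → Option ℕ → Ξ) :
    P.fedInn τ β x y s = fedStep (fun i y s => -P.gradY i x y s) τ β y s := by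
  have h1 : ∀ i b q s n, P.fedInnLocal i b x y q s n
      = localIter (fun y s => -P.gradY i x y s) b y q s n := fun i b q s n => by
    induction n with
    | zero => rfl
    | succ n ih => simp only [fedInnLocal, localIter, ih]
  simp only [fedInn, fedStep, h1]

theorem fedOut_eq_fedStep (τ : Fin m → ℕ) (α : Fin m → ℝ) (x : Vec d₁) (yp : Vec d₂)
    (s : Fin m → Option ℕ → Ξ) :
    P.fedOut τ α x yp s = fedStep (fun i x s => P.gradX i x yp s) τ α x s := by
  have h1 : ∀ i b q s n, P.fedOutLocal i b x yp q s n
      = localIter (fun x s => P.gradX i x yp s) b x q s n := fun i b q s n => by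
    induction n with
    | zero => rfl
    | succ n ih => simp only [fedOutLocal, localIter, ih]
  simp only [fedOut, fedStep, h1]

theorem WellBehaved.average_gradX (hw : P.WellBehaved ℓ₀ ℓ₁ ℓ₂ μ) (z : Pt d₁ d₂) :
    (1 / (m : ℝ)) • ∑ i, (gradient (P.clientObj i) z).fst = (gradient P.avgObj z).fst := by
  rw [hw.gradient_avgObj, WithLp.smul_fst]
  congr 1
  exact (map_sum (WithLp.fstL 2 ℝ (Vec d₁) (Vec d₂)) _ _).symm

theorem WellBehaved.average_gradY (hw : P.WellBehaved ℓ₀ ℓ₁ ℓ₂ μ) (z : Pt d₁ d₂) :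
    (1 / (m : ℝ)) • ∑ i, -(gradient (P.clientObj i) z).snd = -(gradient P.avgObj z).snd := by
  rw [hw.gradient_avgObj, WithLp.smul_snd, Finset.sum_neg_distrib, smul_neg]
  congr 2
  exact (map_sum (WithLp.sndL 2 ℝ (Vec d₁) (Vec d₂)) _ _).symm

end Problem

end FedNest

namespace FedNest

/-! ### Expectation of a quadratic upper bound. -/

section Expansion

variable {Ω : Type*} [MeasurableSpace Ω] {Pr : Measure Ω} [IsProbabilityMeasure Pr]
  {E : Type*} [NormedAddCommGroup E] [InnerProductSpace ℝ E] [CompleteSpace E]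

/-- The linear term sees only the mean of U, the quadratic one only its second moment: exactly the
two facts known about a federated step. -/
theorem L2Le.lintegral_le_of_le_quadratic {U : Ω → E} {C : ℝ} (hU : L2Le Pr U C) {φ : Ω → ℝ}
    (hφ : ∀ ω, 0 ≤ φ ω) {A B : ℝ} (hB : 0 ≤ B) (p : E)
    (h : ∀ ω, φ ω ≤ A + inner ℝ p (U ω) + B * ‖U ω‖ ^ 2) :
    0 ≤ A + inner ℝ p (∫ ω, U ω ∂Pr) + B * C ^ 2 ∧
      ∫⁻ ω, ENNReal.ofReal (φ ω) ∂Pr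
        ≤ ENNReal.ofReal (A + inner ℝ p (∫ ω, U ω ∂Pr) + B * C ^ 2) := by
  have h1 : Integrable (fun ω => inner ℝ p (U ω)) Pr := hU.integrable.const_inner p
  have h2 := hU.integrable_norm_sq.const_mul B
  have h3 : Integrable (fun ω => A + inner ℝ p (U ω)) Pr := (integrable_const A).add h1
  have h4 : Integrable (fun ω => A + inner ℝ p (U ω) + B * ‖U ω‖ ^ 2) Pr := h3.add h2
  have h5 : ∫ ω, (A + inner ℝ p (U ω) + B * ‖U ω‖ ^ 2) ∂Pr
      ≤ A + inner ℝ p (∫ ω, U ω ∂Pr) + B * C ^ 2 := by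
    rw [integral_add h3 h2, integral_add (integrable_const A) h1, integral_const_mul,
      integral_inner hU.integrable]
    have := mul_le_mul_of_nonneg_left hU.integral_norm_sq_le hB
    simp only [integral_const, probReal_univ, one_smul]
    linarith
  have h6 : ∀ ω, 0 ≤ A + inner ℝ p (U ω) + B * ‖U ω‖ ^ 2 := fun ω => (hφ ω).trans (h ω)
  refine ⟨(integral_nonneg h6).trans h5, ?_⟩
  calc ∫⁻ ω, ENNReal.ofReal (φ ω) ∂Pr
      ≤ ∫⁻ ω, ENNReal.ofReal (A + inner ℝ p (U ω) + B * ‖U ω‖ ^ 2) ∂Pr :=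
        lintegral_mono fun ω => ENNReal.ofReal_le_ofReal (h ω)
    _ = ENNReal.ofReal (∫ ω, (A + inner ℝ p (U ω) + B * ‖U ω‖ ^ 2) ∂Pr) :=
        (ofReal_integral_eq_lintegral_ofReal h4 (Filter.Eventually.of_forall h6)).symm
    _ ≤ _ := ENNReal.ofReal_le_ofReal h5

end Expansion

/-! ### Real inequalities behind the inner and outer steps. -/

section Arithmetic

/-- Strong concavity supplies −2βμr². Young's inequality bounds the second-order terms by β²(14ℓ²r²
+ 108σ²), and the step size condition lets one βμr² pay for the first part. -/
theorem inner_step_arith {r β μ ℓ σ M J : ℝ} (hβ : 0 ≤ β)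
    (hM0 : 0 ≤ M) (hM : M ≤ ℓ * r + 3 * σ) (hβμ : 14 * β * ℓ ^ 2 ≤ μ)
    (hJ : J ≤ -(β * μ * r ^ 2) + r * (2 * β ^ 2 * ℓ * M)) :
    r ^ 2 + 2 * J + 1 * (2 * β * M) ^ 2 ≤ (1 - β * μ) * r ^ 2 + 108 * β ^ 2 * σ ^ 2 := by
  have h1 : M ^ 2 ≤ 2 * (ℓ * r) ^ 2 + 18 * σ ^ 2 := by
    have := pow_le_pow_left₀ hM0 hM 2
    nlinarith [sq_nonneg (ℓ * r - 3 * σ)]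
  have h2 : 2 * (ℓ * r) * M ≤ (ℓ * r) ^ 2 + M ^ 2 := by nlinarith [sq_nonneg (ℓ * r - M)]
  have h3 : β ^ 2 * (2 * (2 * (ℓ * r) * M) + 4 * M ^ 2)
      ≤ β ^ 2 * (14 * (ℓ * r) ^ 2 + 108 * σ ^ 2) :=
    mul_le_mul_of_nonneg_left (by linarith) (sq_nonneg β)
  have h4 : β * r ^ 2 * (14 * β * ℓ ^ 2) ≤ β * r ^ 2 * μ :=
    mul_le_mul_of_nonneg_left hβμ (by positivity)
  nlinarith

/-- Coefficient of the squared inner error in the outer descent inequality. -/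
noncomputable def errCoef (ℓ₀ ℓ₁ ℓ₂ σ : ℝ) : ℝ :=
  3 * ℓ₁ ^ 2 + 4 + 2 * ℓ₁ + 8 * (ℓ₂ / ℓ₁) * (ℓ₀ + 3 * σ) ^ 2

/-- Coefficient of the noise in the outer descent inequality. -/
noncomputable def noiseCoef (ℓ₀ ℓ₁ ℓ₂ σ : ℝ) : ℝ :=
  (ℓ₀ + 3 * σ) ^ 2 * (6 + 10 * ℓ₁ + 8 * (ℓ₂ / ℓ₁))

/-- Half of the descent αn² absorbs the cross terms in nr. Everything else is sorted into multiples
of αr² and of α²κ²M², whose totals are `errCoef` and `noiseCoef`. -/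
theorem outer_step_arith {f r n α κ ℓ₁ e M I₁ I₂ : ℝ} (hr : 0 ≤ r) (hα : 0 ≤ α) (hℓ₁ : 0 ≤ ℓ₁)
    (he : 0 ≤ e) (hκ : 1 ≤ κ) (hακ : α * κ ^ 2 ≤ 1)
    (hI₁ : I₁ ≤ -(α * n ^ 2) + α * n * ℓ₁ * r + M * (2 * α ^ 2 * ℓ₁ * M))
    (hI₂ : I₂ ≤ 2 * r * (α * (n + ℓ₁ * r) + 2 * α ^ 2 * ℓ₁ * M)) :
    f + 1 / κ * r ^ 2 + (I₁ + I₂)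
        + (ℓ₁ * (1 + κ ^ 2) + (2 * (e * (1 + κ ^ 2)) * r + κ)) * (2 * α * M) ^ 2
      ≤ f + (1 / κ + α * (3 * ℓ₁ ^ 2 + 4 + 2 * ℓ₁ + 8 * e * M ^ 2)) * r ^ 2 - α / 2 * n ^ 2
        + M ^ 2 * (6 + 10 * ℓ₁ + 8 * e) * κ ^ 2 * α ^ 2 := by
  have hκ2 : 1 ≤ κ ^ 2 := one_le_pow₀ hκ
  have hκκ : κ ≤ κ ^ 2 := by nlinarith
  have hα1 : α ≤ 1 := by nlinarith
  have h1 : α * (n * ℓ₁ * r + 2 * r * n) ≤ α * (n ^ 2 / 2 + (ℓ₁ ^ 2 + 4) * r ^ 2) :=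
    mul_le_mul_of_nonneg_left
      (by nlinarith [sq_nonneg (n / 2 - ℓ₁ * r), sq_nonneg (n / 2 - 2 * r)]) hα
  have h2 : α ^ 2 * (4 * ℓ₁ * M * r) ≤ α ^ 2 * (2 * (ℓ₁ ^ 2 * r ^ 2) + 2 * M ^ 2) :=
    mul_le_mul_of_nonneg_left (by nlinarith [sq_nonneg (ℓ₁ * r - M)]) (sq_nonneg α)
  have h3 : α ^ 2 * (2 * (ℓ₁ ^ 2 * r ^ 2)) ≤ α * (2 * (ℓ₁ ^ 2 * r ^ 2)) :=
    mul_le_mul_of_nonneg_right (by nlinarith) (by positivity)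
  have h4 : 2 * (e * (1 + κ ^ 2)) * r ≤ 2 * e * κ ^ 2 * (1 + r ^ 2) := by
    have : (1 + κ ^ 2) * (2 * r) ≤ 2 * κ ^ 2 * (1 + r ^ 2) :=
      mul_le_mul (by linarith) (by nlinarith [sq_nonneg (1 - r)]) (by positivity) (by positivity)
    nlinarith [mul_le_mul_of_nonneg_left this he]
  have h5 : ℓ₁ * (1 + κ ^ 2) ≤ 2 * ℓ₁ * κ ^ 2 := by nlinarith
  have h6 : (ℓ₁ * (1 + κ ^ 2) + (2 * (e * (1 + κ ^ 2)) * r + κ)) * (2 * α * M) ^ 2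
      ≤ (2 * ℓ₁ * κ ^ 2 + (2 * e * κ ^ 2 * (1 + r ^ 2) + κ ^ 2)) * (2 * α * M) ^ 2 :=
    mul_le_mul_of_nonneg_right (by linarith) (sq_nonneg _)
  -- The part proportional to r² of the remainder from the maximizer expansion costs α²κ²r².
  -- Reducing it to αr² is why steps must be at most of order κ⁻².
  have h7 : (8 * e * M ^ 2 * r ^ 2 * α) * (α * κ ^ 2) ≤ (8 * e * M ^ 2 * r ^ 2 * α) * 1 :=
    mul_le_mul_of_nonneg_left hακ (by positivity)
  have h8 : α ^ 2 * (2 * M ^ 2 + 2 * ℓ₁ * M ^ 2) * 1 ≤ α ^ 2 * (2 * M ^ 2 + 2 * ℓ₁ * M ^ 2) * κ ^ 2 :=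
    mul_le_mul_of_nonneg_left hκ2 (by positivity)
  nlinarith

end Arithmetic

/-! ### Expected progress of a single inner or outer call from a fixed point. -/

namespace Problem

variable {d₁ d₂ m : ℕ} {Ξ Ω : Type*} [MeasurableSpace Ξ] [MeasurableSpace Ω]
  {P : Problem d₁ d₂ m Ξ} {Pr : Measure Ω} {ℓ₀ ℓ₁ ℓ₂ μ σ : ℝ}

/-- The samples of one call of `FedInn` or `FedOut`: independent, with the laws of their
clients. -/
structure IsBatch (P : Problem d₁ d₂ m Ξ) (Pr : Measure Ω) (s : Fin m → Option ℕ → Ω → Ξ) :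
    Prop where
  meas : ∀ i j, Measurable (s i j)
  indep : iIndepFun (fun p : (_ : Fin m) × Option ℕ => s p.1 p.2) Pr
  law : ∀ i j, Measure.map (s i j) Pr = P.law i

variable [IsProbabilityMeasure Pr] {s : Fin m → Option ℕ → Ω → Ξ} {τ : Fin m → ℕ}

/-- The squared distance is exactly quadratic in the displacement. Its mean points along the
y-gradient, which is strongly monotone and vanishes at the maximizer. -/
theorem IsBatch.lintegral_fedInn_le (hs : P.IsBatch Pr s) (hw : P.WellBehaved ℓ₀ ℓ₁ ℓ₂ μ)
    (hg : P.GoodSamples σ) (hm : 0 < m) (hμ : 0 < μ) (hℓ₁ : 0 ≤ ℓ₁) (hσ : 0 ≤ σ)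
    (hτ : ∀ i, 1 ≤ τ i) {β : ℝ} (hβ : 0 ≤ β) (hβℓ : 2 * β * ℓ₁ ≤ 1) (hβμ : 14 * β * ℓ₁ ^ 2 ≤ μ)
    (x : Vec d₁) (y : Vec d₂) :
    ∫⁻ ω, ENNReal.ofReal
        (‖P.fedInn τ (fun i => β / τ i) x y (fun i j => s i j ω) - P.yStar x‖ ^ 2) ∂Pr
      ≤ ENNReal.ofReal ((1 - β * μ) * ‖y - P.yStar x‖ ^ 2 + 108 * β ^ 2 * σ ^ 2) := by
  have hR := hw.regularSaddle hm
  have hp := hw.isArgmax_yStar hm hμ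
  obtain ⟨hU, hI⟩ := fedStep_moments hm (fun i => hg.isOracle_gradY hw i x) hℓ₁ hσ hτ hβ hβℓ
    hs.meas hs.indep hs.law y
  simp only [hw.average_gradY, norm_neg, ← fedInn_eq_fedStep] at hU hI
  set v := y - P.yStar x with hv
  set U := fun ω => P.fedInn τ (fun i => β / τ i) x y (fun i j => s i j ω) - y with hUdef
  set M := ‖(gradient P.avgObj (pt x y)).snd‖ + 3 * σ with hM
  have hzero := hR.gradient_snd_eq_zero (hp x)
  have hGn : ‖(gradient P.avgObj (pt x y)).snd‖ ≤ ℓ₁ * ‖v‖ := by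
    have := hR.norm_gradient_snd_sub_le x y (P.yStar x)
    rwa [hzero, sub_zero] at this
  have hmono : inner ℝ (gradient P.avgObj (pt x y)).snd v ≤ -μ * ‖v‖ ^ 2 := by
    have := hR.strong_mono x (P.yStar x) y
    rwa [hzero, sub_zero] at this
  have hJ : inner ℝ v (∫ ω, U ω ∂Pr) ≤ -(β * μ * ‖v‖ ^ 2) + ‖v‖ * (2 * β ^ 2 * ℓ₁ * M) := by
    have h1 : ∫ ω, U ω ∂Pr = (∫ ω, U ω ∂Pr + β • -(gradient P.avgObj (pt x y)).snd)
        + β • (gradient P.avgObj (pt x y)).snd := by rw [smul_neg]; abel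
    have h2 := (real_inner_le_norm v _).trans (mul_le_mul_of_nonneg_left hI (norm_nonneg v))
    rw [real_inner_comm] at hmono
    have h3 := mul_le_mul_of_nonneg_left hmono hβ
    calc inner ℝ v (∫ ω, U ω ∂Pr)
        = inner ℝ v (∫ ω, U ω ∂Pr + β • -(gradient P.avgObj (pt x y)).snd)
          + β * inner ℝ v (gradient P.avgObj (pt x y)).snd := by
          rw [← inner_smul_right, ← inner_add_right, ← h1]
      _ ≤ _ := by linarith
  have h := hU.lintegral_le_of_le_quadratic (φ := fun ω => ‖P.fedInn τ (fun i => β / τ i) x y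
    (fun i j => s i j ω) - P.yStar x‖ ^ 2) (fun ω => sq_nonneg _) (A := ‖v‖ ^ 2) (B := 1)
    zero_le_one ((2 : ℝ) • v) fun ω => by
      have h1 : P.fedInn τ (fun i => β / τ i) x y (fun i j => s i j ω) - P.yStar x
          = v + U ω := by simp only [hv, hUdef]; abel
      rw [h1, norm_add_sq_real, inner_smul_left]
      simp
  refine h.2.trans (ENNReal.ofReal_le_ofReal ?_)
  rw [inner_smul_left]
  exact inner_step_arith hβ (by positivity) (by linarith) hβμ hJ

/-- Both f and the weighted squared error are expanded to second order in the displacement: f by the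
envelope bound, the error by the linearized maximizer. -/
theorem IsBatch.lintegral_fedOut_le (hs : P.IsBatch Pr s) (hw : P.WellBehaved ℓ₀ ℓ₁ ℓ₂ μ)
    (hg : P.GoodSamples σ) (hm : 0 < m) (hμ : 0 < μ) (hℓ₀ : 0 ≤ ℓ₀) (hℓ₁ : 0 < ℓ₁)
    (hℓ₂ : 0 ≤ ℓ₂) (hσ : 0 ≤ σ) (hτ : ∀ i, 1 ≤ τ i) {κ : ℝ} (hκ : κ = ℓ₁ / μ) (hκ1 : 1 ≤ κ)
    {α : ℝ} (hα : 0 ≤ α) (hαℓ : 2 * α * ℓ₁ ≤ 1) (hακ : α * κ ^ 2 ≤ 1) {b : ℝ}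
    (hb : ∀ x, b ≤ P.outer x) (x : Vec d₁) (y : Vec d₂) :
    ∫⁻ ω, ENNReal.ofReal
        (P.outer (P.fedOut τ (fun i => α / τ i) x y (fun i j => s i j ω)) - b + 1 / κ *
          ‖y - P.yStar (P.fedOut τ (fun i => α / τ i) x y (fun i j => s i j ω))‖ ^ 2) ∂Pr
        + ENNReal.ofReal (α / 2 * ‖gradient P.outer x‖ ^ 2)
      ≤ ENNReal.ofReal (P.outer x - b
          + (1 / κ + α * errCoef ℓ₀ ℓ₁ ℓ₂ σ) * ‖y - P.yStar x‖ ^ 2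
          + noiseCoef ℓ₀ ℓ₁ ℓ₂ σ * κ ^ 2 * α ^ 2) := by
  have hR := hw.regularSaddle hm
  have hp := hw.isArgmax_yStar hm hμ
  obtain ⟨hU, hI⟩ := fedStep_moments hm (fun i => hg.isOracle_gradX hw i y) hℓ₁.le hσ hτ hα hαℓ
    hs.meas hs.indep hs.law x
  simp only [hw.average_gradX, ← fedOut_eq_fedStep] at hU hI
  set v := y - P.yStar x with hv
  set U := fun ω => P.fedOut τ (fun i => α / τ i) x y (fun i j => s i j ω) - x with hUdef
  set M := ℓ₀ + 3 * σ with hM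
  set GX := (gradient P.avgObj (pt x y)).fst with hGX
  have hGXn : ‖GX‖ ≤ ℓ₀ := hR.norm_gradient_fst_le _ hℓ₀
  have hgrad : gradient P.outer x = (gradient P.avgObj (pt x (P.yStar x))).fst :=
    (hR.hasGradientAt_value hμ hp hℓ₁.le x).gradient
  set F := gradient P.outer x with hF
  have hFn : ‖F‖ ≤ M := by
    rw [hgrad]
    exact (hR.norm_gradient_fst_le _ hℓ₀).trans (by linarith)
  have hdiff : ‖GX - F‖ ≤ ℓ₁ * ‖v‖ := by
    rw [hgrad]; exact hR.norm_gradient_fst_sub_le x y (P.yStar x)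
  have hGM : ‖GX‖ + 3 * σ ≤ M := by linarith
  replace hU := hU.mono (D := 2 * α * M) (by gcongr)
  replace hI : ‖∫ ω, U ω ∂Pr + α • GX‖ ≤ 2 * α ^ 2 * ℓ₁ * M := hI.trans (by gcongr)
  have hκ0 : 0 < κ := by linarith
  obtain ⟨w, hwn, hwe⟩ := hR.exists_argmax_expansion hμ hp hℓ₁.le hℓ₂ x v
  rw [← hκ] at hwn hwe
  set e := ℓ₂ / ℓ₁ with he
  have hμκ : ℓ₂ / μ = κ * e := by rw [hκ, he]; field_simp
  rw [hμκ] at hwe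
  have hIU : ∫ ω, U ω ∂Pr = (∫ ω, U ω ∂Pr + α • GX) - α • F - α • (GX - F) := by
    rw [smul_sub]; abel
  have hI₁ : inner ℝ F (∫ ω, U ω ∂Pr)
      ≤ -(α * ‖F‖ ^ 2) + α * ‖F‖ * ℓ₁ * ‖v‖ + M * (2 * α ^ 2 * ℓ₁ * M) := by
    rw [hIU, inner_sub_right, inner_sub_right, inner_smul_right, inner_smul_right,
      real_inner_self_eq_norm_sq]
    have h1 := (real_inner_le_norm F (∫ ω, U ω ∂Pr + α • GX)).trans
      (mul_le_mul hFn hI (norm_nonneg _) (by positivity))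
    have h2 := (neg_le_of_abs_le (abs_real_inner_le_norm F (GX - F)))
    have h3 := mul_le_mul_of_nonneg_left hdiff (norm_nonneg F)
    have h4 : α * (-(‖F‖ * (ℓ₁ * ‖v‖))) ≤ α * inner ℝ F (GX - F) :=
      mul_le_mul_of_nonneg_left (by linarith) hα
    linarith
  have hIn : ‖∫ ω, U ω ∂Pr‖ ≤ α * (‖F‖ + ℓ₁ * ‖v‖) + 2 * α ^ 2 * ℓ₁ * M := by
    rw [hIU]
    have h1 := norm_sub_le (∫ ω, U ω ∂Pr + α • GX - α • F) (α • (GX - F))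
    have h2 := norm_sub_le (∫ ω, U ω ∂Pr + α • GX) (α • F)
    rw [norm_smul, Real.norm_of_nonneg hα] at h1 h2
    have h3 := mul_le_mul_of_nonneg_left hdiff hα
    linarith
  -- The weight 1/κ cancels the factor κ in ‖w‖ ≤ κ‖v‖, so this cross term carries no condition
  -- number.
  have hI₂ : inner ℝ (-(2 * (1 / κ)) • w) (∫ ω, U ω ∂Pr)
      ≤ 2 * ‖v‖ * (α * (‖F‖ + ℓ₁ * ‖v‖) + 2 * α ^ 2 * ℓ₁ * M) := by
    refine (real_inner_le_norm _ _).trans (mul_le_mul ?_ hIn (norm_nonneg _) (by positivity))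
    rw [norm_smul, norm_neg, Real.norm_of_nonneg (by positivity)]
    calc 2 * (1 / κ) * ‖w‖ ≤ 2 * (1 / κ) * (κ * ‖v‖) := by gcongr
      _ = 2 * ‖v‖ := by field_simp
  have h := hU.lintegral_le_of_le_quadratic (φ := fun ω =>
    P.outer (P.fedOut τ (fun i => α / τ i) x y (fun i j => s i j ω)) - b + 1 / κ *
      ‖y - P.yStar (P.fedOut τ (fun i => α / τ i) x y (fun i j => s i j ω))‖ ^ 2)
    (fun ω => add_nonneg (sub_nonneg.2 (hb _)) (by positivity))
    (A := P.outer x - b + 1 / κ * ‖v‖ ^ 2)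
    (B := ℓ₁ * (1 + κ ^ 2) + (2 * (e * (1 + κ ^ 2)) * ‖v‖ + κ)) (by positivity)
    (F + -(2 * (1 / κ)) • w) fun ω => by
      set x' := P.fedOut τ (fun i => α / τ i) x y (fun i j => s i j ω) with hx'
      have hUx : x' - x = U ω := rfl
      have h1 := le_of_abs_le (hR.abs_value_sub_le hμ hp hℓ₁.le x x')
      rw [← hgrad, hUx, ← hκ] at h1
      have h1' : P.outer x' ≤ P.outer x + inner ℝ F (U ω) + ℓ₁ * (1 + κ ^ 2) * ‖U ω‖ ^ 2 := by
        have e1 : P.avgObj (pt x' (P.yStar x')) = P.outer x' := rfl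
        have e2 : P.avgObj (pt x (P.yStar x)) = P.outer x := rfl
        rw [e1, e2] at h1
        linarith
      have h2 := neg_le_of_abs_le (hwe x')
      rw [hUx] at h2
      have h3 := pow_le_pow_left₀ (norm_nonneg _) (hR.argmax_lipschitz hμ hp x x') 2
      rw [← hκ, hUx] at h3
      have h4 : ‖y - P.yStar x'‖ ^ 2 ≤ ‖v‖ ^ 2 - 2 * inner ℝ w (U ω)
          + (2 * (κ * e * (1 + κ ^ 2)) * ‖v‖ + κ ^ 2) * ‖U ω‖ ^ 2 := by
        have h5 : y - P.yStar x' = v - (P.yStar x' - P.yStar x) := by rw [hv]; abel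
        rw [h5, norm_sub_sq_real]
        nlinarith
      have h6 := mul_le_mul_of_nonneg_left h4 (by positivity : 0 ≤ 1 / κ)
      have h7 : 1 / κ * (‖v‖ ^ 2 - 2 * inner ℝ w (U ω)
          + (2 * (κ * e * (1 + κ ^ 2)) * ‖v‖ + κ ^ 2) * ‖U ω‖ ^ 2)
          = 1 / κ * ‖v‖ ^ 2 - 2 * (1 / κ) * inner ℝ w (U ω)
          + (2 * (e * (1 + κ ^ 2)) * ‖v‖ + κ) * ‖U ω‖ ^ 2 := by field_simp
      rw [inner_add_left, inner_smul_left]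
      simp only [conj_trivial]
      linarith
  obtain ⟨h0, hle⟩ := h
  have hc : 0 ≤ α / 2 * ‖F‖ ^ 2 := by positivity
  calc _ ≤ ENNReal.ofReal _ + ENNReal.ofReal (α / 2 * ‖F‖ ^ 2) := add_le_add_left hle _
    _ = ENNReal.ofReal (_ + α / 2 * ‖F‖ ^ 2) := (ENNReal.ofReal_add h0 hc).symm
    _ ≤ _ := by
      refine ENNReal.ofReal_le_ofReal ?_
      have := outer_step_arith (f := P.outer x - b) (norm_nonneg v) hα hℓ₁.le
        (by positivity : 0 ≤ e) hκ1 hακ hI₁ hI₂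
      rw [inner_add_left]
      simp only [errCoef, noiseCoef]
      linarith

end Problem

end FedNest

namespace FedNest

/-! ### The Lyapunov inequality along the random run. -/

namespace Problem

variable {d₁ d₂ m : ℕ} {Ξ Ω : Type*} [MeasurableSpace Ξ] [MeasurableSpace Ω]
  {P : Problem d₁ d₂ m Ξ} {Pr : Measure Ω} {ℓ₀ ℓ₁ ℓ₂ μ σ : ℝ} {τ : Fin m → ℕ}

theorem GoodSamples.measurable_fedInn (h : P.GoodSamples σ) {Ω : Type*} {mΩ : MeasurableSpace Ω}
    (τ : Fin m → ℕ) (β : Fin m → ℝ) {x : Ω → Vec d₁} {y : Ω → Vec d₂}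
    {s : Ω → Fin m → Option ℕ → Ξ} (hx : Measurable x) (hy : Measurable y)
    (hs : ∀ i j, Measurable fun ω => s ω i j) :
    Measurable fun ω => P.fedInn τ β (x ω) (y ω) (s ω) := by
  simp only [fedInn_eq_fedStep]
  exact measurable_fedStep (g := fun i x y s => -P.gradY i x y s)
    (fun i => (h.measurable_gradY i).neg) τ β hx hy hs

theorem GoodSamples.measurable_fedOut (h : P.GoodSamples σ) {Ω : Type*} {mΩ : MeasurableSpace Ω}
    (τ : Fin m → ℕ) (α : Fin m → ℝ) {x : Ω → Vec d₁} {y : Ω → Vec d₂}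
    {s : Ω → Fin m → Option ℕ → Ξ} (hx : Measurable x) (hy : Measurable y)
    (hs : ∀ i j, Measurable fun ω => s ω i j) :
    Measurable fun ω => P.fedOut τ α (x ω) (y ω) (s ω) := by
  simp only [fedOut_eq_fedStep]
  exact measurable_fedStep (g := fun i y x s => P.gradX i x y s)
    (fun i => (h.measurable_gradX i).comp ((measurable_fst.comp measurable_snd).prodMk
      (measurable_fst.prodMk (measurable_snd.comp measurable_snd)))) τ α hy hx hs

theorem GoodSamples.measurable_innerIter (h : P.GoodSamples σ) {Ω : Type*}
    {mΩ : MeasurableSpace Ω} (τ : Fin m → ℕ) (β : Fin m → ℝ) {x : Ω → Vec d₁} {y : Ω → Vec d₂}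
    {s : Ω → ℕ → Fin m → Option ℕ → Ξ} (hx : Measurable x) (hy : Measurable y) (t : ℕ)
    (hs : ∀ t' < t, ∀ i j, Measurable fun ω => s ω t' i j) :
    Measurable fun ω => P.innerIter τ β (x ω) (y ω) (s ω) t := by
  induction t with
  | zero => exact hy
  | succ t ih =>
    exact h.measurable_fedInn τ β hx (ih fun t' ht' => hs t' (ht'.trans t.lt_succ_self))
      (hs t t.lt_succ_self)

theorem GoodSamples.measurable_fedNest (h : P.GoodSamples σ) {Ω : Type*}
    {mΩ : MeasurableSpace Ω} (τ : Fin m → ℕ) (T : ℕ) (α β : ℕ → Fin m → ℝ) (x₀ : Vec d₁)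
    (y₀ : Vec d₂) {ξ : SampleIdx m → Ω → Ξ} (k : ℕ) (hξ : ∀ j, j.1 < k → Measurable (ξ j)) :
    Measurable fun ω => P.fedNest τ T α β x₀ y₀ (fun j => ξ j ω) k := by
  induction k with
  | zero => exact measurable_const
  | succ k ih =>
    have h1 := ih fun j hj => hξ j (hj.trans k.lt_succ_self)
    have h2 := h.measurable_innerIter τ (β k) h1.fst h1.snd
      (s := fun ω t i j => ξ (k, some t, ⟨i, j⟩) ω) T fun t _ i j => hξ _ k.lt_succ_self
    have h3 := h.measurable_fedOut τ (α k) h1.fst h2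
      (s := fun ω i j => ξ (k, none, ⟨i, j⟩) ω) fun i j => hξ _ k.lt_succ_self
    exact h3.prodMk h2

theorem WellBehaved.continuous_yStar (hw : P.WellBehaved ℓ₀ ℓ₁ ℓ₂ μ) (hm : 0 < m) (hμ : 0 < μ)
    (hℓ₁ : 0 ≤ ℓ₁) : Continuous P.yStar :=
  (hw.regularSaddle hm).argmax_continuous hμ (hw.isArgmax_yStar hm hμ) hℓ₁

theorem WellBehaved.hasGradientAt_outer (hw : P.WellBehaved ℓ₀ ℓ₁ ℓ₂ μ) (hm : 0 < m)
    (hμ : 0 < μ) (hℓ₁ : 0 ≤ ℓ₁) (x : Vec d₁) :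
    HasGradientAt P.outer (gradient P.avgObj (pt x (P.yStar x))).fst x :=
  (hw.regularSaddle hm).hasGradientAt_value hμ (hw.isArgmax_yStar hm hμ) hℓ₁ x

theorem WellBehaved.differentiable_outer (hw : P.WellBehaved ℓ₀ ℓ₁ ℓ₂ μ) (hm : 0 < m)
    (hμ : 0 < μ) (hℓ₁ : 0 ≤ ℓ₁) : Differentiable ℝ P.outer := fun x =>
  (hw.hasGradientAt_outer hm hμ hℓ₁ x).hasFDerivAt.differentiableAt

theorem WellBehaved.continuous_gradient_outer (hw : P.WellBehaved ℓ₀ ℓ₁ ℓ₂ μ) (hm : 0 < m)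
    (hμ : 0 < μ) (hℓ₁ : 0 ≤ ℓ₁) : Continuous (gradient P.outer) := by
  have h1 : gradient P.outer = fun x => (gradient P.avgObj (pt x (P.yStar x))).fst :=
    funext fun x => (hw.hasGradientAt_outer hm hμ hℓ₁ x).gradient
  rw [h1]
  have h2 : Continuous fun x => pt x (P.yStar x) :=
    continuous_pt.comp (continuous_id.prodMk (hw.continuous_yStar hm hμ hℓ₁))
  exact (WithLp.fstL 2 ℝ (Vec d₁) (Vec d₂)).continuous.comp
    ((hw.regularSaddle hm).continuous_gradient.comp h2)

theorem WellBehaved.norm_gradient_outer_le (hw : P.WellBehaved ℓ₀ ℓ₁ ℓ₂ μ) (hm : 0 < m)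
    (hμ : 0 < μ) (hℓ₀ : 0 ≤ ℓ₀) (hℓ₁ : 0 ≤ ℓ₁) (x : Vec d₁) : ‖gradient P.outer x‖ ≤ ℓ₀ := by
  rw [(hw.hasGradientAt_outer hm hμ hℓ₁ x).gradient]
  exact (hw.regularSaddle hm).norm_gradient_fst_le _ hℓ₀

variable {ξ : SampleIdx m → Ω → Ξ}

theorem _root_.FedNest.IsSampling.isBatch (hξ : IsSampling P Pr ξ) (k : ℕ) (st : Option ℕ) :
    P.IsBatch Pr fun i j => ξ (k, st, ⟨i, j⟩) where
  meas i j := hξ.meas _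
  indep := hξ.indep.precomp (g := fun p : (_ : Fin m) × Option ℕ => ((k, st, p) : SampleIdx m))
    fun p q h => by simpa using h
  law i j := hξ.law _

/-- The iterates of FedNest with constant step sizes `α / τ i` and `β / τ i`, as random
variables. -/
noncomputable def iterate (P : Problem d₁ d₂ m Ξ) (τ : Fin m → ℕ) (T : ℕ) (α β : ℝ) (x₀ : Vec d₁)
    (y₀ : Vec d₂) (ξ : SampleIdx m → Ω → Ξ) (k : ℕ) (ω : Ω) : Vec d₁ × Vec d₂ :=
  P.fedNest τ T (fun _ i => α / τ i) (fun _ i => β / τ i) x₀ y₀ (fun j => ξ j ω) k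

/-- The inner iterates `y^{k,t}` of FedNest with constant step sizes, as random variables. -/
noncomputable def innerIterate (P : Problem d₁ d₂ m Ξ) (τ : Fin m → ℕ) (T : ℕ) (α β : ℝ)
    (x₀ : Vec d₁) (y₀ : Vec d₂) (ξ : SampleIdx m → Ω → Ξ) (k t : ℕ) (ω : Ω) : Vec d₂ :=
  P.innerIter τ (fun i => β / τ i) (P.iterate τ T α β x₀ y₀ ξ k ω).1
    (P.iterate τ T α β x₀ y₀ ξ k ω).2 (fun t i j => ξ (k, some t, ⟨i, j⟩) ω) t

/-- Labels of the samples drawn before the `t`-th inner call of round `k`. -/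
def pastLabels (m k t : ℕ) : Set (SampleIdx m) :=
  {j | j.1 < k ∨ (j.1 = k ∧ ∃ t' < t, j.2.1 = some t')}

variable {T : ℕ} {α β : ℝ} {x₀ : Vec d₁} {y₀ : Vec d₂}

/-- The current state is a function of earlier samples only, which makes it independent of the next
batch. -/
theorem GoodSamples.measurable_iterate_past {Ω : Type*} {ξ : SampleIdx m → Ω → Ξ}
    (h : P.GoodSamples σ) (k t : ℕ) :
    Measurable[⨆ j ∈ pastLabels m k t, MeasurableSpace.comap (ξ j) inferInstance]
      fun ω => ((P.iterate τ T α β x₀ y₀ ξ k ω).1, P.innerIterate τ T α β x₀ y₀ ξ k t ω) := by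
  have h1 : Measurable[⨆ j ∈ pastLabels m k t, MeasurableSpace.comap (ξ j) inferInstance]
      (P.iterate τ T α β x₀ y₀ ξ k) :=
    h.measurable_fedNest τ T _ _ x₀ y₀ k fun j hj =>
      measurable_iSup_comap ξ (S := pastLabels m k t) (Or.inl hj)
  have h2 : Measurable[⨆ j ∈ pastLabels m k t, MeasurableSpace.comap (ξ j) inferInstance]
      (P.innerIterate τ T α β x₀ y₀ ξ k t) :=
    h.measurable_innerIter τ _ h1.fst h1.snd t fun t' ht' i j =>
      measurable_iSup_comap ξ (S := pastLabels m k t) (Or.inr ⟨rfl, t', ht', rfl⟩)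
  exact h1.fst.prodMk h2

theorem _root_.FedNest.IsSampling.measurable_iterate (hξ : IsSampling P Pr ξ)
    (h : P.GoodSamples σ) (k : ℕ) : Measurable (P.iterate τ T α β x₀ y₀ ξ k) :=
  h.measurable_fedNest τ T _ _ x₀ y₀ k fun j _ => hξ.meas j

theorem _root_.FedNest.IsSampling.measurable_innerIterate (hξ : IsSampling P Pr ξ)
    (h : P.GoodSamples σ) (k t : ℕ) : Measurable (P.innerIterate τ T α β x₀ y₀ ξ k t) :=
  h.measurable_innerIter τ _ (hξ.measurable_iterate h k).fst (hξ.measurable_iterate h k).snd t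
    fun _ _ _ _ => hξ.meas _

variable [IsProbabilityMeasure Pr]

/-- Freezes the past while averaging over one batch, so that the estimates for fixed (x, y) apply
pointwise in ω. -/
theorem _root_.FedNest.IsSampling.lintegral_batch (hξ : IsSampling P Pr ξ) (k : ℕ)
    (st : Option ℕ) {S : Set (SampleIdx m)} (hS : ∀ j ∈ S, ¬(j.1 = k ∧ j.2.1 = st))
    {A : Type*} [MeasurableSpace A] {X : Ω → A}
    (hX : Measurable[⨆ j ∈ S, MeasurableSpace.comap (ξ j) inferInstance] X)
    {Φ : A × (Fin m → Option ℕ → Ξ) → ENNReal} (hΦ : Measurable Φ) :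
    ∫⁻ ω, Φ (X ω, fun i j => ξ (k, st, ⟨i, j⟩) ω) ∂Pr
      = ∫⁻ ω, ∫⁻ ω', Φ (X ω, fun i j => ξ (k, st, ⟨i, j⟩) ω') ∂Pr ∂Pr := by
  set B : Set (SampleIdx m) := {j | j.1 = k ∧ j.2.1 = st} with hB
  have hY : Measurable[⨆ j ∈ B, MeasurableSpace.comap (ξ j) inferInstance]
      fun ω i j => ξ (k, st, (⟨i, j⟩ : (_ : Fin m) × Option ℕ)) ω :=
    @measurable_pi_lambda _ _ _ (⨆ j ∈ B, MeasurableSpace.comap (ξ j) inferInstance) _ _ fun i =>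
      @measurable_pi_lambda _ _ _ (⨆ j ∈ B, MeasurableSpace.comap (ξ j) inferInstance) _ _ fun j =>
        measurable_iSup_comap ξ (S := B) (i := (k, st, ⟨i, j⟩)) ⟨rfl, rfl⟩
  have hle : ∀ S : Set (SampleIdx m), ⨆ j ∈ S, MeasurableSpace.comap (ξ j) inferInstance
      ≤ (inferInstance : MeasurableSpace Ω) := fun S => iSup₂_le fun j _ => (hξ.meas j).comap_le
  exact lintegral_comp_of_indepFun (hX.mono (hle S) le_rfl) (hY.mono (hle B) le_rfl)
    (indepFun_of_measurable_iSup hξ.meas hξ.indep (Set.disjoint_left.2 hS) hX hY) hΦ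

/-- Expected squared inner error `E ‖y^{k,t} - y*(x^k)‖²`. -/
noncomputable def innerErr (P : Problem d₁ d₂ m Ξ) (Pr : Measure Ω) (τ : Fin m → ℕ) (T : ℕ)
    (α β : ℝ) (x₀ : Vec d₁) (y₀ : Vec d₂) (ξ : SampleIdx m → Ω → Ξ) (k t : ℕ) : ENNReal :=
  ∫⁻ ω, ENNReal.ofReal (‖P.innerIterate τ T α β x₀ y₀ ξ k t ω
    - P.yStar (P.iterate τ T α β x₀ y₀ ξ k ω).1‖ ^ 2) ∂Pr

theorem innerErr_succ_le (hξ : IsSampling P Pr ξ) (hw : P.WellBehaved ℓ₀ ℓ₁ ℓ₂ μ)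
    (hg : P.GoodSamples σ) (hm : 0 < m) (hμ : 0 < μ) (hℓ₁ : 0 ≤ ℓ₁) (hσ : 0 ≤ σ)
    (hτ : ∀ i, 1 ≤ τ i) (hβ : 0 ≤ β) (hβℓ : 2 * β * ℓ₁ ≤ 1) (hβμ : 14 * β * ℓ₁ ^ 2 ≤ μ)
    (hβμ1 : β * μ ≤ 1) (k t : ℕ) :
    P.innerErr Pr τ T α β x₀ y₀ ξ k (t + 1)
      ≤ ENNReal.ofReal (1 - β * μ) * P.innerErr Pr τ T α β x₀ y₀ ξ k t
        + ENNReal.ofReal (108 * β ^ 2 * σ ^ 2) := by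
  have hyS := (hw.continuous_yStar hm hμ hℓ₁).measurable
  set Φ : (Vec d₁ × Vec d₂) × (Fin m → Option ℕ → Ξ) → ENNReal := fun p =>
    ENNReal.ofReal (‖P.fedInn τ (fun i => β / τ i) p.1.1 p.1.2 p.2 - P.yStar p.1.1‖ ^ 2) with hΦ
  have hΦm : Measurable Φ := by
    have h1 : Measurable fun p : (Vec d₁ × Vec d₂) × (Fin m → Option ℕ → Ξ) =>
        P.fedInn τ (fun i => β / τ i) p.1.1 p.1.2 p.2 :=
      hg.measurable_fedInn τ _ measurable_fst.fst measurable_fst.snd fun i j =>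
        (measurable_pi_apply j).comp ((measurable_pi_apply i).comp measurable_snd)
    exact ((h1.sub (hyS.comp measurable_fst.fst)).norm.pow_const 2).ennreal_ofReal
  have h1 : P.innerErr Pr τ T α β x₀ y₀ ξ k (t + 1)
      = ∫⁻ ω, Φ (((P.iterate τ T α β x₀ y₀ ξ k ω).1, P.innerIterate τ T α β x₀ y₀ ξ k t ω),
          fun i j => ξ (k, some t, ⟨i, j⟩) ω) ∂Pr := rfl
  rw [h1, hξ.lintegral_batch k (some t) (S := pastLabels m k t) ?_
    (hg.measurable_iterate_past k t) hΦm]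
  · have hms : Measurable fun ω => ENNReal.ofReal (‖P.innerIterate τ T α β x₀ y₀ ξ k t ω
        - P.yStar (P.iterate τ T α β x₀ y₀ ξ k ω).1‖ ^ 2) :=
      (((hξ.measurable_innerIterate hg k t).sub
        (hyS.comp (hξ.measurable_iterate hg k).fst)).norm.pow_const 2).ennreal_ofReal
    calc _ ≤ ∫⁻ ω, (ENNReal.ofReal (1 - β * μ) * ENNReal.ofReal
              (‖P.innerIterate τ T α β x₀ y₀ ξ k t ω
                - P.yStar (P.iterate τ T α β x₀ y₀ ξ k ω).1‖ ^ 2)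
              + ENNReal.ofReal (108 * β ^ 2 * σ ^ 2)) ∂Pr := by
          refine lintegral_mono fun ω => ?_
          refine ((hξ.isBatch k (some t)).lintegral_fedInn_le hw hg hm hμ hℓ₁ hσ hτ hβ hβℓ hβμ
            _ _).trans (le_of_eq ?_)
          rw [ENNReal.ofReal_add (mul_nonneg (by linarith) (sq_nonneg _)) (by positivity),
            ENNReal.ofReal_mul (by linarith)]
          rfl
      _ = _ := by
          rw [lintegral_add_right _ measurable_const, lintegral_const_mul _ hms, lintegral_const,
            measure_univ, mul_one]
          rfl
  · rintro j (hj | ⟨hj, t', ht', hjt⟩) ⟨hk, hst⟩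
    · omega
    · rw [hjt, Option.some.injEq] at hst
      omega

/-- While th ≤ 1 with h = βμ, one has (1 − h)(1 − th/2) ≤ 1 − (t + 1)h/2. The linear form of the
contraction is easy to match with the outer coefficient. -/
theorem innerErr_le (hξ : IsSampling P Pr ξ) (hw : P.WellBehaved ℓ₀ ℓ₁ ℓ₂ μ)
    (hg : P.GoodSamples σ) (hm : 0 < m) (hμ : 0 < μ) (hℓ₁ : 0 ≤ ℓ₁) (hσ : 0 ≤ σ)
    (hτ : ∀ i, 1 ≤ τ i) (hβ : 0 ≤ β) (hβℓ : 2 * β * ℓ₁ ≤ 1) (hβμ : 14 * β * ℓ₁ ^ 2 ≤ μ)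
    (k : ℕ) {t : ℕ} (ht : t * (β * μ) ≤ 1) :
    P.innerErr Pr τ T α β x₀ y₀ ξ k t
      ≤ ENNReal.ofReal (1 - t * (β * μ) / 2) * P.innerErr Pr τ T α β x₀ y₀ ξ k 0
        + ENNReal.ofReal (t * (108 * β ^ 2 * σ ^ 2)) := by
  have h0 : 0 ≤ β * μ := by positivity
  induction t with
  | zero => simp
  | succ t ih =>
    push_cast at ht ⊢
    have ht0 : 0 ≤ (t : ℝ) * (β * μ) := by positivity
    have ht1 : (t : ℝ) * (β * μ) ≤ 1 := by linarith
    have h1 : β * μ ≤ 1 := by linarith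
    refine (innerErr_succ_le hξ hw hg hm hμ hℓ₁ hσ hτ hβ hβℓ hβμ h1 k t).trans ?_
    calc _ ≤ ENNReal.ofReal (1 - β * μ) * (ENNReal.ofReal (1 - t * (β * μ) / 2)
              * P.innerErr Pr τ T α β x₀ y₀ ξ k 0 + ENNReal.ofReal (t * (108 * β ^ 2 * σ ^ 2)))
            + ENNReal.ofReal (108 * β ^ 2 * σ ^ 2) := by gcongr; exact ih ht1
      _ = ENNReal.ofReal ((1 - β * μ) * (1 - t * (β * μ) / 2))
              * P.innerErr Pr τ T α β x₀ y₀ ξ k 0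
            + ENNReal.ofReal ((1 - β * μ) * (t * (108 * β ^ 2 * σ ^ 2))
              + 108 * β ^ 2 * σ ^ 2) := by
          rw [mul_add, ← mul_assoc, ← ENNReal.ofReal_mul (by linarith),
            ← ENNReal.ofReal_mul (by linarith), add_assoc, ← ENNReal.ofReal_add
              (mul_nonneg (by linarith) (by positivity)) (by positivity)]
      _ ≤ _ := by
          have h2 : 0 ≤ (t : ℝ) * (108 * β ^ 2 * σ ^ 2) := by positivity
          gcongr ENNReal.ofReal ?_ * _ + ENNReal.ofReal ?_
          · nlinarith
          · nlinarith

/-- Expected value of the Lyapunov function `f(x^k) - b + κ⁻¹ ‖y^k - y*(x^k)‖²`. -/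
noncomputable def lyapunov (P : Problem d₁ d₂ m Ξ) (Pr : Measure Ω) (τ : Fin m → ℕ) (T : ℕ)
    (α β : ℝ) (x₀ : Vec d₁) (y₀ : Vec d₂) (ξ : SampleIdx m → Ω → Ξ) (b κ : ℝ) (k : ℕ) : ENNReal :=
  ∫⁻ ω, ENNReal.ofReal (P.outer (P.iterate τ T α β x₀ y₀ ξ k ω).1 - b
    + 1 / κ * ‖(P.iterate τ T α β x₀ y₀ ξ k ω).2
      - P.yStar (P.iterate τ T α β x₀ y₀ ξ k ω).1‖ ^ 2) ∂Pr

/-- The outer call raises the weight of the inner error from 1/κ to 1/κ + αe, with e = `errCoef`. By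
`hcon` the preceding T inner calls contract that error enough to restore 1/κ. -/
theorem lyapunov_succ_add_le (hξ : IsSampling P Pr ξ) (hw : P.WellBehaved ℓ₀ ℓ₁ ℓ₂ μ)
    (hg : P.GoodSamples σ) (hm : 0 < m) (hμ : 0 < μ) (hℓ₀ : 0 ≤ ℓ₀) (hℓ₁ : 0 < ℓ₁)
    (hℓ₂ : 0 ≤ ℓ₂) (hσ : 0 ≤ σ) (hτ : ∀ i, 1 ≤ τ i) {κ : ℝ} (hκ : κ = ℓ₁ / μ) (hκ1 : 1 ≤ κ)
    (hα : 0 ≤ α) (hαℓ : 2 * α * ℓ₁ ≤ 1) (hακ : α * κ ^ 2 ≤ 1)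
    (hβ : 0 ≤ β) (hβℓ : 2 * β * ℓ₁ ≤ 1) (hβμ : 14 * β * ℓ₁ ^ 2 ≤ μ) (hT : T * (β * μ) ≤ 1)
    (hcon : (1 / κ + α * errCoef ℓ₀ ℓ₁ ℓ₂ σ) * (1 - T * (β * μ) / 2) ≤ 1 / κ)
    {N : ℝ} (hN : (1 / κ + α * errCoef ℓ₀ ℓ₁ ℓ₂ σ) * (T * (108 * β ^ 2 * σ ^ 2))
      + noiseCoef ℓ₀ ℓ₁ ℓ₂ σ * κ ^ 2 * α ^ 2 ≤ N)
    {b : ℝ} (hb : ∀ x, b ≤ P.outer x) (k : ℕ) :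
    P.lyapunov Pr τ T α β x₀ y₀ ξ b κ (k + 1) + ENNReal.ofReal (α / 2) *
        ∫⁻ ω, ENNReal.ofReal (‖gradient P.outer (P.iterate τ T α β x₀ y₀ ξ k ω).1‖ ^ 2) ∂Pr
      ≤ P.lyapunov Pr τ T α β x₀ y₀ ξ b κ k + ENNReal.ofReal N := by
  have hκ0 : 0 < κ := by linarith
  have hyS := (hw.continuous_yStar hm hμ hℓ₁.le).measurable
  have hf := (hw.differentiable_outer hm hμ hℓ₁.le).continuous.measurable
  have hgr := (hw.continuous_gradient_outer hm hμ hℓ₁.le).measurable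
  have hit := hξ.measurable_iterate (τ := τ) (T := T) (α := α) (β := β) (x₀ := x₀) (y₀ := y₀) hg k
  have he : 0 ≤ errCoef ℓ₀ ℓ₁ ℓ₂ σ := by rw [errCoef]; positivity
  have hn : 0 ≤ noiseCoef ℓ₀ ℓ₁ ℓ₂ σ := by rw [noiseCoef]; positivity
  set c := 1 / κ + α * errCoef ℓ₀ ℓ₁ ℓ₂ σ with hc
  have hc0 : 0 ≤ c := by positivity
  set n := noiseCoef ℓ₀ ℓ₁ ℓ₂ σ * κ ^ 2 * α ^ 2 with hndef
  have hn0 : 0 ≤ n := by positivity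
  set Φ : (Vec d₁ × Vec d₂) × (Fin m → Option ℕ → Ξ) → ENNReal := fun p =>
    ENNReal.ofReal (P.outer (P.fedOut τ (fun i => α / τ i) p.1.1 p.1.2 p.2) - b + 1 / κ *
      ‖p.1.2 - P.yStar (P.fedOut τ (fun i => α / τ i) p.1.1 p.1.2 p.2)‖ ^ 2) with hΦ
  have hΦm : Measurable Φ := by
    have h1 : Measurable fun p : (Vec d₁ × Vec d₂) × (Fin m → Option ℕ → Ξ) =>
        P.fedOut τ (fun i => α / τ i) p.1.1 p.1.2 p.2 :=
      hg.measurable_fedOut τ _ measurable_fst.fst measurable_fst.snd fun i j =>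
        (measurable_pi_apply j).comp ((measurable_pi_apply i).comp measurable_snd)
    exact (((hf.comp h1).sub_const b).add (((measurable_fst.snd.sub
      (hyS.comp h1)).norm.pow_const 2).const_mul (1 / κ))).ennreal_ofReal
  have h1 : P.lyapunov Pr τ T α β x₀ y₀ ξ b κ (k + 1)
      = ∫⁻ ω, Φ (((P.iterate τ T α β x₀ y₀ ξ k ω).1, P.innerIterate τ T α β x₀ y₀ ξ k T ω),
          fun i j => ξ (k, none, ⟨i, j⟩) ω) ∂Pr := rfl
  have hfm : Measurable fun ω =>
      ENNReal.ofReal (P.outer (P.iterate τ T α β x₀ y₀ ξ k ω).1 - b) :=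
    ((hf.comp hit.fst).sub_const b).ennreal_ofReal
  have hem : ∀ t, Measurable fun ω => ENNReal.ofReal (‖P.innerIterate τ T α β x₀ y₀ ξ k t ω
        - P.yStar (P.iterate τ T α β x₀ y₀ ξ k ω).1‖ ^ 2) := fun t =>
    (((hξ.measurable_innerIterate hg k t).sub
      (hyS.comp hit.fst)).norm.pow_const 2).ennreal_ofReal
  have hgm : Measurable fun ω =>
      ENNReal.ofReal (‖gradient P.outer (P.iterate τ T α β x₀ y₀ ξ k ω).1‖ ^ 2) :=
    ((hgr.comp hit.fst).norm.pow_const 2).ennreal_ofReal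
  rw [h1, hξ.lintegral_batch k none (S := pastLabels m k T) ?_
    (hg.measurable_iterate_past k T) hΦm]
  · calc _ = ∫⁻ ω, (∫⁻ ω', Φ (((P.iterate τ T α β x₀ y₀ ξ k ω).1,
              P.innerIterate τ T α β x₀ y₀ ξ k T ω), fun i j => ξ (k, none, ⟨i, j⟩) ω') ∂Pr
            + ENNReal.ofReal (α / 2) * ENNReal.ofReal
              (‖gradient P.outer (P.iterate τ T α β x₀ y₀ ξ k ω).1‖ ^ 2)) ∂Pr := by
          rw [lintegral_add_right _ (hgm.const_mul _), lintegral_const_mul _ hgm]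
      _ ≤ ∫⁻ ω, (ENNReal.ofReal (P.outer (P.iterate τ T α β x₀ y₀ ξ k ω).1 - b)
            + ENNReal.ofReal c * ENNReal.ofReal (‖P.innerIterate τ T α β x₀ y₀ ξ k T ω
              - P.yStar (P.iterate τ T α β x₀ y₀ ξ k ω).1‖ ^ 2) + ENNReal.ofReal n) ∂Pr := by
          refine lintegral_mono fun ω => ?_
          have h2 := (hξ.isBatch k none).lintegral_fedOut_le hw hg hm hμ hℓ₀ hℓ₁ hℓ₂ hσ hτ hκ hκ1
            hα hαℓ hακ hb (P.iterate τ T α β x₀ y₀ ξ k ω).1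
            (P.innerIterate τ T α β x₀ y₀ ξ k T ω)
          rw [ENNReal.ofReal_add (add_nonneg (sub_nonneg.2 (hb _))
              (mul_nonneg hc0 (sq_nonneg _))) hn0,
            ENNReal.ofReal_add (sub_nonneg.2 (hb _)) (mul_nonneg hc0 (sq_nonneg _)),
            ENNReal.ofReal_mul hc0, ENNReal.ofReal_mul (by positivity)] at h2
          exact h2
      _ = ∫⁻ ω, ENNReal.ofReal (P.outer (P.iterate τ T α β x₀ y₀ ξ k ω).1 - b) ∂Pr
            + ENNReal.ofReal c * P.innerErr Pr τ T α β x₀ y₀ ξ k T + ENNReal.ofReal n := by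
          rw [lintegral_add_right _ measurable_const,
            lintegral_add_right _ ((hem T).const_mul _), lintegral_const_mul _ (hem T),
            lintegral_const, measure_univ, mul_one]
          rfl
      _ ≤ ∫⁻ ω, ENNReal.ofReal (P.outer (P.iterate τ T α β x₀ y₀ ξ k ω).1 - b) ∂Pr
            + ENNReal.ofReal c * (ENNReal.ofReal (1 - T * (β * μ) / 2)
                * P.innerErr Pr τ T α β x₀ y₀ ξ k 0
              + ENNReal.ofReal (T * (108 * β ^ 2 * σ ^ 2))) + ENNReal.ofReal n := by
          gcongr
          exact innerErr_le hξ hw hg hm hμ hℓ₁.le hσ hτ hβ hβℓ hβμ k hT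
      _ = ∫⁻ ω, ENNReal.ofReal (P.outer (P.iterate τ T α β x₀ y₀ ξ k ω).1 - b) ∂Pr
            + ENNReal.ofReal (c * (1 - T * (β * μ) / 2)) * P.innerErr Pr τ T α β x₀ y₀ ξ k 0
            + ENNReal.ofReal (c * (T * (108 * β ^ 2 * σ ^ 2)) + n) := by
          rw [mul_add, ← mul_assoc, ← ENNReal.ofReal_mul hc0, ← ENNReal.ofReal_mul hc0,
            ENNReal.ofReal_add (by positivity) hn0]
          ring
      _ ≤ ∫⁻ ω, ENNReal.ofReal (P.outer (P.iterate τ T α β x₀ y₀ ξ k ω).1 - b) ∂Pr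
            + ENNReal.ofReal (1 / κ) * P.innerErr Pr τ T α β x₀ y₀ ξ k 0
            + ENNReal.ofReal N := by gcongr
      _ = _ := by
          rw [innerErr, ← lintegral_const_mul _ (hem 0), ← lintegral_add_left hfm]
          congr 1
          refine lintegral_congr fun ω => ?_
          rw [ENNReal.ofReal_add (sub_nonneg.2 (hb _)) (by positivity),
            ENNReal.ofReal_mul (by positivity)]
          rfl
  · rintro j (hj | ⟨hj, t', ht', hjt⟩) ⟨hk, hst⟩
    · omega
    · rw [hjt] at hst
      exact Option.some_ne_none _ hst

end Problem

end FedNest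

namespace FedNest

/-! ### Telescoping over the rounds. -/

namespace Problem

variable {d₁ d₂ m : ℕ} {Ξ Ω : Type*} [MeasurableSpace Ξ] [MeasurableSpace Ω]
  {P : Problem d₁ d₂ m Ξ} {Pr : Measure Ω} [IsProbabilityMeasure Pr] {ℓ₀ ℓ₁ ℓ₂ μ σ : ℝ}
  {τ : Fin m → ℕ} {ξ : SampleIdx m → Ω → Ξ} {T : ℕ} {x₀ : Vec d₁} {y₀ : Vec d₂}

theorem integrable_gradSq (hξ : IsSampling P Pr ξ) (hw : P.WellBehaved ℓ₀ ℓ₁ ℓ₂ μ)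
    (hg : P.GoodSamples σ) (hm : 0 < m) (hμ : 0 < μ) (hℓ₀ : 0 ≤ ℓ₀) (hℓ₁ : 0 ≤ ℓ₁)
    (K : ℕ) (S : StepParams) (k : ℕ) : Integrable (P.gradSq τ T K S x₀ y₀ ξ k) Pr := by
  have h1 : Measurable (P.gradSq τ T K S x₀ y₀ ξ k) :=
    ((hw.continuous_gradient_outer hm hμ hℓ₁).measurable.comp
      (hξ.measurable_iterate (τ := τ) (T := T) (α := S.alpha K) (β := S.beta T K) (x₀ := x₀)
        (y₀ := y₀) hg k).fst).norm.pow_const 2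
  refine Integrable.of_bound h1.aestronglyMeasurable (ℓ₀ ^ 2) (Filter.Eventually.of_forall ?_)
  intro ω
  rw [gradSq, Real.norm_of_nonneg (sq_nonneg _)]
  exact pow_le_pow_left₀ (norm_nonneg _) (hw.norm_gradient_outer_le hm hμ hℓ₀ hℓ₁ _) 2

/-- The sum telescopes in `ENNReal` and the final Lyapunov value is dropped. The return to real
numbers is safe because the starting value is deterministic and each squared gradient is integrable.
-/
theorem sum_integral_gradSq_le (hξ : IsSampling P Pr ξ) (hw : P.WellBehaved ℓ₀ ℓ₁ ℓ₂ μ)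
    (hg : P.GoodSamples σ) (hm : 0 < m) (hμ : 0 < μ) (hℓ₀ : 0 ≤ ℓ₀) (hℓ₁ : 0 ≤ ℓ₁)
    {K : ℕ} {S : StepParams} {b κ N : ℝ} (hb : ∀ x, b ≤ P.outer x) (hκ : 0 < κ) (hN : 0 ≤ N)
    (hα : 0 ≤ S.alpha K)
    (h : ∀ k, P.lyapunov Pr τ T (S.alpha K) (S.beta T K) x₀ y₀ ξ b κ (k + 1)
        + ENNReal.ofReal (S.alpha K / 2) * ∫⁻ ω, ENNReal.ofReal (‖gradient P.outer
          (P.iterate τ T (S.alpha K) (S.beta T K) x₀ y₀ ξ k ω).1‖ ^ 2) ∂Pr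
      ≤ P.lyapunov Pr τ T (S.alpha K) (S.beta T K) x₀ y₀ ξ b κ k + ENNReal.ofReal N) (n : ℕ) :
    S.alpha K / 2 * ∑ k ∈ Finset.range n, ∫ ω, P.gradSq τ T K S x₀ y₀ ξ k ω ∂Pr
      ≤ P.outer x₀ - b + 1 / κ * ‖y₀ - P.yStar x₀‖ ^ 2 + n * N := by
  have h0 : ∀ k ω, 0 ≤ P.gradSq τ T K S x₀ y₀ ξ k ω := fun k ω => sq_nonneg _
  have hG : ∀ k, ∫⁻ ω, ENNReal.ofReal (‖gradient P.outer
      (P.iterate τ T (S.alpha K) (S.beta T K) x₀ y₀ ξ k ω).1‖ ^ 2) ∂Pr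
      = ENNReal.ofReal (∫ ω, P.gradSq τ T K S x₀ y₀ ξ k ω ∂Pr) := fun k =>
    (ofReal_integral_eq_lintegral_ofReal (integrable_gradSq hξ hw hg hm hμ hℓ₀ hℓ₁ K S k)
      (Filter.Eventually.of_forall (h0 k))).symm
  have hI : ∀ k, 0 ≤ ∫ ω, P.gradSq τ T K S x₀ y₀ ξ k ω ∂Pr := fun k => integral_nonneg (h0 k)
  simp only [hG] at h
  have hα2 : 0 ≤ S.alpha K / 2 := by linarith
  have hsum : P.lyapunov Pr τ T (S.alpha K) (S.beta T K) x₀ y₀ ξ b κ n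
      + ENNReal.ofReal (S.alpha K / 2 * ∑ k ∈ Finset.range n,
          ∫ ω, P.gradSq τ T K S x₀ y₀ ξ k ω ∂Pr)
      ≤ P.lyapunov Pr τ T (S.alpha K) (S.beta T K) x₀ y₀ ξ b κ 0 + ENNReal.ofReal (n * N) := by
    induction n with
    | zero => simp
    | succ n ih =>
      have hs : 0 ≤ ∑ k ∈ Finset.range n, ∫ ω, P.gradSq τ T K S x₀ y₀ ξ k ω ∂Pr :=
        Finset.sum_nonneg fun k _ => hI k
      rw [Finset.sum_range_succ, mul_add, ENNReal.ofReal_add (mul_nonneg hα2 hs)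
        (mul_nonneg hα2 (hI n)), ENNReal.ofReal_mul (q := ∫ ω, P.gradSq τ T K S x₀ y₀ ξ n ω ∂Pr) hα2]
      push_cast
      rw [add_mul, one_mul, ENNReal.ofReal_add (by positivity) hN]
      calc _ = P.lyapunov Pr τ T (S.alpha K) (S.beta T K) x₀ y₀ ξ b κ (n + 1)
              + ENNReal.ofReal (S.alpha K / 2)
                * ENNReal.ofReal (∫ ω, P.gradSq τ T K S x₀ y₀ ξ n ω ∂Pr)
              + ENNReal.ofReal (S.alpha K / 2 * ∑ k ∈ Finset.range n,
                ∫ ω, P.gradSq τ T K S x₀ y₀ ξ k ω ∂Pr) := by ring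
        _ ≤ P.lyapunov Pr τ T (S.alpha K) (S.beta T K) x₀ y₀ ξ b κ n + ENNReal.ofReal N
              + ENNReal.ofReal (S.alpha K / 2 * ∑ k ∈ Finset.range n,
                ∫ ω, P.gradSq τ T K S x₀ y₀ ξ k ω ∂Pr) := add_le_add (h n) le_rfl
        _ = P.lyapunov Pr τ T (S.alpha K) (S.beta T K) x₀ y₀ ξ b κ n
              + ENNReal.ofReal (S.alpha K / 2 * ∑ k ∈ Finset.range n,
                ∫ ω, P.gradSq τ T K S x₀ y₀ ξ k ω ∂Pr) + ENNReal.ofReal N := by ring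
        _ ≤ _ := by rw [← add_assoc]; gcongr
  have hV : P.lyapunov Pr τ T (S.alpha K) (S.beta T K) x₀ y₀ ξ b κ 0
      = ENNReal.ofReal (P.outer x₀ - b + 1 / κ * ‖y₀ - P.yStar x₀‖ ^ 2) := by
    simp [lyapunov, iterate, fedNest]
  have hV0 : 0 ≤ P.outer x₀ - b + 1 / κ * ‖y₀ - P.yStar x₀‖ ^ 2 :=
    add_nonneg (sub_nonneg.2 (hb _)) (by positivity)
  rw [hV, ← ENNReal.ofReal_add hV0 (by positivity)] at hsum
  exact (ENNReal.ofReal_le_ofReal_iff (by positivity)).1 (le_add_self.trans hsum)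

end Problem

/-! ### Choice of step sizes, the rate, and the sample count. -/

section Parameters

variable {ℓ₀ ℓ₁ ℓ₂ σ c : ℝ}

theorem errCoef_pos (hℓ₁ : 0 < ℓ₁) (hℓ₂ : 0 ≤ ℓ₂) : 0 < errCoef ℓ₀ ℓ₁ ℓ₂ σ := by
  rw [errCoef]; positivity

theorem noiseCoef_nonneg (hℓ₁ : 0 < ℓ₁) (hℓ₂ : 0 ≤ ℓ₂) : 0 ≤ noiseCoef ℓ₀ ℓ₁ ℓ₂ σ := by
  rw [noiseCoef]; positivity

/-- The largest outer step size, in units of `κ⁻²`. -/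
noncomputable def stepScale (ℓ₀ ℓ₁ ℓ₂ σ c : ℝ) : ℝ :=
  1 / (1 + 2 * ℓ₁ + 2 * errCoef ℓ₀ ℓ₁ ℓ₂ σ + 28 * errCoef ℓ₀ ℓ₁ ℓ₂ σ * c)

theorem stepScale_pos (hℓ₁ : 0 < ℓ₁) (hℓ₂ : 0 ≤ ℓ₂) (hc : 0 < c) :
    0 < stepScale ℓ₀ ℓ₁ ℓ₂ σ c := by
  have := errCoef_pos (ℓ₀ := ℓ₀) (σ := σ) hℓ₁ hℓ₂
  rw [stepScale]; positivity

/-- With ακ² at most this scale, the four bounds give in turn ακ² ≤ 1, 2αℓ₁ ≤ 1, Tβμ ≤ 1 and 14βℓ₁²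
≤ μ. The last one uses κ ≤ cT. -/
theorem stepScale_bounds (hℓ₁ : 0 < ℓ₁) (hℓ₂ : 0 ≤ ℓ₂) (hc : 0 < c) :
    stepScale ℓ₀ ℓ₁ ℓ₂ σ c ≤ 1 ∧ 2 * stepScale ℓ₀ ℓ₁ ℓ₂ σ c * ℓ₁ ≤ 1 ∧
      2 * errCoef ℓ₀ ℓ₁ ℓ₂ σ * stepScale ℓ₀ ℓ₁ ℓ₂ σ c ≤ 1 ∧
      28 * errCoef ℓ₀ ℓ₁ ℓ₂ σ * stepScale ℓ₀ ℓ₁ ℓ₂ σ c * c ≤ 1 := by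
  have he := errCoef_pos (ℓ₀ := ℓ₀) (σ := σ) hℓ₁ hℓ₂
  have hδ := stepScale_pos (ℓ₀ := ℓ₀) (σ := σ) hℓ₁ hℓ₂ hc
  have h1 : stepScale ℓ₀ ℓ₁ ℓ₂ σ c
      * (1 + 2 * ℓ₁ + 2 * errCoef ℓ₀ ℓ₁ ℓ₂ σ + 28 * errCoef ℓ₀ ℓ₁ ℓ₂ σ * c) = 1 := by
    rw [stepScale]; exact one_div_mul_cancel (by positivity)
  set δ := stepScale ℓ₀ ℓ₁ ℓ₂ σ c
  set e := errCoef ℓ₀ ℓ₁ ℓ₂ σ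
  have h2 : 0 < δ * ℓ₁ := by positivity
  have h3 : 0 < δ * e := by positivity
  have h4 : 0 < δ * e * c := by positivity
  refine ⟨?_, ?_, ?_, ?_⟩ <;> nlinarith

/-- The step size constants of FedNest for condition number `κ`. -/
noncomputable def stepParams (ℓ₀ ℓ₁ ℓ₂ σ c κ : ℝ) (hℓ₁ : 0 < ℓ₁) (hℓ₂ : 0 ≤ ℓ₂) (hc : 0 < c)
    (hκ : 0 < κ) : StepParams where
  a₁ := stepScale ℓ₀ ℓ₁ ℓ₂ σ c / κ ^ 2
  a₂ := stepScale ℓ₀ ℓ₁ ℓ₂ σ c / κ ^ 2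
  a₃ := stepScale ℓ₀ ℓ₁ ℓ₂ σ c / κ ^ 2
  a := 1 / κ
  b := 2 * errCoef ℓ₀ ℓ₁ ℓ₂ σ * κ ^ 2 / ℓ₁
  a₁_pos := div_pos (stepScale_pos hℓ₁ hℓ₂ hc) (by positivity)
  a₂_pos := div_pos (stepScale_pos hℓ₁ hℓ₂ hc) (by positivity)
  a₃_pos := div_pos (stepScale_pos hℓ₁ hℓ₂ hc) (by positivity)
  a_pos := by positivity
  b_pos := by
    have := errCoef_pos (ℓ₀ := ℓ₀) (σ := σ) hℓ₁ hℓ₂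
    positivity

theorem stepParams_alpha {κ : ℝ} (hℓ₁ : 0 < ℓ₁) (hℓ₂ : 0 ≤ ℓ₂) (hc : 0 < c) (hκ : 0 < κ) (K : ℕ) :
    (stepParams ℓ₀ ℓ₁ ℓ₂ σ c κ hℓ₁ hℓ₂ hc hκ).alpha K
      = min (stepScale ℓ₀ ℓ₁ ℓ₂ σ c / κ ^ 2) (1 / κ / √(K : ℝ)) := by
  simp [StepParams.alpha, stepParams]

/-- Coefficient of the total noise per round. -/
noncomputable def roundNoise (ℓ₀ ℓ₁ ℓ₂ σ c : ℝ) : ℝ :=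
  864 * errCoef ℓ₀ ℓ₁ ℓ₂ σ ^ 2 * c * σ ^ 2 / ℓ₁ ^ 2 + noiseCoef ℓ₀ ℓ₁ ℓ₂ σ

/-- The constant of the convergence rate. -/
noncomputable def rateConst (ℓ₀ ℓ₁ ℓ₂ σ c : ℝ) : ℝ :=
  2 + 2 / stepScale ℓ₀ ℓ₁ ℓ₂ σ c + 4 * roundNoise ℓ₀ ℓ₁ ℓ₂ σ c

theorem roundNoise_nonneg (hℓ₁ : 0 < ℓ₁) (hℓ₂ : 0 ≤ ℓ₂) (hc : 0 < c) :
    0 ≤ roundNoise ℓ₀ ℓ₁ ℓ₂ σ c := by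
  have := noiseCoef_nonneg (ℓ₀ := ℓ₀) (σ := σ) hℓ₁ hℓ₂
  rw [roundNoise]; positivity

theorem one_le_rateConst (hℓ₁ : 0 < ℓ₁) (hℓ₂ : 0 ≤ ℓ₂) (hc : 0 < c) :
    1 ≤ rateConst ℓ₀ ℓ₁ ℓ₂ σ c := by
  have h1 := roundNoise_nonneg (ℓ₀ := ℓ₀) (σ := σ) hℓ₁ hℓ₂ hc
  have h2 : 0 < 2 / stepScale ℓ₀ ℓ₁ ℓ₂ σ c := div_pos two_pos (stepScale_pos hℓ₁ hℓ₂ hc)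
  rw [rateConst]; linarith

/-- Since β is proportional to 1/T, the noise Tβ² of T inner calls carries κ/T ≤ c, and the weight
1/κ + αe ≤ 2/κ brings κ³ down to κ². The constant is 864 = 2·108·4. -/
theorem round_noise_arith {e n ℓ κ α β T c σ : ℝ} (hℓ : 0 < ℓ) (hκ : 0 < κ)
    (hT : 0 < T) (hκT : κ ≤ c * T) (hβ : β = 2 * e * κ ^ 2 / ℓ * α / T)
    (heα : α * e ≤ 1 / κ) :
    (1 / κ + α * e) * (T * (108 * β ^ 2 * σ ^ 2)) + n * κ ^ 2 * α ^ 2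
      ≤ (864 * e ^ 2 * c * σ ^ 2 / ℓ ^ 2 + n) * κ ^ 2 * α ^ 2 := by
  have h1 : T * β ^ 2 = 4 * e ^ 2 * κ ^ 3 * α ^ 2 / ℓ ^ 2 * (κ / T) := by
    rw [hβ]; field_simp; ring
  have h2 : κ / T ≤ c := (div_le_iff₀ hT).2 hκT
  have h3 : T * (108 * β ^ 2 * σ ^ 2)
      ≤ 108 * σ ^ 2 * (4 * e ^ 2 * κ ^ 3 * α ^ 2 / ℓ ^ 2 * c) := by
    rw [show T * (108 * β ^ 2 * σ ^ 2) = 108 * σ ^ 2 * (T * β ^ 2) by ring, h1]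
    gcongr
  have h4 : (1 / κ + α * e) * (T * (108 * β ^ 2 * σ ^ 2))
      ≤ (2 / κ) * (108 * σ ^ 2 * (4 * e ^ 2 * κ ^ 3 * α ^ 2 / ℓ ^ 2 * c)) := by
    refine mul_le_mul ?_ h3 (by positivity) (by positivity)
    calc 1 / κ + α * e ≤ 1 / κ + 1 / κ := by linarith
      _ = 2 / κ := by ring
  have h5 : (2 / κ) * (108 * σ ^ 2 * (4 * e ^ 2 * κ ^ 3 * α ^ 2 / ℓ ^ 2 * c))
      = 864 * e ^ 2 * c * σ ^ 2 / ℓ ^ 2 * κ ^ 2 * α ^ 2 := by field_simp; ring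
  linarith

/-- For a minimum, 1/α is at most the sum of the two reciprocals, which handles the initial gap; the
noise uses only α ≤ 1/(κ√K). The K + 1 rounds are absorbed through K + 1 ≤ 2K. -/
theorem rate_arith {A Δ δ κ R K : ℝ} {α : ℝ} (hδ : 0 < δ) (hκ : 0 < κ) (hR : 0 ≤ R) (hK : 1 ≤ K)
    (hΔ : 1 ≤ Δ) (hα : α = min (δ / κ ^ 2) (1 / κ / √K))
    (hA : α / 2 * A ≤ Δ + (K + 1) * (R * κ ^ 2 * α ^ 2)) :
    1 / K * A ≤ (2 + 2 / δ + 4 * R) * Δ * (κ ^ 2 / K + κ / √K) := by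
  have hK0 : 0 < K := by linarith
  have hs : 0 < √K := Real.sqrt_pos.2 hK0
  have hα0 : 0 < α := by rw [hα]; exact lt_min (by positivity) (by positivity)
  have h1 : 1 / α ≤ κ ^ 2 / δ + κ * √K := by
    rcases min_choice (δ / κ ^ 2) (1 / κ / √K) with h | h
    · rw [hα, h, one_div_div]
      have : 0 ≤ κ * √K := by positivity
      linarith
    · have h' : 1 / (1 / κ / √K) = κ * √K := by field_simp
      rw [hα, h, h']
      have : 0 ≤ κ ^ 2 / δ := by positivity
      linarith
  have h2 : κ ^ 2 * α ≤ κ / √K := by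
    calc κ ^ 2 * α ≤ κ ^ 2 * (1 / κ / √K) := by
          gcongr; rw [hα]; exact min_le_right _ _
      _ = κ / √K := by field_simp
  have h3 : A ≤ 2 * (1 / α) * Δ + 2 * (K + 1) * R * (κ ^ 2 * α) := by
    have h4 : A = 2 / α * (α / 2 * A) := by field_simp
    have h5 : 2 * (1 / α) * Δ + 2 * (K + 1) * R * (κ ^ 2 * α)
        = 2 / α * (Δ + (K + 1) * (R * κ ^ 2 * α ^ 2)) := by field_simp
    rw [h4, h5]
    exact mul_le_mul_of_nonneg_left hA (by positivity)
  have h4 : A ≤ 2 * (κ ^ 2 / δ + κ * √K) * Δ + 2 * (2 * K) * R * (κ / √K) := by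
    refine h3.trans (add_le_add (by gcongr) ?_)
    gcongr
    linarith
  have hsq : √K * √K = K := Real.mul_self_sqrt hK0.le
  have h5 : 1 / K * (2 * (κ ^ 2 / δ + κ * √K) * Δ + 2 * (2 * K) * R * (κ / √K))
      = 2 / δ * Δ * (κ ^ 2 / K) + (2 * Δ + 4 * R) * (κ / √K) := by
    have : κ * √K / K = κ / √K := by
      rw [div_eq_div_iff hK0.ne' hs.ne', mul_assoc, hsq]
    calc _ = 2 / δ * Δ * (κ ^ 2 / K) + 2 * Δ * (κ * √K / K) + 4 * R * (κ / √K) * (K / K) := by ring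
      _ = _ := by rw [this, div_self hK0.ne']; ring
  have hu : 0 ≤ κ ^ 2 / K := by positivity
  have hv : 0 ≤ κ / √K := by positivity
  have hd : 0 ≤ 2 / δ := by positivity
  calc 1 / K * A ≤ 2 / δ * Δ * (κ ^ 2 / K) + (2 * Δ + 4 * R) * (κ / √K) := by
        rw [← h5]; gcongr
    _ ≤ (2 + 2 / δ + 4 * R) * Δ * (κ ^ 2 / K) + (2 + 2 / δ + 4 * R) * Δ * (κ / √K) := by
        gcongr ?_ * _ + ?_ * _
        · gcongr; linarith
        · nlinarith [mul_nonneg hd (by linarith : 0 ≤ Δ), mul_le_mul_of_nonneg_left hΔ hR]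
    _ = _ := by ring

/-- A number of rounds for which the rate is below the target accuracy. -/
theorem exists_rounds {C Δ κ ε : ℝ} (hC : 1 ≤ C) (hΔ : 1 ≤ Δ) (hκ : 1 ≤ κ) (hε : 0 < ε)
    (hε1 : ε ≤ 1) :
    ∃ K : ℕ, 1 ≤ K ∧ C * Δ * (κ ^ 2 / K + κ / √(K : ℝ)) ≤ ε ∧
      (K : ℝ) ≤ 5 * C ^ 2 * Δ ^ 2 * (κ ^ 2 / ε ^ 2) := by
  set A := C * Δ * κ / ε with hA
  have hCΔ : 1 ≤ C * Δ := one_le_mul_of_one_le_of_one_le hC hΔ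
  have hCΔκ : 1 ≤ C * Δ * κ := one_le_mul_of_one_le_of_one_le hCΔ hκ
  have hA1 : 1 ≤ A := by rw [hA, le_div_iff₀ hε]; linarith
  have hA2 : 1 ≤ A ^ 2 := one_le_pow₀ hA1
  have hK1 : 4 * A ^ 2 ≤ (⌈4 * A ^ 2⌉₊ : ℝ) := Nat.le_ceil _
  have hK2 : (⌈4 * A ^ 2⌉₊ : ℝ) < 4 * A ^ 2 + 1 := Nat.ceil_lt_add_one (by positivity)
  set K := ⌈4 * A ^ 2⌉₊ with hK
  have hK0 : (0 : ℝ) < K := by linarith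
  refine ⟨K, Nat.cast_pos.1 hK0, ?_, ?_⟩
  · have hs : 2 * A ≤ √(K : ℝ) := Real.le_sqrt_of_sq_le (by nlinarith)
    have h1 : κ / √(K : ℝ) ≤ κ / (2 * A) := by gcongr
    have h2 : κ ^ 2 / K ≤ κ ^ 2 / (4 * A ^ 2) := by gcongr
    have h3 : C * Δ * (κ / (2 * A)) = ε / 2 := by rw [hA]; field_simp
    have h4 : C * Δ * (κ ^ 2 / (4 * A ^ 2)) = ε * ε / (4 * (C * Δ)) := by rw [hA]; field_simp
    have h5 : ε * ε / (4 * (C * Δ)) ≤ ε / 2 := by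
      rw [div_le_div_iff₀ (by positivity) two_pos]
      nlinarith
    calc _ ≤ C * Δ * (κ ^ 2 / (4 * A ^ 2) + κ / (2 * A)) := by gcongr
      _ ≤ ε := by rw [mul_add, h3, h4]; linarith
  · calc (K : ℝ) ≤ 5 * A ^ 2 := by linarith
      _ = _ := by rw [hA]; ring

theorem card_samplesUsed {m : ℕ} (τ : Fin m → ℕ) (T K : ℕ) :
    (samplesUsed τ T K).card = K * ((T + 1) * ∑ i, (τ i + 1)) := by
  simp [samplesUsed, Finset.card_product, Finset.card_sigma, Finset.card_insertNone]

theorem card_samplesUsed_le {m : ℕ} {τ : Fin m → ℕ} (hτ : ∀ i, 1 ≤ τ i) {T : ℕ} (hT : 1 ≤ T)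
    (K : ℕ) : ((samplesUsed τ T K).card : ℝ) ≤ 4 * K * T * ∑ i, (τ i : ℝ) := by
  rw [card_samplesUsed]
  have h1 : ∑ i, (τ i + 1) ≤ 2 * ∑ i, τ i := by
    rw [Finset.mul_sum]
    exact Finset.sum_le_sum fun i _ => by have := hτ i; omega
  have h2 : K * ((T + 1) * ∑ i, (τ i + 1)) ≤ K * ((2 * T) * (2 * ∑ i, τ i)) := by
    gcongr; omega
  calc _ ≤ ((K * ((2 * T) * (2 * ∑ i, τ i)) : ℕ) : ℝ) := by exact_mod_cast h2
    _ = _ := by push_cast; ring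

end Parameters

/-! ### The convergence rate with the chosen step sizes. -/

namespace Problem

variable {d₁ d₂ m : ℕ} {Ξ Ω : Type*} [MeasurableSpace Ξ] [MeasurableSpace Ω]
  {P : Problem d₁ d₂ m Ξ} {Pr : Measure Ω} [IsProbabilityMeasure Pr] {ℓ₀ ℓ₁ ℓ₂ μ σ c κ : ℝ}
  {τ : Fin m → ℕ} {ξ : SampleIdx m → Ω → Ξ} {T : ℕ} {x₀ : Vec d₁} {y₀ : Vec d₂}

theorem one_le_initGap (hb : BddBelow (Set.range P.outer)) (x₀ : Vec d₁) (y₀ : Vec d₂) :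
    1 ≤ P.initGap x₀ y₀ := by
  have h1 := ciInf_le hb x₀
  have h2 := sq_nonneg ‖y₀ - P.yStar x₀‖
  rw [initGap]
  linarith

theorem avgGradSq_le (hξ : IsSampling P Pr ξ) (hw : P.WellBehaved ℓ₀ ℓ₁ ℓ₂ μ)
    (hg : P.GoodSamples σ) (hm : 0 < m) (hμ : 0 < μ) (hℓ₀ : 0 ≤ ℓ₀) (hℓ₁ : 0 < ℓ₁)
    (hℓ₂ : 0 ≤ ℓ₂) (hσ : 0 ≤ σ) (hc : 0 < c) (hτ : ∀ i, 1 ≤ τ i) (hκ : κ = ℓ₁ / μ) (hκ1 : 1 ≤ κ)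
    (hκ0 : 0 < κ) (hκT : κ ≤ c * T) (hb : BddBelow (Set.range P.outer)) {K : ℕ} (hK : 1 ≤ K) :
    P.avgGradSq τ T K (stepParams ℓ₀ ℓ₁ ℓ₂ σ c κ hℓ₁ hℓ₂ hc hκ0) x₀ y₀ Pr ξ
      ≤ rateConst ℓ₀ ℓ₁ ℓ₂ σ c * P.initGap x₀ y₀ * (κ ^ 2 / K + κ / √(K : ℝ)) := by
  set S := stepParams ℓ₀ ℓ₁ ℓ₂ σ c κ hℓ₁ hℓ₂ hc hκ0 with hS
  set δ := stepScale ℓ₀ ℓ₁ ℓ₂ σ c with hδ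
  set e := errCoef ℓ₀ ℓ₁ ℓ₂ σ with he
  set α := S.alpha K with hα
  set β := S.beta T K with hβ
  have hαmin : α = min (δ / κ ^ 2) (1 / κ / √(K : ℝ)) := stepParams_alpha hℓ₁ hℓ₂ hc hκ0 K
  have hβe : β = 2 * e * κ ^ 2 / ℓ₁ * α / T := rfl
  have hδ0 : 0 < δ := stepScale_pos hℓ₁ hℓ₂ hc
  have he0 : 0 < e := errCoef_pos hℓ₁ hℓ₂
  obtain ⟨hδ1, hδ2, hδ3, hδ4⟩ :=
    stepScale_bounds (ℓ₀ := ℓ₀) (ℓ₁ := ℓ₁) (ℓ₂ := ℓ₂) (σ := σ) (c := c) hℓ₁ hℓ₂ hc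
  rw [← hδ] at hδ1 hδ2 hδ3 hδ4
  rw [← he] at hδ3 hδ4
  have hK0 : (0 : ℝ) < K := Nat.cast_pos.2 hK
  have hT0 : (0 : ℝ) < T := by
    by_contra h
    have : c * (T : ℝ) ≤ 0 := mul_nonpos_of_nonneg_of_nonpos hc.le (not_lt.1 h)
    linarith
  have hα0 : 0 < α := by
    rw [hαmin]
    exact lt_min (by positivity) (by have := Real.sqrt_pos.2 hK0; positivity)
  have hακδ : α * κ ^ 2 ≤ δ := by
    rw [← le_div_iff₀ (by positivity), hαmin]
    exact min_le_left _ _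
  have hμκ : μ = ℓ₁ / κ := by rw [hκ]; field_simp
  have hμℓ : μ ≤ ℓ₁ := by rw [hμκ]; exact div_le_self hℓ₁.le hκ1
  have hκ2 : κ ≤ κ ^ 2 := by nlinarith
  have hακ1 : α * κ ≤ δ := (mul_le_mul_of_nonneg_left hκ2 hα0.le).trans hακδ
  have hαδ : α ≤ δ := by nlinarith
  have hβ0 : 0 ≤ β := by rw [hβe]; positivity
  -- The constant b in β = bα/T was chosen for this identity: T inner calls contract by 1 − eακ.
  have hTβ : T * (β * μ) = 2 * e * (α * κ) := by rw [hβe, hμκ]; field_simp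
  have hβμ : 14 * β * ℓ₁ ^ 2 ≤ μ := by
    have h1 : 14 * β * ℓ₁ ^ 2 * T = 28 * e * (α * κ ^ 2) * ℓ₁ := by rw [hβe]; field_simp; ring
    have h2 : 28 * e * (α * κ ^ 2) * c ≤ 1 :=
      le_trans (by gcongr) hδ4
    have h3 : 28 * e * (α * κ ^ 2) * κ ≤ T := by
      calc 28 * e * (α * κ ^ 2) * κ ≤ 28 * e * (α * κ ^ 2) * (c * T) := by gcongr
        _ = 28 * e * (α * κ ^ 2) * c * T := by ring
        _ ≤ 1 * T := by gcongr
        _ = T := one_mul _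
    rw [hμκ, le_div_iff₀ hκ0]
    refine le_of_mul_le_mul_right ?_ hT0
    calc 14 * β * ℓ₁ ^ 2 * κ * T = 28 * e * (α * κ ^ 2) * κ * ℓ₁ := by
          rw [show 14 * β * ℓ₁ ^ 2 * κ * T = 14 * β * ℓ₁ ^ 2 * T * κ by ring, h1]; ring
      _ ≤ T * ℓ₁ := by gcongr
      _ = ℓ₁ * T := mul_comm _ _
  have hβℓ : 2 * β * ℓ₁ ≤ 1 := by
    have : 14 * β * ℓ₁ * ℓ₁ ≤ 1 * ℓ₁ := by nlinarith
    have := le_of_mul_le_mul_right this hℓ₁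
    nlinarith [mul_nonneg hβ0 hℓ₁.le]
  have heακ : 2 * e * (α * κ) ≤ 1 := le_trans (by gcongr) hδ3
  have heα : α * e ≤ 1 / κ := by
    rw [le_div_iff₀ hκ0]; nlinarith [mul_pos (mul_pos he0 hα0) hκ0]
  set R := roundNoise ℓ₀ ℓ₁ ℓ₂ σ c with hR
  have hR0 : 0 ≤ R := roundNoise_nonneg hℓ₁ hℓ₂ hc
  have hbi : ∀ x, ⨅ x, P.outer x ≤ P.outer x := fun x => ciInf_le hb x
  have hcon : (1 / κ + α * e) * (1 - T * (β * μ) / 2) ≤ 1 / κ := by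
    rw [hTβ]
    -- With that choice the product is a difference of squares, (1/κ)(1 + eακ)(1 − eακ).
    have h1 : (1 / κ + α * e) * (1 - 2 * e * (α * κ) / 2) = 1 / κ - α ^ 2 * e ^ 2 * κ := by
      field_simp; ring
    rw [h1]
    have : 0 ≤ α ^ 2 * e ^ 2 * κ := by positivity
    linarith
  -- The average runs over k = 1, …, K, so the telescoped sum is taken over 0, …, K, that is over K
  -- + 1 rounds, and its term at 0 is discarded.
  have hmain := sum_integral_gradSq_le (τ := τ) (T := T) (x₀ := x₀) (y₀ := y₀) (K := K) (S := S)
    (N := R * κ ^ 2 * α ^ 2) hξ hw hg hm hμ hℓ₀ hℓ₁.le hbi hκ0 (by positivity) hα0.le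
    (fun k => lyapunov_succ_add_le hξ hw hg hm hμ hℓ₀ hℓ₁ hℓ₂ hσ hτ hκ hκ1 hα0.le
      (le_trans (by gcongr) hδ2) (hακδ.trans hδ1) hβ0 hβℓ hβμ (hTβ.le.trans heακ) hcon
      (round_noise_arith hℓ₁ hκ0 hT0 hκT hβe heα) hbi k) (K + 1)
  have hI : ∀ k, 0 ≤ ∫ ω, P.gradSq τ T K S x₀ y₀ ξ k ω ∂Pr := fun k =>
    integral_nonneg fun ω => sq_nonneg _
  have hsub : ∑ k ∈ Finset.Icc 1 K, ∫ ω, P.gradSq τ T K S x₀ y₀ ξ k ω ∂Pr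
      ≤ ∑ k ∈ Finset.range (K + 1), ∫ ω, P.gradSq τ T K S x₀ y₀ ξ k ω ∂Pr :=
    Finset.sum_le_sum_of_subset_of_nonneg
      (fun k hk => Finset.mem_range.2 (Nat.lt_succ_of_le (Finset.mem_Icc.1 hk).2)) fun k _ _ => hI k
  refine rate_arith (Δ := P.initGap x₀ y₀) hδ0 hκ0 hR0 (by exact_mod_cast hK)
    (one_le_initGap hb x₀ y₀) hαmin ?_
  calc _ ≤ α / 2 * ∑ k ∈ Finset.range (K + 1), ∫ ω, P.gradSq τ T K S x₀ y₀ ξ k ω ∂Pr := by gcongr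
    _ ≤ _ := hmain
    _ ≤ _ := by
      push_cast
      gcongr
      rw [initGap]
      have h1 : 1 / κ * ‖y₀ - P.yStar x₀‖ ^ 2 ≤ 1 * ‖y₀ - P.yStar x₀‖ ^ 2 := by
        gcongr
        exact (div_le_one hκ0).2 hκ1
      linarith

end Problem

end FedNest

/-! ### The main theorem. -/

theorem corollary2
    (ℓ₀ ℓ₁ ℓ₂ σ c : ℝ) (hℓ₀ : 0 ≤ ℓ₀) (hℓ₁ : 0 < ℓ₁) (hℓ₂ : 0 ≤ ℓ₂) (hσ : 0 ≤ σ) (hc : 0 < c) :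
    ∃ C : ℝ, 0 < C ∧
      ∀ (μ κ : ℝ) (T : ℕ), 0 < μ → κ = ℓ₁ / μ → κ ≤ c * T → (T : ℝ) ≤ c * κ →
      ∃ S : FedNest.StepParams,
        ∀ (d₁ d₂ m : ℕ) (Ξ : Type*) [MeasurableSpace Ξ] (P : FedNest.Problem d₁ d₂ m Ξ)
          (τ : Fin m → ℕ) (x₀ : FedNest.Vec d₁) (y₀ : FedNest.Vec d₂)
          (Ω : Type*) [MeasurableSpace Ω] (Pr : Measure Ω) [IsProbabilityMeasure Pr]
          (ξ : FedNest.SampleIdx m → Ω → Ξ),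
          0 < d₂ → 0 < m → (∀ i, 1 ≤ τ i) →
          P.WellBehaved ℓ₀ ℓ₁ ℓ₂ μ → P.GoodSamples σ → BddBelow (Set.range P.outer) →
          FedNest.IsSampling P Pr ξ →
          (∀ x, IsMaxOn (P.obj x) Set.univ (P.yStar x)) ∧
          Differentiable ℝ P.outer ∧
          (∀ K : ℕ, 1 ≤ K →
            (∀ k ∈ Finset.Icc 1 K, Integrable (P.gradSq τ T K S x₀ y₀ ξ k) Pr) ∧
            P.avgGradSq τ T K S x₀ y₀ Pr ξ
              ≤ C * P.initGap x₀ y₀ * (κ ^ 2 / K + κ / √(K : ℝ))) ∧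
          (∀ ε : ℝ, 0 < ε → ε ≤ 1 →
            ∃ K : ℕ, 1 ≤ K ∧
              P.avgGradSq τ T K S x₀ y₀ Pr ξ ≤ ε ∧
              (K : ℝ) ≤ C * P.initGap x₀ y₀ ^ 2 * (κ ^ 2 / ε ^ 2) ∧
              ((FedNest.samplesUsed τ T K).card : ℝ)
                ≤ C * P.initGap x₀ y₀ ^ 2 * (∑ i, (τ i : ℝ)) * (κ ^ 3 / ε ^ 2)) := by
  set C₀ := FedNest.rateConst ℓ₀ ℓ₁ ℓ₂ σ c with hC₀
  have hC1 : 1 ≤ C₀ := FedNest.one_le_rateConst hℓ₁ hℓ₂ hc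
  have hCsq : C₀ ≤ C₀ ^ 2 := by nlinarith
  -- The round count needs 5C₀². The sample count multiplies it by 4, from T + 1 ≤ 2T and τ_i + 1 ≤
  -- 2τ_i, and by c, from T ≤ cκ.
  refine ⟨20 * C₀ ^ 2 * (1 + c), by positivity, fun μ κ T hμ hκ hκT hTκ => ?_⟩
  have hκ0 : 0 < κ := by rw [hκ]; positivity
  refine ⟨FedNest.stepParams ℓ₀ ℓ₁ ℓ₂ σ c κ hℓ₁ hℓ₂ hc hκ0, ?_⟩
  intro d₁ d₂ m Ξ _ P τ x₀ y₀ Ω _ Pr _ ξ hd hm hτ hw hg hb hξ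
  have hκ1 : 1 ≤ κ := by
    rw [hκ, one_le_div hμ]
    exact (hw.regularSaddle hm).mu_le hd
  have hΔ := FedNest.Problem.one_le_initGap hb x₀ y₀
  have hrate := fun {K : ℕ} (hK : 1 ≤ K) => FedNest.Problem.avgGradSq_le (x₀ := x₀) (y₀ := y₀)
    hξ hw hg hm hμ hℓ₀ hℓ₁ hℓ₂ hσ hc hτ hκ hκ1 hκ0 hκT hb hK
  have hT : 1 ≤ T := by
    rcases Nat.eq_zero_or_pos T with h | h
    · rw [h, Nat.cast_zero, mul_zero] at hκT
      linarith
    · exact h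
  refine ⟨hw.isArgmax_yStar hm hμ, hw.differentiable_outer hm hμ hℓ₁.le, fun K hK =>
    ⟨fun k _ => FedNest.Problem.integrable_gradSq hξ hw hg hm hμ hℓ₀ hℓ₁.le K _ k,
      (hrate hK).trans ?_⟩, fun ε hε hε1 => ?_⟩
  · have : C₀ ≤ 20 * C₀ ^ 2 * (1 + c) := by nlinarith [mul_pos hc (by linarith : 0 < C₀)]
    gcongr
  · obtain ⟨K, hK1, hKε, hKle⟩ := FedNest.exists_rounds hC1 hΔ hκ1 hε hε1
    refine ⟨K, hK1, (hrate hK1).trans hKε, hKle.trans ?_, ?_⟩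
    · have : 5 * C₀ ^ 2 ≤ 20 * C₀ ^ 2 * (1 + c) := by nlinarith [sq_nonneg C₀]
      gcongr
    · have hsum : 0 ≤ ∑ i, (τ i : ℝ) := Finset.sum_nonneg fun i _ => Nat.cast_nonneg _
      calc _ ≤ 4 * K * T * ∑ i, (τ i : ℝ) := FedNest.card_samplesUsed_le hτ hT K
        _ ≤ 4 * (5 * C₀ ^ 2 * P.initGap x₀ y₀ ^ 2 * (κ ^ 2 / ε ^ 2)) * (c * κ)
              * ∑ i, (τ i : ℝ) := by gcongr
        _ = 20 * C₀ ^ 2 * c * P.initGap x₀ y₀ ^ 2 * (∑ i, (τ i : ℝ)) * (κ ^ 3 / ε ^ 2) := by ring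
        _ ≤ _ := by gcongr; linarith
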